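/- Let $d\ge 1$, let $(\Omega_i,\mathcal F^i,\mathbb P_i)$, $i=1,\dots,d$, be probability spaces, and for each $i$ let $(\mathcal F^i_n)_{n\in\mathbb N}$ be an increasing sequence of sub-$\sigma$-algebras with $\mathcal F^i=\sigma(\bigcup_n\mathcal F^i_n)$. Let $(\Omega,\mathcal F,\mathbb P)$ be the product probability space, $\mathcal F_n=\sigma(\prod_{i}\mathcal F^i_n)$, and let $\mathbb E_n$ be the conditional expectation with respect to $\mathcal F_n$. Let $\vec p=(p_1,\dots,p_d)$ with $0<p_i<\infty$ and $$\|g\|_{\vec p}=\Big(\int_{\Omega_d}\cdots\Big(\int_{\Omega_1}|g(x_1,\dots,x_d)|^{p_1}\,dx_1\Big)^{p_2/p_1}\cdots dx_d\Big)^{1/p_d}.$$ Martingales $f=(f_n)_{n\in\mathbb N}$ are real-valued, taken with respect to $(\mathcal F_n)$, and normalised by $f_0=0$; put $d_nf=f_n-f_{n-1}$ (with $f_{-1}=0$), $M(f)=\sup_n|f_n|$, $S_n(f)=\big(\sum_{m\le n}|d_mf|^2\big)^{1/2}$, $S(f)=\big(\sum_{m}|d_mf|^2\big)^{1/2}$.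 Let $H^M_{\vec p}$ and $H^S_{\vec p}$ be the spaces of martingales with $\|f\|_{H^M_{\vec p}}=\|M(f)\|_{\vec p}<\infty$ and $\|f\|_{H^S_{\vec p}}=\|S(f)\|_{\vec p}<\infty$, respectively. Let $\mathcal P_{\vec p}$ (resp. $\mathcal Q_{\vec p}$) be the space of martingales $f$ for which there is a non-decreasing, non-negative, adapted sequence $(\lambda_n)_{n\in\mathbb N}$, with limit $\lambda_\infty$, such that a.e. $|f_n|\le\lambda_{n-1}$ (resp. $S_n(f)\le\lambda_{n-1}$) for all $n\ge1$ and $\|\lambda_\infty\|_{\vec p}<\infty$; its quasi-norm is the infimum of $\|\lambda_\infty\|_{\vec p}$ over all such $(\lambda_n)$. An integrable function $a$ is an $(M,\vec p)$-atom (resp. $(S,\vec p)$-atom) with stopping time $\tau:\Omega\to\mathbb N\cup\{\infty\}$ if for every $n$ one has $\mathbb E_na=0$ a.e. on $\{n\le\tau\}$, and $\|M(a)\chi_{\{\tau<\infty\}}\|_\infty\le\|\chi_{\{\tau<\infty\}}\|_{\vec p}^{-1}$ (resp. the same with $S(a)$), where $M(a),S(a)$ are formed for the martingale $(\mathbb E_na)_n$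 and $0^{-1}=\infty$. Suppose that $(\mathcal F_n)$ is regular: there is $R>0$ such that for all $n\ge1$ and $A\in\mathcal F_n$ there is $B\in\mathcal F_{n-1}$ with $A\subset B$ and $\mathbb P(B)\le R\,\mathbb P(A)$. Let $0<t<\min\{p_1,\dots,p_d,1\}$. For sequences $(\mu_k)_{k\in\mathbb Z}$ of real numbers and $(\tau_k)_{k\in\mathbb Z}$ of stopping times put $$A_t(\mu,\tau)=\bigg\|\Big(\sum_{k\in\mathbb Z}\Big(\frac{|\mu_k|\,\chi_{\{\tau_k<\infty\}}}{\|\chi_{\{\tau_k<\infty\}}\|_{\vec p}}\Big)^t\Big)^{1/t}\bigg\|_{\vec p}.$$ Then a martingale $f$ belongs to $H^M_{\vec p}$ (resp. $H^S_{\vec p}$) if and only if there are $(M,\vec p)$-atoms (resp. $(S,\vec p)$-atoms) $a^k$ with stopping times $\tau_k$, and real numbers $\mu_k$ $(k\in\mathbb Z)$, such that $$f_n=\sum_{k\in\mathbb Z}\mu_k\,\mathbb E_na^k\quad\text{a.e., with unconditional convergence, for all } n\in\mathbb N,\qquad A_t(\mu,\tau)<\infty.$$ Moreover there are constants $\alpha,\beta>0$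 such that for all $f\in H^M_{\vec p}$ (resp. $f\in H^S_{\vec p}$), with the infimum taken over all such decompositions of $f$, $$\alpha\,\|f\|_{H^M_{\vec p}}\le\inf A_t(\mu,\tau)\le\beta\,\|f\|_{H^M_{\vec p}}\qquad\Big(\text{resp. with }\|f\|_{H^S_{\vec p}}\Big).$$ Consequently $H^S_{\vec p}=\mathcal Q_{\vec p}$ and $H^M_{\vec p}=\mathcal P_{\vec p}$, with equivalent quasi-norms. -/

import Mathlib

open MeasureTheory Set
open scoped ENNReal NNReal

noncomputable section

namespace MixedHardy

universe u

/-- The mixed `L_p`-(quasi-)norm of a `[0,∞]`-valued function on the product `∏ i, Ω i`: first the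
`L_{p 0}`-norm in the first variable, then the `L_{p 1}`-norm in the second one, and so on, the last
variable being outermost. The exponents are finite. -/
def mixedNorm : {d : ℕ} → (Ω : Fin d → Type u) → (m : ∀ i, MeasurableSpace (Ω i)) →
    (P : ∀ i, Measure (Ω i)) → (p : Fin d → ℝ) → ((∀ i, Ω i) → ℝ≥0∞) → ℝ≥0∞
  | 0, _, _, _, _, g => g (fun i => i.elim0)
  | _ + 1, Ω, m, P, p, g =>
      mixedNorm (fun i => Ω i.succ) (fun i => m i.succ) (fun i => P i.succ) (fun i => p i.succ)
        (fun x => (∫⁻ y, (g (Fin.cons (α := Ω) y x)) ^ (p 0) ∂(P 0)) ^ (1 / p 0))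

/-- The product filtration `F_n = σ(∏ i, F^i_n)` on `∏ i, Ω i`. -/
def prodFiltration {d : ℕ} {Ω : Fin d → Type u} [m : ∀ i, MeasurableSpace (Ω i)]
    (F : ∀ i, Filtration ℕ (m i)) :
    Filtration ℕ (MeasurableSpace.pi : MeasurableSpace (∀ i, Ω i)) where
  seq n := @MeasurableSpace.pi (Fin d) Ω (fun i => F i n)
  mono' _ _ h := iSup_mono fun i => MeasurableSpace.comap_mono ((F i).mono h)
  le' n := iSup_mono fun i => MeasurableSpace.comap_mono ((F i).le n)

section General

variable {X : Type u}

/-- Regularity of a stochastic basis. -/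
def IsRegular {mX : MeasurableSpace X} (G : Filtration ℕ mX) (μ : Measure X) : Prop :=
  ∃ R : ℝ≥0, 0 < R ∧ ∀ (n : ℕ) (A : Set X), MeasurableSet[G (n + 1)] A →
    ∃ B : Set X, MeasurableSet[G n] B ∧ A ⊆ B ∧ μ B ≤ R * μ A

/-- Martingales, normalised by `f_0 = 0`. -/
def IsMart {mX : MeasurableSpace X} (G : Filtration ℕ mX) (μ : Measure X)
    (f : ℕ → X → ℝ) : Prop :=
  Martingale f G μ ∧ f 0 =ᵐ[μ] 0

/-- Martingale differences `d_n f = f_n - f_{n-1}`, where `f_{-1} = 0`. -/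
def mdiff (f : ℕ → X → ℝ) : ℕ → X → ℝ
  | 0, x => f 0 x
  | n + 1, x => f (n + 1) x - f n x

/-- The maximal function `M(f) = sup_n |f_n|`. -/
def maxFn (f : ℕ → X → ℝ) (x : X) : ℝ≥0∞ := ⨆ n, ‖f n x‖ₑ

/-- The partial quadratic variation `S_n(f)`. -/
def sqFnUpTo (f : ℕ → X → ℝ) (n : ℕ) (x : X) : ℝ :=
  Real.sqrt (∑ j ∈ Finset.range (n + 1), |mdiff f j x| ^ 2)

/-- The quadratic variation `S(f)`. -/
def sqFn (f : ℕ → X → ℝ) (x : X) : ℝ≥0∞ := (∑' n, ‖mdiff f n x‖ₑ ^ 2) ^ (1 / 2 : ℝ)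

/-- The class `Λ` of non-decreasing, non-negative, adapted sequences. -/
structure IsControl {mX : MeasurableSpace X} (G : Filtration ℕ mX) (l : ℕ → X → ℝ) : Prop where
  adapted : ∀ n, Measurable[G n] (l n)
  nonneg : ∀ n x, 0 ≤ l n x
  mono : ∀ x, Monotone fun n => l n x

/-- The limit `λ_∞ = lim λ_n` of a sequence of the class `Λ`. -/
def limFn (l : ℕ → X → ℝ) (x : X) : ℝ≥0∞ := ⨆ n, ENNReal.ofReal (l n x)

/-- The set `{τ < ∞}`. -/
def finSet (τ : X → WithTop ℕ) : Set X := {x | τ x < ⊤}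

end General

section Spaces

variable {d : ℕ} {Ω : Fin d → Type u} [m : ∀ i, MeasurableSpace (Ω i)]
  (P : ∀ i, Measure (Ω i)) [∀ i, IsProbabilityMeasure (P i)]
  (F : ∀ i, Filtration ℕ (m i)) (p : Fin d → ℝ)

/-- The quasi-norm of `H^M_p`. -/
def normHM (f : ℕ → (∀ i, Ω i) → ℝ) : ℝ≥0∞ := mixedNorm Ω m P p (maxFn f)

/-- The quasi-norm of `H^S_p`. -/
def normHS (f : ℕ → (∀ i, Ω i) → ℝ) : ℝ≥0∞ := mixedNorm Ω m P p (sqFn f)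

/-- `l ∈ Λ` and `|f_n| ≤ l_{n-1}` for all `n ≥ 1`. -/
def ControlsP (f l : ℕ → (∀ i, Ω i) → ℝ) : Prop :=
  IsControl (prodFiltration F) l ∧ ∀ n, ∀ᵐ x ∂(Measure.pi P), |f (n + 1) x| ≤ l n x

/-- `l ∈ Λ` and `S_n(f) ≤ l_{n-1}` for all `n ≥ 1`. -/
def ControlsQ (f l : ℕ → (∀ i, Ω i) → ℝ) : Prop :=
  IsControl (prodFiltration F) l ∧ ∀ n, ∀ᵐ x ∂(Measure.pi P), sqFnUpTo f (n + 1) x ≤ l n x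

/-- The quasi-norm of `𝒫_p`. -/
def normP (f : ℕ → (∀ i, Ω i) → ℝ) : ℝ≥0∞ :=
  ⨅ (l : ℕ → (∀ i, Ω i) → ℝ) (_ : ControlsP P F f l), mixedNorm Ω m P p (limFn l)

/-- The quasi-norm of `𝒬_p`. -/
def normQ (f : ℕ → (∀ i, Ω i) → ℝ) : ℝ≥0∞ :=
  ⨅ (l : ℕ → (∀ i, Ω i) → ℝ) (_ : ControlsQ P F f l), mixedNorm Ω m P p (limFn l)

/-- The mixed martingale Hardy space `H^M_p`. -/
def spaceHM : Set (ℕ → (∀ i, Ω i) → ℝ) :=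
  {f | IsMart (prodFiltration F) (Measure.pi P) f ∧ normHM P p f < ∞}

/-- The mixed martingale Hardy space `H^S_p`. -/
def spaceHS : Set (ℕ → (∀ i, Ω i) → ℝ) :=
  {f | IsMart (prodFiltration F) (Measure.pi P) f ∧ normHS P p f < ∞}

/-- The mixed martingale Hardy space `𝒫_p`. -/
def spaceP : Set (ℕ → (∀ i, Ω i) → ℝ) :=
  {f | IsMart (prodFiltration F) (Measure.pi P) f ∧
    ∃ l, ControlsP P F f l ∧ mixedNorm Ω m P p (limFn l) < ∞}

/-- The mixed martingale Hardy space `𝒬_p`. -/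
def spaceQ : Set (ℕ → (∀ i, Ω i) → ℝ) :=
  {f | IsMart (prodFiltration F) (Measure.pi P) f ∧
    ∃ l, ControlsQ P F f l ∧ mixedNorm Ω m P p (limFn l) < ∞}

/-- `‖χ_{τ < ∞}‖_p`. -/
def chiNorm (τ : (∀ i, Ω i) → WithTop ℕ) : ℝ≥0∞ :=
  mixedNorm Ω m P p ((finSet τ).indicator 1)

/-- The martingale `(E_n a)_n` of a function `a`. -/
def condMart (a : (∀ i, Ω i) → ℝ) (n : ℕ) : (∀ i, Ω i) → ℝ :=
  (Measure.pi P)[a | prodFiltration F n]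

/-- `a` is a `(T,p)`-atom with associated stopping time `τ`. With `T = maxFn` these are the
`(M,p)`-atoms, with `T = sqFn` the `(S,p)`-atoms. The bound `‖χ_{τ < ∞}‖_p⁻¹` is `∞` if
`{τ < ∞}` is a null set. -/
structure IsAtom (T : (ℕ → (∀ i, Ω i) → ℝ) → (∀ i, Ω i) → ℝ≥0∞)
    (a : (∀ i, Ω i) → ℝ) (τ : (∀ i, Ω i) → WithTop ℕ) : Prop where
  measurable : Measurable a
  integrable : Integrable a (Measure.pi P)
  stopping : IsStoppingTime (prodFiltration F) τ
  vanish : ∀ n : ℕ, ∀ᵐ x ∂(Measure.pi P), (n : WithTop ℕ) ≤ τ x → condMart P F a n x = 0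
  bound : essSup ((finSet τ).indicator (T (condMart P F a))) (Measure.pi P) ≤ (chiNorm P p τ)⁻¹

/-- `f_n = ∑_{k ∈ ℤ} c_k E_n a^k` almost everywhere for all `n`, where `a^k` is a `(T,p)`-atom with
stopping time `τ_k`. -/
structure IsDecomp (T : (ℕ → (∀ i, Ω i) → ℝ) → (∀ i, Ω i) → ℝ≥0∞)
    (f : ℕ → (∀ i, Ω i) → ℝ) (c : ℤ → ℝ) (a : ℤ → (∀ i, Ω i) → ℝ)
    (τ : ℤ → (∀ i, Ω i) → WithTop ℕ) : Prop where
  atom : ∀ k, IsAtom P F p T (a k) (τ k)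
  sum : ∀ n, ∀ᵐ x ∂(Measure.pi P), HasSum (fun k => c k * condMart P F (a k) n x) (f n x)

/-- `‖(∑_k (|c_k| χ_{τ_k < ∞} / ‖χ_{τ_k < ∞}‖_p)^t)^{1/t}‖_p`. -/
def atomicSize (t : ℝ) (c : ℤ → ℝ) (τ : ℤ → (∀ i, Ω i) → WithTop ℕ) : ℝ≥0∞ :=
  mixedNorm Ω m P p fun x =>
    (∑' k, (‖c k‖ₑ * (finSet (τ k)).indicator 1 x / chiNorm P p (τ k)) ^ t) ^ (1 / t)

/-- The infimum of the atomic sizes of all decompositions of `f` into `(T,p)`-atoms. -/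
def atomicInf (T : (ℕ → (∀ i, Ω i) → ℝ) → (∀ i, Ω i) → ℝ≥0∞) (t : ℝ)
    (f : ℕ → (∀ i, Ω i) → ℝ) : ℝ≥0∞ :=
  ⨅ (c : ℤ → ℝ) (a : ℤ → (∀ i, Ω i) → ℝ) (τ : ℤ → (∀ i, Ω i) → WithTop ℕ)
    (_ : IsDecomp P F p T f c a τ), atomicSize P p t c τ

end Spaces

/-- `N₁ ∼ N₂` on `A`: `α N₁ ≤ N₂ ≤ β N₁` with positive constants that do not depend on `f ∈ A`. -/
def EquivOn {E : Type u} (A : Set E) (N₁ N₂ : E → ℝ≥0∞) : Prop :=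
  ∃ α β : ℝ≥0, 0 < α ∧ 0 < β ∧ ∀ f ∈ A, α * N₁ f ≤ N₂ f ∧ N₂ f ≤ β * N₁ f

end MixedHardy

end

noncomputable section

namespace MixedHardy

universe u

/-! Everything is derived from a predictable control: if `f` is a martingale and `T f` is its
maximal function or quadratic variation, the supremum of adapted `t_n`, there is `λ` in the class
`Λ` with `t_{n+1} ≤ λ_n` and `‖λ_∞‖ ≤ C ‖T f‖` in the mixed norm (`exists_control`). Fix `0 < r <
min(p_i, 1)`. Regularity gives `h ≤ R E_n h` for nonnegative `F_{n+1}`-measurable `h`, so `t_{n+1}^r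
≤ R E_n[t_{n+1}^r] ≤ R E_n[(T f)^r]`. The control `λ_n` is the `1/r`-th power of the running maximum
of the middle terms, and its bound is Doob's maximal inequality in the mixed norm with exponents
`p_i / r > 1`.

That inequality (`mixedNorm_doob`) is the hard part: the supremum over `n` is common to all
variables, so the scalar inequality cannot simply be iterated. The induction on the number of
variables (`mixedNorm_maximal`) carries an extra factor `Y` with an outer `L_s`-norm, for every `s >
1`. Absorbing a new variable `Z` into `Y` at its own exponent `q` yields, by Fubini, the inequality
in `L_q(Y; L_q(Z; N))`. The outer exponent is then changed from `q` to `s` by a good-`λ` inequality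
(`MixNorm.good_lambda`): stopping depends on `y` alone, and regularity supplies a predictable
majorant of the norms `N(u_n(·, y))`, to which the scalar Doob inequality applies.

Given a control, `f` is cut into blocks of increments occurring while `2^k < λ_j ≤ 2^{k+1}`. The
block has `T ≤ 3 · 2^k`, vanishes up to the first time `τ_k` at which `λ` exceeds `2^k`, and is
bounded in `L_2`, hence closed by an integrable function, which is a multiple of an atom. Since
`{τ_k < ∞} = {λ_∞ > 2^k}`, the `t`-sum in the atomic size is a geometric series of size `λ_∞^t`.
Conversely, pointwise, `T f` is at most the `ℓ^1`-sum, hence the `ℓ^t`-sum, of the normalised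
indicators; and `T f ≤ λ_∞` for every control. -/

theorem iSup_rpow {ι : Sort*} (f : ι → ℝ≥0∞) {s : ℝ} (hs : 0 < s) :
    (⨆ i, f i) ^ s = ⨆ i, f i ^ s :=
  (ENNReal.orderIsoRpow s hs).map_iSup f

/-! ### Dyadic sums in place of the layer-cake integral. -/

/-- The dyadic sum `∑ 2^{ks}` over all integers `k` with `2^k < L`. -/
def dyadicSum (s : ℝ) (L : ℝ≥0∞) : ℝ≥0∞ :=
  ∑' k : ℤ, if (2 : ℝ≥0∞) ^ k < L then ((2 : ℝ≥0∞) ^ k) ^ s else 0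

theorem two_zpow_pos (k : ℤ) : (0 : ℝ≥0∞) < 2 ^ k :=
  ENNReal.zpow_pos (by norm_num) (by norm_num) k

theorem two_zpow_ne_top (k : ℤ) : (2 : ℝ≥0∞) ^ k ≠ ∞ :=
  (ENNReal.zpow_lt_top (by norm_num) (by norm_num) k).ne

theorem two_zpow_succ (k : ℤ) : (2 : ℝ≥0∞) ^ (k + 1) = 2 * 2 ^ k := by
  rw [ENNReal.zpow_add (by norm_num) (by norm_num), zpow_one, mul_comm]

theorem two_zpow_mono {k l : ℤ} (h : k ≤ l) : (2 : ℝ≥0∞) ^ k ≤ 2 ^ l :=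
  ENNReal.zpow_le_of_le (by norm_num) h

/-- The constant in `dyadicSum_le`. -/
def dyadicConst (s : ℝ) : ℝ≥0 := ((1 - (2 : ℝ≥0∞)⁻¹ ^ s)⁻¹).toNNReal

theorem coe_dyadicConst {s : ℝ} (hs : 0 < s) :
    (dyadicConst s : ℝ≥0∞) = (1 - (2 : ℝ≥0∞)⁻¹ ^ s)⁻¹ := by
  refine ENNReal.coe_toNNReal (ENNReal.inv_ne_top.2 (tsub_pos_of_lt ?_).ne')
  exact ENNReal.rpow_lt_one (by norm_num) hs

theorem one_le_dyadicConst {s : ℝ} (hs : 0 < s) : (1 : ℝ≥0∞) ≤ dyadicConst s := by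
  rw [coe_dyadicConst hs]
  exact ENNReal.one_le_inv.2 tsub_le_self

/-- The nonzero terms form a geometric series of ratio `2^{-s}` going down from the largest `2^n <
L`. -/
theorem dyadicSum_le {s : ℝ} (hs : 0 < s) (L : ℝ≥0∞) :
    dyadicSum s L ≤ dyadicConst s * L ^ s := by
  rcases eq_or_ne L 0 with rfl | h0
  · simp [dyadicSum]
  rcases eq_or_ne L ∞ with rfl | hT
  · rw [ENNReal.top_rpow_of_pos hs, ENNReal.mul_top]
    · exact le_top
    · exact (zero_lt_one.trans_le (one_le_dyadicConst hs)).ne'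
  obtain ⟨n, hn1, hn2⟩ := ENNReal.exists_mem_Ioc_zpow h0 hT (y := 2) (by norm_num) (by norm_num)
  have hinj : Function.Injective fun j : ℕ => n - (j : ℤ) := fun a b h => by
    simp only at h; omega
  have hsupp : Function.support
      (fun k : ℤ => if (2 : ℝ≥0∞) ^ k < L then ((2 : ℝ≥0∞) ^ k) ^ s else 0) ⊆
        Set.range fun j : ℕ => n - (j : ℤ) := by
    intro k hk
    have hk' : (2 : ℝ≥0∞) ^ k < L := by
      by_contra h
      simp [h] at hk
    have : k ≤ n := by
      by_contra h
      exact absurd (hn2.trans (two_zpow_mono (by omega : n + 1 ≤ k))) (not_le.2 hk')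
    exact ⟨(n - k).toNat, by simp only; omega⟩
  rw [dyadicSum, ← hinj.tsum_eq hsupp]
  have hterm : ∀ j : ℕ, (if (2 : ℝ≥0∞) ^ (n - (j : ℤ)) < L
      then ((2 : ℝ≥0∞) ^ (n - (j : ℤ))) ^ s else 0) ≤ L ^ s * ((2 : ℝ≥0∞)⁻¹ ^ s) ^ j := by
    intro j
    split_ifs with h
    · have : (2 : ℝ≥0∞) ^ (n - (j : ℤ)) = 2 ^ n * (2⁻¹) ^ j := by
        rw [sub_eq_add_neg, ENNReal.zpow_add (by norm_num) (by norm_num), ENNReal.zpow_neg,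
          zpow_natCast, ENNReal.inv_pow]
      rw [this, ENNReal.mul_rpow_of_nonneg _ _ hs.le, ← ENNReal.rpow_natCast_mul,
        mul_comm (j : ℝ) s,
        ENNReal.rpow_mul_natCast]
      gcongr
    · exact zero_le
  refine (ENNReal.tsum_le_tsum hterm).trans ?_
  rw [ENNReal.tsum_mul_left, ENNReal.tsum_geometric, coe_dyadicConst hs, mul_comm]

/-- The top term alone suffices, because `L ≤ 2^{n+1}` for the largest `2^n < L`; for `L = ∞` the
terms are unbounded. -/
theorem rpow_le_dyadicSum {s : ℝ} (hs : 0 < s) (L : ℝ≥0∞) :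
    L ^ s ≤ 2 ^ s * dyadicSum s L := by
  have key : ∀ n : ℤ, (2 : ℝ≥0∞) ^ n < L → ((2 : ℝ≥0∞) ^ n) ^ s ≤ dyadicSum s L := fun n hn => by
    refine le_trans ?_ (ENNReal.le_tsum n)
    rw [if_pos hn]
  rcases eq_or_ne L 0 with rfl | h0
  · simp [hs]
  rcases eq_or_ne L ∞ with rfl | hT
  · have : dyadicSum s ∞ = ∞ := by
      refine ENNReal.eq_top_of_forall_nnreal_le fun r => ?_
      obtain ⟨n, hn⟩ := pow_unbounded_of_one_lt (r ^ (1 / s)) (one_lt_two (α := ℝ≥0))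
      have := key n (two_zpow_ne_top _).lt_top
      refine le_trans ?_ this
      rw [zpow_natCast]
      have h2 : ((r : ℝ≥0∞) ^ (1 / s)) ≤ 2 ^ n := by
        rw [← ENNReal.coe_rpow_of_nonneg _ (by positivity)]
        exact_mod_cast hn.le
      calc (r : ℝ≥0∞) = ((r : ℝ≥0∞) ^ (1 / s)) ^ s := by
            rw [← ENNReal.rpow_mul, one_div_mul_cancel hs.ne', ENNReal.rpow_one]
        _ ≤ _ := by gcongr
    rw [this, ENNReal.mul_top]
    · exact le_top
    · simp
  obtain ⟨n, hn1, hn2⟩ := ENNReal.exists_mem_Ioc_zpow h0 hT (y := 2) (by norm_num) (by norm_num)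
  calc L ^ s ≤ (2 ^ (n + 1)) ^ s := by gcongr
    _ = 2 ^ s * (2 ^ n) ^ s := by
      rw [two_zpow_succ, ENNReal.mul_rpow_of_nonneg _ _ hs.le]
    _ ≤ _ := by gcongr; exact key n hn1

theorem lintegral_dyadicSum {W : Type*} [MeasurableSpace W] (μ : Measure W) {f g : W → ℝ≥0∞}
    (hf : Measurable f) (hg : Measurable g) (s : ℝ) :
    ∫⁻ x, g x * dyadicSum s (f x) ∂μ =
      ∑' k : ℤ, ((2 : ℝ≥0∞) ^ k) ^ s * ∫⁻ x in {x | (2 : ℝ≥0∞) ^ k < f x}, g x ∂μ := by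
  have hm : ∀ k : ℤ, MeasurableSet {x | (2 : ℝ≥0∞) ^ k < f x} := fun k =>
    measurableSet_lt measurable_const hf
  simp only [dyadicSum, ← ENNReal.tsum_mul_left]
  rw [lintegral_tsum]
  · refine tsum_congr fun k => ?_
    rw [← lintegral_const_mul _ hg, ← lintegral_indicator (hm k)]
    refine lintegral_congr fun x => ?_
    by_cases h : (2 : ℝ≥0∞) ^ k < f x <;> simp [indicator, h, mul_comm]
  · intro k
    refine (hg.mul (Measurable.ite (hm k) measurable_const measurable_const)).aemeasurable

theorem lintegral_dyadicSum_one {W : Type*} [MeasurableSpace W] (μ : Measure W) {f : W → ℝ≥0∞}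
    (hf : Measurable f) (s : ℝ) :
    ∫⁻ x, dyadicSum s (f x) ∂μ =
      ∑' k : ℤ, ((2 : ℝ≥0∞) ^ k) ^ s * μ {x | (2 : ℝ≥0∞) ^ k < f x} := by
  simpa using lintegral_dyadicSum μ hf (measurable_const (a := (1 : ℝ≥0∞))) s

/-! ### Domination by a conditional expectation. -/

/-- `u` is `m`-measurable and is dominated, in the mean over the sets of `m`, by `g`. -/
structure SubCE {W : Type*} (m : MeasurableSpace W) {mW : MeasurableSpace W} (μ : Measure W)
    (u g : W → ℝ≥0∞) : Prop where
  meas : Measurable[m] u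
  le : ∀ A, MeasurableSet[m] A → ∫⁻ x in A, u x ∂μ ≤ ∫⁻ x in A, g x ∂μ

section SubCE

variable {W : Type*} {m mW : MeasurableSpace W} {μ : Measure W} {u g : W → ℝ≥0∞}

/-- Domination on all sets of `m` is an inequality between the measures with densities `u` and `g`
trimmed to `m`, so any `m`-measurable weight may be integrated against it. -/
theorem SubCE.lintegral_mul_le (h : SubCE m μ u g) (hm : m ≤ mW) (hg : Measurable g)
    {φ : W → ℝ≥0∞} (hφ : Measurable[m] φ) :
    ∫⁻ x, u x * φ x ∂μ ≤ ∫⁻ x, g x * φ x ∂μ := by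
  have hu : Measurable u := h.meas.mono hm le_rfl
  have hφ' : Measurable φ := hφ.mono hm le_rfl
  have hle : (μ.withDensity u).trim hm ≤ (μ.withDensity g).trim hm := by
    refine Measure.le_iff.2 fun A hA => ?_
    rw [trim_measurableSet_eq hm hA, trim_measurableSet_eq hm hA, withDensity_apply _ (hm _ hA),
      withDensity_apply _ (hm _ hA)]
    exact h.le A hA
  have e : ∀ v : W → ℝ≥0∞, Measurable v →
      ∫⁻ x, v x * φ x ∂μ = ∫⁻ x, φ x ∂(μ.withDensity v).trim hm := fun v hv => by
    rw [lintegral_trim hm hφ, lintegral_withDensity_eq_lintegral_mul _ hv hφ']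
    rfl
  rw [e u hu, e g hg]
  exact lintegral_mono' hle le_rfl

theorem SubCE.mono_right (h : SubCE m μ u g) {g' : W → ℝ≥0∞} (hg : g ≤ g') : SubCE m μ u g' :=
  ⟨h.meas, fun A hA => (h.le A hA).trans (lintegral_mono hg)⟩

theorem subCE_condLExp (hm : m ≤ mW) [SigmaFinite (μ.trim hm)] (g : W → ℝ≥0∞) :
    SubCE m μ (μ⁻[g|m]) g :=
  ⟨measurable_condLExp m μ g, fun _ hA => (setLIntegral_condLExp hm μ g hA).le⟩

theorem SubCE.ae_le_condLExp [IsFiniteMeasure μ] (hm : m ≤ mW) (h : SubCE m μ u g) :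
    u ≤ᵐ[μ] μ⁻[g|m] := by
  refine ae_of_ae_trim hm ?_
  refine ae_le_of_forall_setLIntegral_le_of_sigmaFinite h.meas fun A hA _ => ?_
  rw [setLIntegral_trim hm h.meas hA, setLIntegral_trim hm (measurable_condLExp m μ g) hA,
    setLIntegral_condLExp hm μ g hA]
  exact h.le A hA

end SubCE

/-! ### The scalar Doob inequality. -/

section Doob

variable {W : Type*} {mW : MeasurableSpace W} {μ : Measure W}

/-- The sets `disjointed A n` record the first `n` with `u n > c`; each lies in `ℱ n`, where `u n`
is dominated by `g`. -/
theorem weak_doob (ℱ : Filtration ℕ mW) {u : ℕ → W → ℝ≥0∞} {g : W → ℝ≥0∞}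
    (h : ∀ n, SubCE (ℱ n) μ (u n) g) (c : ℝ≥0∞) :
    c * μ {x | c < ⨆ n, u n x} ≤ ∫⁻ x in {x | c < ⨆ n, u n x}, g x ∂μ := by
  set A : ℕ → Set W := fun n => {x | c < u n x}
  have hA : ∀ n, MeasurableSet[ℱ n] (A n) := fun n =>
    measurableSet_lt measurable_const (h n).meas
  have hU : {x | c < ⨆ n, u n x} = ⋃ n, disjointed A n := by
    rw [iUnion_disjointed]
    ext x
    simp [A, lt_iSup_iff]
  have hD : ∀ n, MeasurableSet[ℱ n] (disjointed A n) := fun n => by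
    rw [disjointed_eq_inter_compl]
    exact (hA n).inter (MeasurableSet.iInter fun j => MeasurableSet.iInter fun hj =>
      (ℱ.mono (le_of_lt hj) _ (hA j)).compl)
  have hD' : ∀ n, MeasurableSet (disjointed A n) := fun n => ℱ.le n _ (hD n)
  rw [hU, measure_iUnion (disjoint_disjointed A) hD', lintegral_iUnion hD' (disjoint_disjointed A),
    ← ENNReal.tsum_mul_left]
  refine ENNReal.tsum_le_tsum fun n => ?_
  calc c * μ (disjointed A n) = ∫⁻ _ in disjointed A n, c ∂μ := by simp
    _ ≤ ∫⁻ x in disjointed A n, u n x ∂μ :=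
      setLIntegral_mono' (hD' n) fun x hx => (disjointed_subset A n hx : c < u n x).le
    _ ≤ _ := (h n).le _ (hD n)

/-- In the weak inequality the part of `g` below `c / 2` contributes at most half of the left side,
which is finite and is absorbed. This leaves an integral over `{c < 2 g}`, and summation over dyadic
`c` gives the strong bound. -/
theorem doob_maximal [IsFiniteMeasure μ] (ℱ : Filtration ℕ mW) {u : ℕ → W → ℝ≥0∞}
    {g : W → ℝ≥0∞} (hg : Measurable g) (h : ∀ n, SubCE (ℱ n) μ (u n) g) {q : ℝ} (hq : 1 < q) :
    ∫⁻ x, (⨆ n, u n x) ^ q ∂μ ≤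
      (2 ^ q * 2 * 2 ^ (q - 1) * dyadicConst (q - 1)) * ∫⁻ x, g x ^ q ∂μ := by
  have hq0 : 0 < q := by linarith
  have hU : Measurable fun x => ⨆ n, u n x :=
    Measurable.iSup fun n => (h n).meas.mono (ℱ.le n) le_rfl
  have hweak : ∀ k : ℤ, (2 : ℝ≥0∞) ^ k * μ {x | (2 : ℝ≥0∞) ^ k < ⨆ n, u n x} ≤
      2 * ∫⁻ x in {x | (2 : ℝ≥0∞) ^ k < 2 * g x}, g x ∂μ := by
    intro k
    set c : ℝ≥0∞ := 2 ^ k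
    set A := {x | c < ⨆ n, u n x}
    set B := {x | c < 2 * g x}
    have hA : MeasurableSet A := measurableSet_lt measurable_const hU
    have hB : MeasurableSet B := measurableSet_lt measurable_const (hg.const_mul 2)
    have h1 : c * μ A ≤ ∫⁻ x in B, g x ∂μ + c / 2 * μ A := by
      calc c * μ A ≤ ∫⁻ x in A, g x ∂μ := weak_doob ℱ h c
        _ ≤ ∫⁻ x in A, (B.indicator g x + c / 2) ∂μ := by
          refine lintegral_mono fun x => ?_
          by_cases hx : x ∈ B
          · simp [hx]
          · simp only [indicator, hx, if_false, zero_add]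
            rw [ENNReal.le_div_iff_mul_le (by simp) (by simp), mul_comm]
            exact not_lt.1 hx
        _ = ∫⁻ x in A, B.indicator g x ∂μ + c / 2 * μ A := by
          rw [lintegral_add_right _ measurable_const]
          simp
        _ ≤ ∫⁻ x, B.indicator g x ∂μ + c / 2 * μ A := by
          gcongr
          exact Measure.restrict_le_self
        _ = _ := by rw [lintegral_indicator hB]
    have hfin : c / 2 * μ A ≠ ∞ :=
      ENNReal.mul_ne_top (ENNReal.div_ne_top (two_zpow_ne_top k) (by simp)) (measure_ne_top _ _)
    have h2 : c * μ A = c / 2 * μ A + c / 2 * μ A := by rw [← add_mul, ENNReal.add_halves]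
    rw [h2] at h1
    have h3 := (ENNReal.add_le_add_iff_right hfin).1 h1
    rw [h2, ← two_mul]
    gcongr
  calc ∫⁻ x, (⨆ n, u n x) ^ q ∂μ ≤ ∫⁻ x, 2 ^ q * dyadicSum q (⨆ n, u n x) ∂μ :=
        lintegral_mono fun x => rpow_le_dyadicSum hq0 _
    _ = 2 ^ q * ∑' k : ℤ, ((2 : ℝ≥0∞) ^ k) ^ q * μ {x | (2 : ℝ≥0∞) ^ k < ⨆ n, u n x} := by
      rw [lintegral_const_mul' _ _ (by simp), lintegral_dyadicSum_one μ hU]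
    _ ≤ 2 ^ q * ∑' k : ℤ, 2 * (((2 : ℝ≥0∞) ^ k) ^ (q - 1) *
          ∫⁻ x in {x | (2 : ℝ≥0∞) ^ k < 2 * g x}, g x ∂μ) := by
      refine mul_le_mul_right (ENNReal.tsum_le_tsum fun k => ?_) _
      have : ((2 : ℝ≥0∞) ^ k) ^ q = (2 ^ k) ^ (q - 1) * 2 ^ k := by
        conv_lhs => rw [show q = q - 1 + 1 by ring,
          ENNReal.rpow_add _ _ (two_zpow_pos k).ne' (two_zpow_ne_top k), ENNReal.rpow_one]
      rw [this, mul_assoc, mul_left_comm (2 : ℝ≥0∞)]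
      exact mul_le_mul_right (hweak k) _
    _ = 2 ^ q * (2 * ∫⁻ x, g x * dyadicSum (q - 1) (2 * g x) ∂μ) := by
      rw [ENNReal.tsum_mul_left, lintegral_dyadicSum μ (hg.const_mul 2) hg]
    _ ≤ 2 ^ q * (2 * ∫⁻ x, (2 ^ (q - 1) * dyadicConst (q - 1)) * g x ^ q ∂μ) := by
      refine mul_le_mul_right (mul_le_mul_right (lintegral_mono fun x => ?_) _) _
      calc g x * dyadicSum (q - 1) (2 * g x)
          ≤ g x * (dyadicConst (q - 1) * (2 * g x) ^ (q - 1)) := by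
            gcongr
            exact dyadicSum_le (by linarith) _
        _ = (2 ^ (q - 1) * dyadicConst (q - 1)) * (g x * g x ^ (q - 1)) := by
            rw [ENNReal.mul_rpow_of_nonneg _ _ (by linarith)]
            ring
        _ = _ := by
            congr 1
            nth_rw 1 [← ENNReal.rpow_one (g x)]
            rw [← ENNReal.rpow_add_of_nonneg _ _ zero_le_one (by linarith)]
            congr 1
            ring
    _ = _ := by
      rw [lintegral_const_mul _ (hg.pow_const q)]
      ring

end Doob

/-! ### Minkowski's inequality for dominated functions. -/

section Minkowski

variable {Z Y : Type*} {K : MeasurableSpace Z} {G : MeasurableSpace Y} {mZ : MeasurableSpace Z}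
  {mY : MeasurableSpace Y}

theorem prod_mono_measurableSpace {m₁ m₁' : MeasurableSpace Z} {m₂ m₂' : MeasurableSpace Y}
    (h₁ : m₁ ≤ m₁') (h₂ : m₂ ≤ m₂') : m₁.prod m₂ ≤ m₁'.prod m₂' :=
  sup_le_sup (MeasurableSpace.comap_mono h₁) (MeasurableSpace.comap_mono h₂)

theorem measurable_lintegral_left {ζ : Measure Z} [SFinite ζ] (hK : K ≤ mZ)
    {f : Z × Y → ℝ≥0∞} (hf : Measurable[K.prod G] f) :
    Measurable[G] fun y => ∫⁻ z, f (z, y) ∂ζ :=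
  @Measurable.lintegral_prod_left' Z Y mZ G ζ _ f
    (hf.mono (prod_mono_measurableSpace hK le_rfl) le_rfl)

theorem measurable_snd_comp {f : Y → ℝ≥0∞}
    (hf : Measurable[G] f) : Measurable[K.prod G] fun w : Z × Y => f w.2 :=
  hf.comp (@measurable_snd Z Y K G)

theorem setLIntegral_snd {ζ : Measure Z} {ν : Measure Y} [SFinite ζ] [SFinite ν]
    {f : Z × Y → ℝ≥0∞} (hf : Measurable f) {A : Set Y} (hA : MeasurableSet A) :
    ∫⁻ w in Prod.snd ⁻¹' A, f w ∂ζ.prod ν = ∫⁻ y in A, ∫⁻ z, f (z, y) ∂ζ ∂ν := by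
  rw [← lintegral_indicator (measurable_snd hA), lintegral_prod_symm' _
    (hf.indicator (measurable_snd hA)), ← lintegral_indicator hA]
  refine lintegral_congr fun y => ?_
  by_cases h : y ∈ A <;> simp [indicator, h]

theorem lintegral_min_nat {ν : Measure Y} {A : Set Y} {ζ : Measure Z} [SFinite ζ]
    {v : Z × Y → ℝ≥0∞} (hv : Measurable v) {q : ℝ} (hq : 0 < q) :
    ∫⁻ y in A, (∫⁻ z, v (z, y) ^ q ∂ζ) ^ (1 / q) ∂ν =
      ⨆ n : ℕ, ∫⁻ y in A, (∫⁻ z, min (v (z, y)) n ^ q ∂ζ) ^ (1 / q) ∂ν := by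
  have hm : ∀ n : ℕ, Measurable fun w => min (v w) (n : ℝ≥0∞) ^ q := fun n =>
    (hv.min measurable_const).pow_const q
  have hmono : ∀ w, Monotone fun n : ℕ => min (v w) (n : ℝ≥0∞) ^ q := fun w a b hab =>
    ENNReal.rpow_le_rpow (min_le_min le_rfl (by exact_mod_cast hab)) hq.le
  rw [← lintegral_iSup]
  · refine lintegral_congr fun y => ?_
    rw [← iSup_rpow _ (by positivity)]
    congr 1
    rw [← lintegral_iSup (f := fun (n : ℕ) z => min (v (z, y)) (n : ℝ≥0∞) ^ q)
      (fun n => (hm n).comp measurable_prodMk_right) fun a b hab z => hmono (z, y) hab]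
    refine lintegral_congr fun z => ?_
    rw [← iSup_rpow _ hq]
    congr 1
    rw [← inf_iSup_eq, ENNReal.iSup_natCast, inf_top_eq]
  · intro n
    exact (Measurable.lintegral_prod_left' (hm n)).pow_const _
  · intro a b hab y
    refine ENNReal.rpow_le_rpow (lintegral_mono fun z => hmono (z, y) hab) (by positivity)

/-- The conditional form of Minkowski's inequality, by duality: the extremal weight `w^{q-1} /
V^{q-1}` for the norm of `v(·, y)` is measurable for `K.prod G`, so `v` may be replaced by `h` under
it, and Hölder's inequality returns the norm of `h(·, y)`. -/
theorem SubCE.minkowski {ζ : Measure Z} [IsProbabilityMeasure ζ] {ν : Measure Y}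
    [IsProbabilityMeasure ν] (hK : K ≤ mZ)
    (hG : G ≤ mY) {v h : Z × Y → ℝ≥0∞} (hh : Measurable h)
    (hv : SubCE (K.prod G) (ζ.prod ν) v h) {q : ℝ} (hq : 1 < q) :
    SubCE G ν (fun y => (∫⁻ z, v (z, y) ^ q ∂ζ) ^ (1 / q))
      (fun y => (∫⁻ z, h (z, y) ^ q ∂ζ) ^ (1 / q)) := by
  have hq0 : 0 < q := by linarith
  have hKG : K.prod G ≤ mZ.prod mY := prod_mono_measurableSpace hK hG
  have hvm : Measurable v := hv.meas.mono hKG le_rfl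
  refine ⟨?_, fun A hA => ?_⟩
  · have := measurable_lintegral_left (ζ := ζ) hK (hv.meas.pow_const q)
    exact this.pow_const (1 / q)
  have hA' : MeasurableSet A := hG _ hA
  rw [lintegral_min_nat hvm hq0]
  refine iSup_le fun N => ?_
  -- Truncation makes `V` finite, so that `V = V^{1-q} · V^q` can be used; monotone convergence
  -- removes it.
  set w : Z × Y → ℝ≥0∞ := fun x => min (v x) N
  have hw : Measurable[K.prod G] w := hv.meas.min measurable_const
  have hw' : Measurable w := hw.mono hKG le_rfl
  set V : Y → ℝ≥0∞ := fun y => (∫⁻ z, w (z, y) ^ q ∂ζ) ^ (1 / q)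
  have hV : Measurable[G] V := (measurable_lintegral_left hK (hw.pow_const q)).pow_const (1 / q)
  have hVfin : ∀ y, V y ≠ ∞ := by
    intro y
    refine ENNReal.rpow_ne_top_of_nonneg (by positivity) ?_
    refine ne_top_of_le_ne_top (b := (N : ℝ≥0∞) ^ q) (by simp [hq0.le]) ?_
    calc ∫⁻ z, w (z, y) ^ q ∂ζ ≤ ∫⁻ _, (N : ℝ≥0∞) ^ q ∂ζ :=
          lintegral_mono fun z => ENNReal.rpow_le_rpow (min_le_right _ _) hq0.le
      _ = _ := by simp
  have hVq : ∀ y, ∫⁻ z, w (z, y) ^ q ∂ζ = V y ^ q := by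
    intro y
    simp only [V]
    rw [← ENNReal.rpow_mul, one_div_mul_cancel hq0.ne', ENNReal.rpow_one]
  -- Here `c = ∞` where `V = 0`. This is harmless: the lower estimate is trivial there, and `c ·
  -- V^{q-1} ≤ 1` remains true.
  set c : Y → ℝ≥0∞ := fun y => (V y ^ (q - 1))⁻¹
  have hc : Measurable[G] c := (hV.pow_const (q - 1)).inv
  have hc' : Measurable c := hc.mono hG le_rfl
  set φ : Z × Y → ℝ≥0∞ := fun x => A.indicator c x.2 * w x ^ (q - 1)
  have hφ : Measurable[K.prod G] φ :=
    (measurable_snd_comp (hc.indicator hA)).mul (hw.pow_const (q - 1))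
  have hint : ∀ f : Z × Y → ℝ≥0∞, Measurable f → ∫⁻ x, f x * φ x ∂ζ.prod ν =
      ∫⁻ y in A, c y * ∫⁻ z, f (z, y) * w (z, y) ^ (q - 1) ∂ζ ∂ν := by
    intro f hf
    rw [lintegral_prod_symm' (fun x => f x * φ x) (hf.mul (hφ.mono hKG le_rfl)),
      ← lintegral_indicator hA']
    refine lintegral_congr fun y => ?_
    have hm : Measurable fun z => f (z, y) * w (z, y) ^ (q - 1) :=
      (hf.mul (hw'.pow_const _)).comp measurable_prodMk_right
    by_cases hy : y ∈ A
    · simp only [φ, indicator, hy, if_true]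
      rw [← lintegral_const_mul _ hm]
      refine lintegral_congr fun z => ?_
      ring
    · simp [φ, indicator, hy]
  calc ∫⁻ y in A, V y ∂ν
      ≤ ∫⁻ y in A, c y * ∫⁻ z, v (z, y) * w (z, y) ^ (q - 1) ∂ζ ∂ν := by
        refine lintegral_mono fun y => ?_
        rcases eq_or_ne (V y) 0 with h0 | h0
        · simp only [h0]; exact zero_le
        calc V y = c y * V y ^ q := by
              simp only [c]
              rw [← ENNReal.rpow_neg, ← ENNReal.rpow_add _ _ h0 (hVfin y)]
              simp
          _ = c y * ∫⁻ z, w (z, y) ^ q ∂ζ := by rw [hVq]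
          _ ≤ _ := by
              gcongr with z
              calc w (z, y) ^ q = w (z, y) * w (z, y) ^ (q - 1) := by
                    nth_rw 2 [← ENNReal.rpow_one (w (z, y))]
                    rw [← ENNReal.rpow_add_of_nonneg _ _ zero_le_one (by linarith)]
                    congr 1
                    ring
                _ ≤ _ := by
                    gcongr
                    exact min_le_left _ _
    _ = ∫⁻ x, v x * φ x ∂ζ.prod ν := (hint v hvm).symm
    _ ≤ ∫⁻ x, h x * φ x ∂ζ.prod ν := hv.lintegral_mul_le hKG hh hφ
    _ = ∫⁻ y in A, c y * ∫⁻ z, h (z, y) * w (z, y) ^ (q - 1) ∂ζ ∂ν := hint h hh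
    _ ≤ ∫⁻ y in A, (∫⁻ z, h (z, y) ^ q ∂ζ) ^ (1 / q) ∂ν := by
        refine lintegral_mono fun y => ?_
        have hconj : q.HolderConjugate q.conjExponent := Real.HolderConjugate.conjExponent hq
        have hH := ENNReal.lintegral_mul_le_Lp_mul_Lq ζ hconj
          (f := fun z => h (z, y)) (g := fun z => w (z, y) ^ (q - 1))
          (hh.comp measurable_prodMk_right).aemeasurable
          ((hw'.pow_const _).comp measurable_prodMk_right).aemeasurable
        have hpow : (∫⁻ z, (w (z, y) ^ (q - 1)) ^ q.conjExponent ∂ζ) ^ (1 / q.conjExponent) =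
            V y ^ (q - 1) := by
          have hq1 : q - 1 ≠ 0 := by linarith
          have e1 : (q - 1) * q.conjExponent = q := by
            rw [Real.conjExponent]; field_simp
          have e2 : 1 / q.conjExponent = 1 / q * (q - 1) := by
            rw [Real.conjExponent]; field_simp
          simp only [← ENNReal.rpow_mul, e1]
          rw [e2, ENNReal.rpow_mul]
        rw [hpow] at hH
        calc c y * ∫⁻ z, h (z, y) * w (z, y) ^ (q - 1) ∂ζ
            ≤ c y * ((∫⁻ z, h (z, y) ^ q ∂ζ) ^ (1 / q) * V y ^ (q - 1)) := by
              gcongr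
              exact hH
          _ = (∫⁻ z, h (z, y) ^ q ∂ζ) ^ (1 / q) * (c y * V y ^ (q - 1)) := by ring
          _ ≤ (∫⁻ z, h (z, y) ^ q ∂ζ) ^ (1 / q) * 1 := by
              gcongr
              exact ENNReal.inv_mul_le_one _
          _ = _ := mul_one _

end Minkowski

/-! ### Regularity in functional form. -/

section Regular

/-- Functional form of regularity: every nonnegative `ℱ (n+1)`-measurable function has an
`ℱ n`-measurable majorant with comparable mean over the sets of `ℱ n`. -/
def RegF {W : Type*} {mW : MeasurableSpace W} (ℱ : Filtration ℕ mW) (μ : Measure W) : Prop :=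
  ∃ R : ℝ≥0, ∀ n h, Measurable[ℱ (n + 1)] h → ∃ b : W → ℝ≥0∞, Measurable[ℱ n] b ∧ h ≤ᵐ[μ] b ∧
    ∀ C, MeasurableSet[ℱ n] C → ∫⁻ x in C, b x ∂μ ≤ R * ∫⁻ x in C, h x ∂μ

variable {W : Type u} {mW : MeasurableSpace W} {ℱ : Filtration ℕ mW} {μ : Measure W}

/-- For an indicator of `A`, let `D` be the `ℱ n`-set where `R E_n 1_A < 1` and let `B` be the
regular cover of `A ∩ D`. If `B ∩ D` had positive measure, integrating over it would give `R μ(A ∩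
D) < μ(B ∩ D) ≤ R μ(A ∩ D)`. Sums and monotone limits give all nonnegative functions. -/
theorem IsRegular.le_condLExp [IsProbabilityMeasure μ] (hreg : IsRegular ℱ μ) :
    ∃ R : ℝ≥0, ∀ n h, Measurable[ℱ (n + 1)] h → ∀ᵐ x ∂μ, h x ≤ R * (μ⁻[h|ℱ n]) x := by
  obtain ⟨R, -, hR⟩ := hreg
  refine ⟨R, fun n h hh => ?_⟩
  have hset : ∀ A, MeasurableSet[ℱ (n + 1)] A →
      ∀ᵐ x ∂μ, A.indicator 1 x ≤ R * (μ⁻[A.indicator 1|ℱ n]) x := by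
    intro A hA
    have hA' := ℱ.le _ _ hA
    have hEm : Measurable[ℱ n] (μ⁻[A.indicator 1|ℱ n]) := measurable_condLExp _ _ _
    set D := {x | R * (μ⁻[A.indicator 1|ℱ n]) x < 1}
    have hD : MeasurableSet[ℱ n] D := measurableSet_lt (hEm.const_mul _) measurable_const
    obtain ⟨B, hB, hAB, hBR⟩ := hR n (A ∩ D) (hA.inter (ℱ.mono n.le_succ _ hD))
    have hBD : MeasurableSet[ℱ n] (B ∩ D) := hB.inter hD
    have hBD' := ℱ.le _ _ hBD
    have hAeq : A ∩ (B ∩ D) = A ∩ D := by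
      ext x
      constructor
      · rintro ⟨h1, h2, h3⟩; exact ⟨h1, h3⟩
      · rintro h1; exact ⟨h1.1, hAB h1, h1.2⟩
    have h1 : ∫⁻ x in B ∩ D, R * (μ⁻[A.indicator 1|ℱ n]) x ∂μ = R * μ (A ∩ D) := by
      rw [lintegral_const_mul _ (hEm.mono (ℱ.le n) le_rfl),
        setLIntegral_condLExp (ℱ.le n) μ _ hBD, lintegral_indicator_one hA',
        Measure.restrict_apply hA', hAeq]
    have h0 : μ (B ∩ D) = 0 := by
      by_contra hne
      have := setLIntegral_strict_mono (μ := μ) (f := fun x => R * (μ⁻[A.indicator 1|ℱ n]) x)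
        (g := fun _ => 1) hBD' hne measurable_const (by
          rw [h1]; exact ENNReal.mul_ne_top (by simp) (measure_ne_top _ _))
          (Filter.Eventually.of_forall fun x hx => hx.2)
      rw [h1] at this
      simp only [lintegral_one, Measure.restrict_apply MeasurableSet.univ, univ_inter] at this
      exact absurd (this.trans_le (measure_mono inter_subset_left)) (not_lt.2 hBR)
    have h2 : μ (A ∩ D) = 0 := by
      rw [← hAeq]
      exact measure_mono_null inter_subset_right h0
    filter_upwards [measure_eq_zero_iff_ae_notMem.1 h2] with x hx
    by_cases hxA : x ∈ A
    · rw [indicator_of_mem hxA]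
      exact not_lt.1 fun hlt => hx ⟨hxA, hlt⟩
    · rw [indicator_of_notMem hxA]
      exact zero_le
  refine @Measurable.ennreal_induction W (ℱ (n + 1))
    (fun h => ∀ᵐ x ∂μ, h x ≤ R * (μ⁻[h|ℱ n]) x) ?_ ?_ ?_ h hh
  · intro c A hA
    have e : A.indicator (fun _ => c) = c • A.indicator (1 : W → ℝ≥0∞) := by
      ext x; by_cases hx : x ∈ A <;> simp [hx]
    have hm : AEMeasurable (A.indicator (1 : W → ℝ≥0∞)) μ :=
      (measurable_one.indicator (ℱ.le _ _ hA)).aemeasurable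
    filter_upwards [hset A hA, condLExp_smul (mΩ := ℱ n) (P := μ) _ hm c] with x hx hx2
    rw [e, hx2]
    simp only [Pi.smul_apply, smul_eq_mul]
    rw [mul_left_comm]
    gcongr
  · intro f g _ hf hg hf1 hg1
    filter_upwards [hf1, hg1, condLExp_add_left (mΩ := ℱ n) (P := μ) (X := f) g
      (hf.mono (ℱ.le _) le_rfl).aemeasurable] with x h1 h2 h3
    rw [h3]
    simp only [Pi.add_apply]
    rw [mul_add]
    gcongr
  · intro f hf hmono hle
    have hmon : ∀ᵐ x ∂μ, ∀ k, (μ⁻[f k|ℱ n]) x ≤ (μ⁻[fun x => ⨆ k, f k x|ℱ n]) x := by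
      refine ae_all_iff.2 fun k => ?_
      exact condLExp_mono (Filter.Eventually.of_forall fun x => le_iSup (fun k => f k x) k)
    filter_upwards [ae_all_iff.2 hle, hmon] with x h1 h2
    exact iSup_le fun k => (h1 k).trans (by gcongr; exact h2 k)

theorem IsRegular.regF [IsProbabilityMeasure μ] (hreg : IsRegular ℱ μ) : RegF ℱ μ := by
  obtain ⟨R, hR⟩ := hreg.le_condLExp
  refine ⟨R, fun n h hh => ⟨fun x => R * (μ⁻[h|ℱ n]) x, (measurable_condLExp _ _ _).const_mul _,
    hR n h hh, fun C hC => ?_⟩⟩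
  rw [lintegral_const_mul _ (measurable_condLExp' (ℱ n) μ h), setLIntegral_condLExp (ℱ.le n) μ _ hC]

end Regular

/-! ### Summation of a good-`λ` inequality. -/

section GoodLambda

/-- Over a window `[-m, m]` the shifted sum is again at most the window sum plus one boundary term,
so half of the finite window sum is absorbed; the boundary term `a (-m)` tends to zero. No prior
summability of `a` is needed. -/
theorem tsum_le_of_half_step {a e : ℤ → ℝ≥0∞} (ha : ∀ k, a k ≠ ∞)
    (hlim : Filter.Tendsto (fun m : ℕ => a (-m)) Filter.atTop (nhds 0))
    (h : ∀ k, a (k + 1) ≤ 2⁻¹ * a k + e k) : ∑' k, a k ≤ 2 * ∑' k, e k := by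
  have hΦ : ∀ m : ℕ, ∑ k ∈ Finset.Icc (-m : ℤ) m, a k ≤ 2 * (a (-m) + ∑' k, e k) := by
    intro m
    set Φ := ∑ k ∈ Finset.Icc (-m : ℤ) m, a k
    have hΦfin : 2⁻¹ * Φ ≠ ∞ :=
      ENNReal.mul_ne_top (by simp) (ENNReal.sum_ne_top.2 fun k _ => ha k)
    have h1 : Φ ≤ 2⁻¹ * Φ + (a (-m) + ∑' k, e k) := by
      have hsub : Finset.Icc (-m : ℤ) m ⊆
          insert (-m : ℤ) ((Finset.Icc (-m : ℤ) m).image fun k => k + 1) := by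
        intro k hk
        simp only [Finset.mem_Icc, Finset.mem_insert, Finset.mem_image] at hk ⊢
        by_cases hkm : k = -m
        · exact Or.inl hkm
        · exact Or.inr ⟨k - 1, by omega, by omega⟩
      calc Φ ≤ ∑ k ∈ insert (-m : ℤ) ((Finset.Icc (-m : ℤ) m).image fun k => k + 1), a k :=
            Finset.sum_le_sum_of_subset hsub
        _ ≤ a (-m) + ∑ k ∈ (Finset.Icc (-m : ℤ) m).image fun k => k + 1, a k := by
            rw [← Finset.sum_singleton a (-m : ℤ), Finset.insert_eq]
            exact (le_add_right le_rfl).trans_eq Finset.sum_union_inter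
        _ = a (-m) + ∑ k ∈ Finset.Icc (-m : ℤ) m, a (k + 1) := by
            rw [Finset.sum_image fun x _ y _ hxy => by simpa using hxy]
        _ ≤ a (-m) + ∑ k ∈ Finset.Icc (-m : ℤ) m, (2⁻¹ * a k + e k) := by
            gcongr with k
            exact h k
        _ ≤ a (-m) + (2⁻¹ * Φ + ∑' k, e k) := by
            rw [Finset.sum_add_distrib, Finset.mul_sum]
            gcongr
            exact ENNReal.sum_le_tsum _
        _ = _ := by ring
    have h2 : Φ = 2⁻¹ * Φ + 2⁻¹ * Φ := by
      rw [← add_mul, ENNReal.inv_two_add_inv_two, one_mul]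
    have h3 : 2⁻¹ * Φ ≤ a (-m) + ∑' k, e k := by
      rw [h2] at h1
      rw [← h2] at h1
      conv_lhs at h1 => rw [h2]
      exact (ENNReal.add_le_add_iff_left hΦfin).1 h1
    rw [h2, ← two_mul]
    gcongr
  rw [ENNReal.tsum_eq_iSup_sum]
  refine iSup_le fun S => ?_
  have hlim2 : Filter.Tendsto (fun m : ℕ => 2 * (a (-m) + ∑' k, e k)) Filter.atTop
      (nhds (2 * (0 + ∑' k, e k))) :=
    ENNReal.Tendsto.const_mul (hlim.add_const _) (Or.inr (by simp))
  rw [zero_add] at hlim2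
  refine ge_of_tendsto hlim2 ?_
  obtain ⟨m₀, hm₀⟩ : ∃ m₀ : ℕ, ∀ k ∈ S, k.natAbs ≤ m₀ :=
    ⟨S.sup Int.natAbs, fun k hk => Finset.le_sup hk⟩
  filter_upwards [Filter.eventually_ge_atTop m₀] with m hm
  refine (Finset.sum_le_sum_of_subset fun k hk => ?_).trans (hΦ m)
  have := hm₀ k hk
  simp only [Finset.mem_Icc]
  omega

/-- Integrated form of a good-`λ` inequality. -/
theorem lintegral_rpow_le_of_good_lambda {Y : Type*} [MeasurableSpace Y] {ν : Measure Y}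
    [IsFiniteMeasure ν] {q s : ℝ} (hq : 0 < q) (hs : 0 < s) (C : ℝ≥0) :
    ∃ C' : ℝ≥0, ∀ X B : Y → ℝ≥0∞, Measurable X → Measurable B →
      (∀ δ : ℝ≥0, 0 < δ → ∀ k : ℤ, ν {y | 2 * 2 ^ k < X y ∧ B y ≤ δ * 2 ^ k} ≤
        C * (δ : ℝ≥0∞) ^ q * ν {y | 2 ^ k < X y}) →
      ∫⁻ y, X y ^ s ∂ν ≤ C' * ∫⁻ y, B y ^ s ∂ν := by
  -- The factor `2^s` is lost in passing from `2^{k+1}` to `2^k`; `δ` is chosen so that the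
  -- coefficient of the shifted term is at most one half.
  obtain ⟨δ, hδ, hδC⟩ : ∃ δ : ℝ≥0, 0 < δ ∧ (2 : ℝ≥0∞) ^ s * (C * (δ : ℝ≥0∞) ^ q) ≤ 2⁻¹ := by
    set e : ℝ≥0 := (2 * 2 ^ s * (C + 1))⁻¹
    have he : 0 < e := by positivity
    refine ⟨e ^ (1 / q), NNReal.rpow_pos he, ?_⟩
    rw [← ENNReal.coe_rpow_of_nonneg _ hq.le, ← NNReal.rpow_mul, one_div_mul_cancel hq.ne',
      NNReal.rpow_one]
    have h2 : (2 : ℝ≥0∞) ^ s = ((2 ^ s : ℝ≥0) : ℝ≥0∞) := by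
      rw [ENNReal.coe_rpow_of_nonneg _ hs.le]; rfl
    rw [h2, show (2 : ℝ≥0∞)⁻¹ = ((2⁻¹ : ℝ≥0) : ℝ≥0∞) by simp]
    norm_cast
    have h3 : (2 : ℝ≥0) ^ s * (C * e) * (2 * (C + 1)) = C := by
      simp only [e]; field_simp
    have hpos : (0 : ℝ≥0) < 2 ^ s := NNReal.rpow_pos two_pos
    rw [← NNReal.coe_le_coe]
    have h4 : ((2 : ℝ≥0) ^ s * (C * e) : ℝ) * (2 * (C + 1)) = C := by exact_mod_cast h3
    have h5 : (0 : ℝ) ≤ C := C.2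
    push_cast at h4 ⊢
    rw [← mul_le_mul_iff_left₀ (show (0 : ℝ) < 2 * (C + 1) by positivity), h4]
    linarith
  have hδ0 : (δ : ℝ≥0∞) ≠ 0 := by exact_mod_cast hδ.ne'
  have hC' : (2 : ℝ≥0∞) ^ s * (2 * (2 ^ s * (dyadicConst s * ((δ : ℝ≥0∞)⁻¹) ^ s))) ≠ ∞ := by
    have : ((δ : ℝ≥0∞)⁻¹) ≠ ∞ := ENNReal.inv_ne_top.2 hδ0
    finiteness
  refine ⟨ENNReal.toNNReal ((2 : ℝ≥0∞) ^ s * (2 * (2 ^ s * (dyadicConst s *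
    ((δ : ℝ≥0∞)⁻¹) ^ s)))), fun X B hX hB h => ?_⟩
  rw [ENNReal.coe_toNNReal hC']
  have hB' : Measurable fun y => (δ : ℝ≥0∞)⁻¹ * B y := hB.const_mul _
  have key : ∑' k : ℤ, ((2 : ℝ≥0∞) ^ k) ^ s * ν {y | 2 ^ k < X y} ≤
      2 * ∑' k : ℤ, 2 ^ s * (((2 : ℝ≥0∞) ^ k) ^ s * ν {y | 2 ^ k < (δ : ℝ≥0∞)⁻¹ * B y}) := by
    refine tsum_le_of_half_step (fun k => ?_) ?_ fun k => ?_
    · exact ENNReal.mul_ne_top (ENNReal.rpow_ne_top_of_nonneg hs.le (two_zpow_ne_top k))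
        (measure_ne_top _ _)
    · have hle : ∀ m : ℕ, ((2 : ℝ≥0∞) ^ (-m : ℤ)) ^ s * ν {y | 2 ^ (-m : ℤ) < X y} ≤
          ((2 : ℝ≥0∞)⁻¹ ^ s) ^ m * ν univ := by
        intro m
        rw [ENNReal.zpow_neg, zpow_natCast, ENNReal.inv_pow, ← ENNReal.rpow_natCast_mul,
          mul_comm (m : ℝ) s, ENNReal.rpow_mul_natCast]
        gcongr
        exact subset_univ _
      refine tendsto_of_tendsto_of_tendsto_of_le_of_le tendsto_const_nhds ?_
        (fun _ => zero_le) hle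
      have := ENNReal.tendsto_pow_atTop_nhds_zero_of_lt_one
        (ENNReal.rpow_lt_one (show (2 : ℝ≥0∞)⁻¹ < 1 by norm_num) hs)
      simpa using ENNReal.Tendsto.mul_const (b := ν univ) this (Or.inr (measure_ne_top _ _))
    · have hsub : {y | 2 ^ (k + 1) < X y} ⊆ {y | 2 * 2 ^ k < X y ∧ B y ≤ δ * 2 ^ k} ∪
          {y | (2 : ℝ≥0∞) ^ k < (δ : ℝ≥0∞)⁻¹ * B y} := by
        intro y hy
        by_cases hBy : B y ≤ δ * 2 ^ k
        · exact Or.inl ⟨by rw [← two_zpow_succ]; exact hy, hBy⟩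
        · refine Or.inr ?_
          simp only [mem_ofPred_eq]
          rw [mul_comm, ← div_eq_mul_inv, ENNReal.lt_div_iff_mul_lt (Or.inl hδ0) (by simp),
            mul_comm]
          exact not_le.1 hBy
      calc ((2 : ℝ≥0∞) ^ (k + 1)) ^ s * ν {y | 2 ^ (k + 1) < X y}
          ≤ (2 ^ s * (2 ^ k) ^ s) * (C * (δ : ℝ≥0∞) ^ q * ν {y | 2 ^ k < X y} +
              ν {y | (2 : ℝ≥0∞) ^ k < (δ : ℝ≥0∞)⁻¹ * B y}) := by
            nth_rw 1 [two_zpow_succ]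
            rw [ENNReal.mul_rpow_of_nonneg _ _ hs.le]
            gcongr
            exact (measure_mono hsub).trans ((measure_union_le _ _).trans
              (add_le_add (h δ hδ k) le_rfl))
        _ = (2 ^ s * (C * (δ : ℝ≥0∞) ^ q)) * ((2 ^ k) ^ s * ν {y | 2 ^ k < X y}) +
              2 ^ s * ((2 ^ k) ^ s * ν {y | (2 : ℝ≥0∞) ^ k < (δ : ℝ≥0∞)⁻¹ * B y}) := by ring
        _ ≤ _ := by gcongr
  calc ∫⁻ y, X y ^ s ∂ν ≤ ∫⁻ y, 2 ^ s * dyadicSum s (X y) ∂ν :=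
        lintegral_mono fun y => rpow_le_dyadicSum hs _
    _ = 2 ^ s * ∑' k : ℤ, ((2 : ℝ≥0∞) ^ k) ^ s * ν {y | (2 : ℝ≥0∞) ^ k < X y} := by
      rw [lintegral_const_mul' _ _ (by simp), lintegral_dyadicSum_one ν hX]
    _ ≤ 2 ^ s * (2 * (2 ^ s * ∫⁻ y, dyadicSum s ((δ : ℝ≥0∞)⁻¹ * B y) ∂ν)) := by
      rw [lintegral_dyadicSum_one ν hB']
      rw [ENNReal.tsum_mul_left] at key
      exact mul_le_mul_right key _
    _ ≤ 2 ^ s * (2 * (2 ^ s * ∫⁻ y, (dyadicConst s * ((δ : ℝ≥0∞)⁻¹) ^ s) * B y ^ s ∂ν)) := by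
      gcongr with y
      refine (dyadicSum_le hs _).trans_eq ?_
      rw [ENNReal.mul_rpow_of_nonneg _ _ hs.le, mul_assoc]
    _ = _ := by
      rw [lintegral_const_mul _ (hB.pow_const s)]
      ring

end GoodLambda

/-! ### Product filtrations, abstract mixed norms and optional stopping. -/

/-- The product of two filtrations. -/
def prodFil {X Y : Type*} {mX : MeasurableSpace X} {mY : MeasurableSpace Y} (G : Filtration ℕ mX)
    (H : Filtration ℕ mY) : Filtration ℕ (mX.prod mY) where
  seq n := (G n).prod (H n)
  mono' _ _ h := prod_mono_measurableSpace (G.mono h) (H.mono h)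
  le' n := prod_mono_measurableSpace (G.le n) (H.le n)

theorem ae_ae_of_ae_prod_symm {X Y : Type*} {mX : MeasurableSpace X} {mY : MeasurableSpace Y}
    {μ : Measure X} {ν : Measure Y} [SFinite μ] [SFinite ν] {p : X × Y → Prop}
    (h : ∀ᵐ w ∂μ.prod ν, p w) : ∀ᵐ y ∂ν, ∀ᵐ x ∂μ, p (x, y) :=
  Measure.ae_ae_of_ae_prod
    ((Measure.measurePreserving_swap (μ := ν) (ν := μ)).quasiMeasurePreserving.ae h)

/-- Averaging the majorant over the first variable gives a majorant on the second factor. Functions,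
unlike sets, can be projected this way, which is why regularity is used in functional form. -/
theorem RegF.snd {X Y : Type*} {mX : MeasurableSpace X} {mY : MeasurableSpace Y}
    {μ : Measure X} {ν : Measure Y} [IsProbabilityMeasure μ] [IsProbabilityMeasure ν]
    {G : Filtration ℕ mX} {H : Filtration ℕ mY} (h : RegF (prodFil G H) (μ.prod ν)) :
    RegF H ν := by
  obtain ⟨R, hR⟩ := h
  refine ⟨R, fun n f hf => ?_⟩
  obtain ⟨b, hb, hle, hbR⟩ := hR n (fun w => f w.2) (measurable_snd_comp hf)
  have hb' : Measurable b := hb.mono ((prodFil G H).le n) le_rfl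
  have hf' : Measurable f := hf.mono (H.le _) le_rfl
  refine ⟨fun y => ∫⁻ x, b (x, y) ∂μ, measurable_lintegral_left (G.le n) hb, ?_, fun C hC => ?_⟩
  · filter_upwards [ae_ae_of_ae_prod_symm hle] with y hy
    calc f y = ∫⁻ _, f y ∂μ := by simp
      _ ≤ _ := lintegral_mono_ae hy
  · have hC' := H.le n _ hC
    have := hbR (Prod.snd ⁻¹' C) (@measurable_snd X Y (G n) (H n) C hC)
    rw [setLIntegral_snd hb' hC', setLIntegral_snd (f := fun w => f w.2)
      (hf'.comp measurable_snd) hC'] at this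
    simpa using this

/-- A norm on the nonnegative functions on `X`, built from the filtered space `(X, μ, G)`. -/
structure MixNorm {X : Type u} {mX : MeasurableSpace X} (μ : Measure X) (G : Filtration ℕ mX)
    (N : (X → ℝ≥0∞) → ℝ≥0∞) : Prop where
  ae_mono : ∀ {g h : X → ℝ≥0∞}, g ≤ᵐ[μ] h → N g ≤ N h
  zero : N 0 = 0
  add_le : ∀ {g h : X → ℝ≥0∞}, Measurable g → Measurable h → N (g + h) ≤ N g + N h
  iSup : ∀ {g : ℕ → X → ℝ≥0∞}, (∀ n, Measurable (g n)) → Monotone g →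
    N (fun x => ⨆ n, g n x) = ⨆ n, N (g n)
  meas : ∀ {Y : Type u} {mY : MeasurableSpace Y} {g : X × Y → ℝ≥0∞}, Measurable[mX.prod mY] g →
    Measurable[mY] fun y => N fun x => g (x, y)
  contr : ∀ {Y : Type u} {F mY : MeasurableSpace Y} {ν : Measure Y} [IsProbabilityMeasure ν],
    F ≤ mY → ∀ {n : ℕ} {u g : X × Y → ℝ≥0∞}, Measurable g →
      SubCE ((G n).prod F) (μ.prod ν) u g →
        SubCE F ν (fun y => N fun x => u (x, y)) (fun y => N fun x => g (x, y))

/-- The maximal inequality in `L_s(Y; N)` for the product of the filtrations `G` and `H`. -/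
def MaxIneq {X Y : Type u} {mX : MeasurableSpace X} {mY : MeasurableSpace Y} (μ : Measure X)
    (G : Filtration ℕ mX) (N : (X → ℝ≥0∞) → ℝ≥0∞) (ν : Measure Y) (H : Filtration ℕ mY)
    (s : ℝ) : Prop :=
  ∃ C : ℝ≥0, ∀ (g : X × Y → ℝ≥0∞) (u : ℕ → X × Y → ℝ≥0∞), Measurable g →
    (∀ n, SubCE (prodFil G H n) (μ.prod ν) (u n) g) →
      ∫⁻ y, (N fun x => ⨆ n, u n (x, y)) ^ s ∂ν ≤ C * ∫⁻ y, (N fun x => g (x, y)) ^ s ∂ν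

theorem MixNorm.mono {X : Type u} {mX : MeasurableSpace X} {μ : Measure X} {G : Filtration ℕ mX}
    {N : (X → ℝ≥0∞) → ℝ≥0∞} (hN : MixNorm μ G N) {g h : X → ℝ≥0∞} (hgh : ∀ x, g x ≤ h x) :
    N g ≤ N h :=
  hN.ae_mono (Filter.Eventually.of_forall hgh)

/-- Optional stopping: `S` marks having started, `D` not having stopped yet, and the dominating
function is `u` at the step of exit from `D`. On `A ∩ D n`, the part outside `D (n + 1)` exits now;
the rest is `ℱ n`-measurable because `D` is predictable, so `u n` can be replaced by `u (n + 1)` and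
the induction continues up to `M + 1`, where `D` is empty. -/
theorem stopped_subCE {W : Type*} {mW : MeasurableSpace W} {μ : Measure W} (ℱ : Filtration ℕ mW)
    {u : ℕ → W → ℝ≥0∞} (hu : ∀ n, Measurable[ℱ n] (u n))
    (hsub : ∀ n A, MeasurableSet[ℱ n] A → ∫⁻ x in A, u n x ∂μ ≤ ∫⁻ x in A, u (n + 1) x ∂μ)
    {S D : ℕ → Set W} (hS : ∀ n, MeasurableSet[ℱ n] (S n)) (hSm : Monotone S)
    (hD : ∀ n, MeasurableSet[ℱ n] (D n)) (hD' : ∀ n, MeasurableSet[ℱ n] (D (n + 1)))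
    (hDm : Antitone D) {M : ℕ} (hDM : D (M + 1) = ∅) (n : ℕ) :
    SubCE (ℱ n) μ ((S n ∩ D n).indicator (u n)) (fun x => ∑ k ∈ Finset.range (M + 1),
      (S k ∩ (D k \ D (k + 1))).indicator (u k) x) := by
  set T : ℕ → W → ℝ≥0∞ := fun k => (S k ∩ (D k \ D (k + 1))).indicator (u k)
  have hTm : ∀ k, Measurable (T k) := fun k =>
    ((hu k).mono (ℱ.le k) le_rfl).indicator
      (ℱ.le k _ ((hS k).inter ((hD k).diff (hD' k))))
  have key : ∀ j n, n + j = M + 1 → ∀ A, MeasurableSet[ℱ n] A → A ⊆ S n →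
      ∫⁻ x in A ∩ D n, u n x ∂μ ≤ ∫⁻ x in A, ∑ k ∈ Finset.Ico n (M + 1), T k x ∂μ := by
    intro j
    induction j with
    | zero =>
      intro n hn A _ _
      have : n = M + 1 := by omega
      subst this
      simp [hDM]
    | succ j ih =>
      intro n hn A hA hAS
      have hA' := ℱ.le n _ hA
      rw [← lintegral_inter_add_sdiff _ (A ∩ D n) (ℱ.le n _ (hD' n)), add_comm]
      have hlt : n < M + 1 := by omega
      simp_rw [Finset.sum_eq_sum_Ico_succ_bot hlt]
      rw [lintegral_add_left (hTm n)]
      refine add_le_add ?_ ?_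
      · rw [lintegral_indicator (ℱ.le n _ ((hS n).inter ((hD n).diff (hD' n)))),
          Measure.restrict_restrict (ℱ.le n _ ((hS n).inter ((hD n).diff (hD' n))))]
        refine lintegral_mono_set fun x hx => ?_
        exact ⟨⟨hAS hx.1.1, hx.1.2, hx.2⟩, hx.1.1⟩
      · have e : A ∩ D n ∩ D (n + 1) = A ∩ D (n + 1) := by
          rw [inter_assoc, inter_eq_right.2 (hDm n.le_succ)]
        rw [e]
        exact (hsub n _ (hA.inter (hD' n))).trans
          (ih (n + 1) (by omega) A (ℱ.mono n.le_succ _ hA) (hAS.trans (hSm n.le_succ)))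
  refine ⟨(hu n).indicator ((hS n).inter (hD n)), fun A hA => ?_⟩
  have hSD := ℱ.le n _ ((hS n).inter (hD n))
  rw [lintegral_indicator hSD, Measure.restrict_restrict hSD]
  by_cases hn : n ≤ M + 1
  · have e : S n ∩ D n ∩ A = A ∩ S n ∩ D n := by
      ext x; simp only [mem_inter_iff]; tauto
    rw [e]
    refine (key (M + 1 - n) n (by omega) (A ∩ S n) (hA.inter (hS n)) inter_subset_right).trans ?_
    refine (lintegral_mono_set inter_subset_left).trans (lintegral_mono fun x => ?_)
    refine Finset.sum_le_sum_of_subset fun k hk => ?_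
    simp only [Finset.mem_Ico, Finset.mem_range] at hk ⊢
    exact hk.2
  · have : D n = ∅ := subset_empty_iff.1 (hDM ▸ hDm (by omega : M + 1 ≤ n))
    simp [this]

/-! ### Changing the outer exponent. -/

section Extrapolation

variable {X Y : Type u} {mX : MeasurableSpace X} {mY : MeasurableSpace Y} {μ : Measure X}
  {ν : Measure Y} {G : Filtration ℕ mX}
  {H : Filtration ℕ mY} {N : (X → ℝ≥0∞) → ℝ≥0∞}

/-- The filtration `H` delayed by one step. -/
def delay (H : Filtration ℕ mY) : Filtration ℕ mY where
  seq n := H (n - 1)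
  mono' _ _ h := H.mono (Nat.sub_le_sub_right h 1)
  le' n := H.le (n - 1)

/-- A sequence dominated by `g` has a predictable majorant dominated by a multiple of `g`. -/
theorem exists_predictable_majorant (hreg : RegF H ν) :
    ∃ R : ℝ≥0, ∀ (a : ℕ → Y → ℝ≥0∞) (g : Y → ℝ≥0∞), Measurable g → (∀ n, SubCE (H n) ν (a n) g) →
      ∃ c : ℕ → Y → ℝ≥0∞, (∀ n, a n ≤ᵐ[ν] c n) ∧
        ∀ n, SubCE (delay H n) ν (c n) (fun y => R * g y) := by
  obtain ⟨R, hR⟩ := hreg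
  -- The delayed filtration equals `H 0` at time zero, so `a 0` is kept there at cost `1`; later
  -- terms cost `R`.
  refine ⟨max 1 R, fun a g hg ha => ?_⟩
  choose b hb hle hbR using fun n => hR n (a (n + 1)) (ha (n + 1)).meas
  refine ⟨fun n => Nat.casesOn n (a 0) b, fun n => ?_, fun n => ?_⟩
  · cases n with
    | zero => exact Filter.EventuallyLE.refl _ _
    | succ n => exact hle n
  · cases n with
    | zero =>
      refine (ha 0).mono_right fun y => ?_
      exact le_mul_of_one_le_left zero_le (by simp)
    | succ n =>
      refine ⟨hb n, fun A hA => (hbR n A hA).trans ?_⟩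
      rw [lintegral_const_mul _ hg]
      refine mul_le_mul' (by simp) ?_
      exact (ha (n + 1)).le A (H.mono n.le_succ _ hA)

/-- The running maximum `max_{j ≤ n} u_j`. -/
def runMax {W : Type*} (u : ℕ → W → ℝ≥0∞) (n : ℕ) (w : W) : ℝ≥0∞ := ⨆ j, ⨆ _ : j ≤ n, u j w

theorem runMax_mono {W : Type*} (u : ℕ → W → ℝ≥0∞) (w : W) : Monotone fun n => runMax u n w :=
  fun _ _ h => iSup_mono fun _ => iSup_mono' fun hj => ⟨hj.trans h, le_rfl⟩

theorem le_runMax {W : Type*} (u : ℕ → W → ℝ≥0∞) {j n : ℕ} (h : j ≤ n) (w : W) :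
    u j w ≤ runMax u n w :=
  le_iSup₂_of_le j h le_rfl

theorem iSup_runMax {W : Type*} (u : ℕ → W → ℝ≥0∞) (w : W) :
    ⨆ n, runMax u n w = ⨆ n, u n w :=
  le_antisymm (iSup_le fun _ => iSup₂_le fun j _ => le_iSup (fun j => u j w) j)
    (iSup_mono fun _ => le_runMax u le_rfl w)

theorem measurable_runMax {W : Type*} {mW : MeasurableSpace W} (ℱ : Filtration ℕ mW)
    {u : ℕ → W → ℝ≥0∞} (hu : ∀ n, Measurable[ℱ n] (u n)) (n : ℕ) : Measurable[ℱ n] (runMax u n) :=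
  Measurable.iSup fun j => Measurable.iSup fun h => (hu j).mono (ℱ.mono h) le_rfl

/-- Start when the norm of the running maximum exceeds `l = 2^k` and stop just before `c` exceeds `δ
l`, or after `M`. Both rules depend on `y` only, so they commute with `N`. The hypothesis at
exponent `q`, applied to the stopped sequence, bounds it by `(δ l)^q` on the set where the start
occurs by `M`, while on the exceptional set the stopped sequence has norm at least `l`. Chebyshev's
inequality concludes. -/
theorem MixNorm.good_lambda (hN : MixNorm μ G N) {q : ℝ} (hq : 0 < q) {C : ℝ≥0}
    (hC : ∀ (g : X × Y → ℝ≥0∞) (u : ℕ → X × Y → ℝ≥0∞), Measurable g →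
      (∀ n, SubCE (prodFil G H n) (μ.prod ν) (u n) g) →
      ∫⁻ y, (N fun x => ⨆ n, u n (x, y)) ^ q ∂ν ≤ C * ∫⁻ y, (N fun x => g (x, y)) ^ q ∂ν)
    {u : ℕ → X × Y → ℝ≥0∞} (hu : ∀ n, Measurable[prodFil G H n] (u n))
    (hsub : ∀ n A, MeasurableSet[prodFil G H n] A →
      ∫⁻ w in A, u n w ∂μ.prod ν ≤ ∫⁻ w in A, u (n + 1) w ∂μ.prod ν)
    {c : ℕ → Y → ℝ≥0∞} (hc : ∀ n, Measurable[delay H n] (c n))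
    (hac : ∀ n, (fun y => N fun x => u n (x, y)) ≤ᵐ[ν] c n) (M : ℕ) (δ : ℝ≥0) (k : ℤ) :
    ν {y | 2 * 2 ^ k < (N fun x => runMax u M (x, y)) ∧ (⨆ n, c n y) ≤ δ * 2 ^ k} ≤
      C * (δ : ℝ≥0∞) ^ q * ν {y | 2 ^ k < N fun x => runMax u M (x, y)} := by
  set l : ℝ≥0∞ := 2 ^ k
  have hl0 : l ≠ 0 := (two_zpow_pos k).ne'
  have hlT : l ≠ ∞ := two_zpow_ne_top k
  set V : ℕ → Y → ℝ≥0∞ := fun n y => N fun x => runMax u n (x, y)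
  have hV : ∀ n, Measurable[H n] (V n) := fun n =>
    hN.meas ((measurable_runMax (prodFil G H) hu n).mono
      (prod_mono_measurableSpace (G.le n) le_rfl) le_rfl)
  have hVm : ∀ y, Monotone fun n => V n y := fun y a b hab =>
    hN.mono fun x => runMax_mono u (x, y) hab
  set S : ℕ → Set Y := fun n => {y | l < V n y}
  set D : ℕ → Set Y := fun n => {y | n ≤ M ∧ ∀ j ≤ n, c j y ≤ δ * l}
  have hS : ∀ n, MeasurableSet[H n] (S n) := fun n => measurableSet_lt measurable_const (hV n)
  have hSm : Monotone S := fun a b hab y (hy : l < V a y) => hy.trans_le (hVm y hab)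
  have hDd : ∀ n, MeasurableSet[delay H n] (D n) := by
    intro n
    refine MeasurableSet.inter (MeasurableSet.const _) ?_
    have : {y | ∀ j ≤ n, c j y ≤ δ * l} = ⋂ j, ⋂ _ : j ≤ n, {y | c j y ≤ δ * l} := by
      ext y; simp
    change MeasurableSet[delay H n] {y | ∀ j ≤ n, c j y ≤ δ * l}
    rw [this]
    exact MeasurableSet.iInter fun j => MeasurableSet.iInter fun hj =>
      measurableSet_le ((hc j).mono ((delay H).mono hj) le_rfl) measurable_const
  have hD : ∀ n, MeasurableSet[H n] (D n) := fun n => H.mono (Nat.sub_le n 1) _ (hDd n)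
  have hDm : Antitone D := fun a b hab y hy => ⟨hab.trans hy.1, fun j hj => hy.2 j (hj.trans hab)⟩
  have hDM : D (M + 1) = ∅ := by
    ext y
    simp [D]
  have hpre : ∀ n A, MeasurableSet[H n] A →
      MeasurableSet[prodFil G H n] (Prod.snd ⁻¹' A : Set (X × Y)) := fun n A hA =>
    @measurable_snd X Y (G n) (H n) A hA
  set v : ℕ → X × Y → ℝ≥0∞ := fun n => (Prod.snd ⁻¹' S n ∩ Prod.snd ⁻¹' D n).indicator (u n)
  set g : X × Y → ℝ≥0∞ := fun x => ∑ n ∈ Finset.range (M + 1),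
      (Prod.snd ⁻¹' S n ∩ (Prod.snd ⁻¹' D n \ Prod.snd ⁻¹' D (n + 1))).indicator (u n) x
  have hvg : ∀ n, SubCE (prodFil G H n) (μ.prod ν) (v n) g :=
    stopped_subCE (prodFil G H) hu hsub (S := fun n => Prod.snd ⁻¹' S n)
      (D := fun n => Prod.snd ⁻¹' D n) (fun n => hpre n _ (hS n))
      (fun a b hab => preimage_mono (hSm hab)) (fun n => hpre n _ (hD n))
      (fun n => hpre n _ (hDd (n + 1))) (fun a b hab => preimage_mono (hDm hab))
      (by simp only [hDM, preimage_empty])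
  have hg : Measurable g := by
    refine Finset.measurable_fun_sum _ fun n _ => ?_
    exact ((hu n).mono ((prodFil G H).le n) le_rfl).indicator ((prodFil G H).le n _
      ((hpre n _ (hS n)).inter ((hpre n _ (hD n)).diff (hpre n _ (hDd (n + 1))))))
  have hSM : MeasurableSet (S M) := H.le M _ (hS M)
  -- For fixed `y` at most one summand of `g` survives, the exit index `n`; there `N (u n) ≤ c n ≤ δ
  -- l`, since `D n` already tests `c n`.
  have hgN : ∀ᵐ y ∂ν, (N fun x => g (x, y)) ^ q ≤ (S M).indicator (fun _ => (δ * l) ^ q) y := by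
    filter_upwards [ae_all_iff.2 hac] with y hy
    by_cases hex : ∃ n, n ≤ M ∧ y ∈ S n ∧ y ∈ D n ∧ y ∉ D (n + 1)
    · obtain ⟨n, hnM, hyS, hyD, hyD'⟩ := hex
      have hgu : (fun x => g (x, y)) = fun x => u n (x, y) := by
        funext x
        simp only [g]
        rw [Finset.sum_eq_single n]
        · exact indicator_of_mem (show (x, y) ∈ Prod.snd ⁻¹' S n ∩
            (Prod.snd ⁻¹' D n \ Prod.snd ⁻¹' D (n + 1)) from ⟨hyS, hyD, hyD'⟩) _
        · intro j _ hjn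
          refine indicator_of_notMem (fun hj => ?_) _
          rcases lt_or_gt_of_ne hjn with h | h
          · exact hj.2.2 (hDm (Nat.succ_le_of_lt h) hyD)
          · exact hyD' (hDm (Nat.succ_le_of_lt h) hj.2.1)
        · intro h
          exact absurd (Finset.mem_range.2 (Nat.lt_succ_of_le hnM)) h
      rw [hgu, indicator_of_mem (hSm hnM hyS)]
      exact ENNReal.rpow_le_rpow ((hy n).trans (hyD.2 n le_rfl)) hq.le
    · have hgu : (fun x => g (x, y)) = 0 := by
        funext x
        refine Finset.sum_eq_zero fun n hn => indicator_of_notMem (fun hj => hex ?_) _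
        exact ⟨n, Nat.lt_succ_iff.1 (Finset.mem_range.1 hn), hj.1, hj.2.1, hj.2.2⟩
      rw [hgu, hN.zero, ENNReal.zero_rpow_of_pos hq]
      exact zero_le
  have hint : ∫⁻ y, (N fun x => ⨆ n, v n (x, y)) ^ q ∂ν ≤ C * ((δ * l) ^ q * ν (S M)) := by
    refine (hC g v hg hvg).trans (mul_le_mul_right ((lintegral_mono_ae hgN).trans_eq ?_) _)
    rw [lintegral_indicator hSM]
    simp
  have hsubset : {y | 2 * l < V M y ∧ (⨆ n, c n y) ≤ δ * l} ⊆
      {y | l ^ q ≤ (N fun x => ⨆ n, v n (x, y)) ^ q} := by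
    rintro y ⟨hy1, hy2⟩
    have hyD : ∀ n ≤ M, y ∈ D n := fun n hn =>
      ⟨hn, fun j _ => (le_iSup (fun n => c n y) j).trans hy2⟩
    have hyS : y ∈ S M := lt_of_le_of_lt (by rw [two_mul]; exact le_self_add) hy1
    have hvm : Measurable fun w => ⨆ n, v n w := Measurable.iSup fun n =>
      (hvg n).meas.mono ((prodFil G H).le n) le_rfl
    have hvm' : Measurable fun x => ⨆ n, v n (x, y) := hvm.comp measurable_prodMk_right
    have hvu : ∀ n ≤ M, y ∈ S n → ∀ x, u n (x, y) ≤ ⨆ n, v n (x, y) := fun n hn hnS x => by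
      refine le_trans ?_ (le_iSup (fun n => v n (x, y)) n)
      rw [show v n (x, y) = u n (x, y) from indicator_of_mem
        (show (x, y) ∈ Prod.snd ⁻¹' S n ∩ Prod.snd ⁻¹' D n from ⟨hnS, hyD n hn⟩) _]
    refine ENNReal.rpow_le_rpow ?_ hq.le
    classical
    -- Before the starting index `σ` the running maximum has norm at most `l`; from `σ` on, `u`
    -- coincides with `v`. Hence `2 l < V M y ≤ l + N (sup v)`.
    set σ := Nat.find (⟨M, hyS⟩ : ∃ n, y ∈ S n)
    have hσ : y ∈ S σ := Nat.find_spec (⟨M, hyS⟩ : ∃ n, y ∈ S n)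
    have hσmin : ∀ j < σ, y ∉ S j := fun j hj => Nat.find_min (⟨M, hyS⟩ : ∃ n, y ∈ S n) hj
    rcases Nat.eq_zero_or_pos σ with h0 | hpos
    · have : V M y ≤ N fun x => ⨆ n, v n (x, y) := hN.mono fun x => iSup₂_le fun j hj =>
        hvu j hj (hSm (h0 ▸ Nat.zero_le j) hσ) x
      exact le_trans (by rw [two_mul]; exact le_self_add) (hy1.le.trans this)
    · have hle : V M y ≤ V (σ - 1) y + N fun x => ⨆ n, v n (x, y) := by
        have hUm : Measurable fun x => runMax u (σ - 1) (x, y) :=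
          ((measurable_runMax (prodFil G H) hu (σ - 1)).mono ((prodFil G H).le _) le_rfl).comp
            measurable_prodMk_right
        refine le_trans (hN.mono fun x => ?_) (hN.add_le hUm hvm')
        refine iSup₂_le fun j hj => ?_
        rcases lt_or_ge j σ with h | h
        · exact le_add_right (le_runMax u (by omega) _)
        · exact le_add_left (hvu j hj (hSm h hσ) x)
      have h1 : V (σ - 1) y ≤ l := not_lt.1 (hσmin (σ - 1) (by omega))
      have h2 : l + l < l + N fun x => ⨆ n, v n (x, y) := by
        rw [← two_mul]
        exact hy1.trans_le (hle.trans (by gcongr))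
      exact ((ENNReal.add_lt_add_iff_left hlT).1 h2).le
  have hNm : Measurable fun y => (N fun x => ⨆ n, v n (x, y)) ^ q :=
    (hN.meas (Measurable.iSup fun n => (hvg n).meas.mono ((prodFil G H).le n) le_rfl)).pow_const q
  have hlq0 : l ^ q ≠ 0 := by simp [hl0, hlT]
  have hlqT : l ^ q ≠ ∞ := ENNReal.rpow_ne_top_of_nonneg hq.le hlT
  have hcheb := (mul_meas_ge_le_lintegral hNm (l ^ q)).trans hint
  rw [ENNReal.mul_rpow_of_nonneg _ _ hq.le] at hcheb
  refine (measure_mono hsubset).trans ?_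
  rw [← ENNReal.mul_le_mul_iff_right hlq0 hlqT]
  refine hcheb.trans_eq ?_
  ring

/-- The good-`λ` inequality bounds the `L_s`-norm of `N (sup u)` by that of `sup c`, where `c` is a
scalar predictable sequence dominated by a multiple of `N g`; the scalar Doob inequality for the
delayed filtration needs only `s > 1`. The running maximum up to `M` is treated first, and `M → ∞`
by monotone convergence. -/
theorem MixNorm.maxIneq_of_maxIneq [IsProbabilityMeasure μ] [IsProbabilityMeasure ν]
    (hN : MixNorm μ G N) (hreg : RegF H ν) {q : ℝ} (hq : 0 < q)
    (h : MaxIneq μ G N ν H q) {s : ℝ} (hs : 1 < s) : MaxIneq μ G N ν H s := by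
  obtain ⟨C, hC⟩ := h
  have hs0 : 0 < s := by linarith
  obtain ⟨C₁, hC₁⟩ := lintegral_rpow_le_of_good_lambda (ν := ν) hq hs0 C
  obtain ⟨R, hR⟩ := exists_predictable_majorant hreg
  set K : ℝ≥0∞ := C₁ * ((2 ^ s * 2 * 2 ^ (s - 1) * dyadicConst (s - 1)) * (R : ℝ≥0∞) ^ s)
  have hK : K ≠ ∞ := by
    have : (2 : ℝ≥0∞) ^ (s - 1) ≠ ∞ := ENNReal.rpow_ne_top_of_nonneg (by linarith) (by simp)
    have : (2 : ℝ≥0∞) ^ s ≠ ∞ := ENNReal.rpow_ne_top_of_nonneg (by linarith) (by simp)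
    finiteness
  refine ⟨K.toNNReal, fun g u₀ hg hu₀ => ?_⟩
  rw [ENNReal.coe_toNNReal hK]
  -- The conditional expectations majorise every admissible sequence and, unlike it, satisfy the
  -- martingale relation needed for stopping.
  set u : ℕ → X × Y → ℝ≥0∞ := fun n => (μ.prod ν)⁻[g|prodFil G H n]
  have hu : ∀ n, SubCE (prodFil G H n) (μ.prod ν) (u n) g := fun n =>
    subCE_condLExp ((prodFil G H).le n) g
  have hsub : ∀ n A, MeasurableSet[prodFil G H n] A →
      ∫⁻ w in A, u n w ∂μ.prod ν ≤ ∫⁻ w in A, u (n + 1) w ∂μ.prod ν := fun n A hA => by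
    rw [setLIntegral_condLExp ((prodFil G H).le n) _ _ hA, setLIntegral_condLExp
      ((prodFil G H).le (n + 1)) _ _ ((prodFil G H).mono n.le_succ _ hA)]
  have hGm : Measurable fun y => N fun x => g (x, y) := hN.meas hg
  obtain ⟨c, hac, hc⟩ := hR (fun n y => N fun x => u n (x, y)) _ hGm
    fun n => hN.contr (H.le n) hg (hu n)
  have hcm : Measurable fun y => ⨆ n, c n y := Measurable.iSup fun n =>
    (hc n).meas.mono ((delay H).le n) le_rfl
  have hUm : ∀ M, Measurable (runMax u M) := fun M =>
    (measurable_runMax (prodFil G H) (fun n => (hu n).meas) M).mono ((prodFil G H).le M) le_rfl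
  have hM : ∀ M, ∫⁻ y, (N fun x => runMax u M (x, y)) ^ s ∂ν ≤
      K * ∫⁻ y, (N fun x => g (x, y)) ^ s ∂ν := by
    intro M
    calc ∫⁻ y, (N fun x => runMax u M (x, y)) ^ s ∂ν ≤ C₁ * ∫⁻ y, (⨆ n, c n y) ^ s ∂ν :=
          hC₁ _ _ (hN.meas (hUm M)) hcm fun δ _ k =>
            hN.good_lambda hq hC (fun n => (hu n).meas) hsub (fun n => (hc n).meas) hac M δ k
      _ ≤ C₁ * ((2 ^ s * 2 * 2 ^ (s - 1) * dyadicConst (s - 1)) *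
            ∫⁻ y, (R * N fun x => g (x, y)) ^ s ∂ν) := by
          gcongr
          exact doob_maximal (delay H) (hGm.const_mul _) hc hs
      _ = _ := by
          simp_rw [ENNReal.mul_rpow_of_nonneg _ _ hs0.le]
          rw [lintegral_const_mul _ (hGm.pow_const s)]
          ring
  have hmono : ∀ᵐ y ∂ν, (N fun x => ⨆ n, u₀ n (x, y)) ≤ N fun x => ⨆ n, u n (x, y) := by
    have : ∀ᵐ w ∂μ.prod ν, ∀ n, u₀ n w ≤ u n w :=
      ae_all_iff.2 fun n => (hu₀ n).ae_le_condLExp ((prodFil G H).le n)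
    filter_upwards [ae_ae_of_ae_prod_symm this] with y hy
    refine hN.ae_mono ?_
    filter_upwards [hy] with x hx
    exact iSup_mono hx
  calc ∫⁻ y, (N fun x => ⨆ n, u₀ n (x, y)) ^ s ∂ν
      ≤ ∫⁻ y, (N fun x => ⨆ n, u n (x, y)) ^ s ∂ν :=
        lintegral_mono_ae (hmono.mono fun y hy => ENNReal.rpow_le_rpow hy hs0.le)
    _ = ∫⁻ y, ⨆ M, (N fun x => runMax u M (x, y)) ^ s ∂ν := by
        refine lintegral_congr fun y => ?_
        rw [← iSup_rpow _ hs0, ← hN.iSup (g := fun M x => runMax u M (x, y))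
          (fun M => (hUm M).comp measurable_prodMk_right)
          fun a b hab x => runMax_mono u (x, y) hab]
        congr 2
        funext x
        exact (iSup_runMax u (x, y)).symm
    _ = ⨆ M, ∫⁻ y, (N fun x => runMax u M (x, y)) ^ s ∂ν :=
        lintegral_iSup (fun M => (hN.meas (hUm M)).pow_const s) fun a b hab y =>
          ENNReal.rpow_le_rpow (hN.mono fun x => runMax_mono u (x, y) hab) hs0.le
    _ ≤ _ := iSup_le hM

end Extrapolation

/-! ### Transport along measurable equivalences. -/

section Transport

variable {W W' : Type*} {m mW : MeasurableSpace W} {mW' : MeasurableSpace W'} {α : Measure W'}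
  {β : Measure W}

theorem setLIntegral_comp_symm (e : W' ≃ᵐ W) (he : MeasurePreserving e α β) (u : W' → ℝ≥0∞)
    (A : Set W) : ∫⁻ w in A, u (e.symm w) ∂β = ∫⁻ w in e ⁻¹' A, u w ∂α := by
  rw [← he.setLIntegral_comp_preimage_emb e.measurableEmbedding]
  simp

theorem measurable_comp_symm (e : W' ≃ᵐ W) {u : W' → ℝ≥0∞}
    (hu : Measurable[m.comap e] u) : Measurable[m] fun w => u (e.symm w) := by
  intro B hB
  obtain ⟨T, hT, hTB⟩ := hu hB
  have : (fun w => u (e.symm w)) ⁻¹' B = T := by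
    change e.symm ⁻¹' (u ⁻¹' B) = T
    rw [← hTB, ← preimage_comp]
    simp
  rwa [this]

theorem SubCE.comp_symm (e : W' ≃ᵐ W) (he : MeasurePreserving e α β) {u g : W' → ℝ≥0∞}
    (h : SubCE (m.comap e) α u g) :
    SubCE m β (fun w => u (e.symm w)) (fun w => g (e.symm w)) := by
  refine ⟨measurable_comp_symm e h.meas, fun A hA => ?_⟩
  rw [setLIntegral_comp_symm e he, setLIntegral_comp_symm e he]
  exact h.le _ ⟨A, hA, rfl⟩

theorem RegF.comp_symm (e : W' ≃ᵐ W) (he : MeasurePreserving e α β) {ℱ' : Filtration ℕ mW'}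
    {ℱ : Filtration ℕ mW} (hℱ : ∀ n, ℱ' n = (ℱ n).comap e) (h : RegF ℱ' α) : RegF ℱ β := by
  obtain ⟨R, hR⟩ := h
  refine ⟨R, fun n f hf => ?_⟩
  obtain ⟨b, hb, hle, hbR⟩ := hR n (fun w => f (e w)) (by
    rw [hℱ]
    exact hf.comp (comap_measurable e))
  rw [hℱ] at hb
  refine ⟨fun w => b (e.symm w), measurable_comp_symm e hb, ?_, fun C hC => ?_⟩
  · have := (he.symm e).quasiMeasurePreserving.ae hle
    filter_upwards [this] with w hw
    simpa using hw
  · rw [setLIntegral_comp_symm e he]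
    have h1 := hbR (e ⁻¹' C) (by rw [hℱ]; exact ⟨C, hC, rfl⟩)
    rwa [he.setLIntegral_comp_preimage_emb e.measurableEmbedding] at h1

end Transport

/-! ### Adding one variable to a mixed norm. -/

section Step

variable {X X' Z Y : Type u} {mX : MeasurableSpace X} {mX' : MeasurableSpace X'}
  {mZ : MeasurableSpace Z} {mY : MeasurableSpace Y} {μ : Measure X} {μ' : Measure X'}
  {ζ : Measure Z} {G : Filtration ℕ mX} {G' : Filtration ℕ mX'} {K : Filtration ℕ mZ}
  {H : Filtration ℕ mY}

/-- Reassociation of `X' × Y` along an identification of `X'` with `X × Z`. -/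
def assocEquiv (Y : Type u) [MeasurableSpace Y] (e : X' ≃ᵐ X × Z) : X' × Y ≃ᵐ X × (Z × Y) :=
  (e.prodCongr (MeasurableEquiv.refl Y)).trans MeasurableEquiv.prodAssoc

theorem measurePreserving_assocEquiv [SFinite μ] [SFinite ζ] {ν : Measure Y} [SFinite ν]
    [SFinite μ'] {e : X' ≃ᵐ X × Z} (he : MeasurePreserving e μ' (μ.prod ζ)) :
    MeasurePreserving (assocEquiv Y e) (μ'.prod ν) (μ.prod (ζ.prod ν)) :=
  (measurePreserving_prodAssoc μ ζ ν).comp (he.prod (MeasurePreserving.id ν))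

theorem comap_assocEquiv {e : X' ≃ᵐ X × Z} {mG' : MeasurableSpace X'} {mG : MeasurableSpace X}
    {mK : MeasurableSpace Z} {mF : MeasurableSpace Y} (h : mG' = (mG.prod mK).comap e) :
    mG'.prod mF = (mG.prod (mK.prod mF)).comap (assocEquiv Y e) := by
  subst h
  simp only [MeasurableSpace.prod, MeasurableSpace.comap_sup, MeasurableSpace.comap_comp, sup_assoc]
  rfl

variable [IsProbabilityMeasure μ] [IsProbabilityMeasure μ'] [IsProbabilityMeasure ζ]
  {N : (X → ℝ≥0∞) → ℝ≥0∞} {N' : (X' → ℝ≥0∞) → ℝ≥0∞}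

/-- The contraction property is the delicate one: with `X' × Y` regrouped as `X × (Z × Y)`, the
contraction of `N` removes `x` with parameter space `Z × Y`, and Minkowski's inequality removes `z`.
This is why the fields of `MixNorm` quantify over all parameter spaces. -/
theorem MixNorm.step (hN : MixNorm μ G N)
    {q : ℝ} (hq : 1 < q) {e : X' ≃ᵐ X × Z} (he : MeasurePreserving e μ' (μ.prod ζ))
    (hG : ∀ n, G' n = (prodFil G K n).comap e)
    (hN' : ∀ g, N' g = (∫⁻ z, (N fun x => g (e.symm (x, z))) ^ q ∂ζ) ^ (1 / q)) :
    MixNorm μ' G' N' := by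
  have hq0 : 0 < q := by linarith
  have hm : ∀ {g : X' → ℝ≥0∞}, Measurable g → Measurable fun z => N fun x => g (e.symm (x, z)) :=
    fun {g} hg => hN.meas (g := fun w => g (e.symm w)) (hg.comp e.symm.measurable)
  refine ⟨?_, ?_, ?_, ?_, ?_, ?_⟩
  · intro g h hgh
    rw [hN', hN']
    have h1 := ae_ae_of_ae_prod_symm ((he.symm e).quasiMeasurePreserving.ae hgh)
    refine ENNReal.rpow_le_rpow (lintegral_mono_ae ?_) (by positivity)
    filter_upwards [h1] with z hz
    exact ENNReal.rpow_le_rpow (hN.ae_mono hz) hq0.le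
  · rw [hN']
    have : N (fun _ => 0) = 0 := hN.zero
    simp [this, hq0]
  · intro g h hg hh
    rw [hN', hN', hN']
    refine le_trans ?_ (ENNReal.lintegral_Lp_add_le (hm hg).aemeasurable (hm hh).aemeasurable hq.le)
    refine ENNReal.rpow_le_rpow (lintegral_mono fun z => ENNReal.rpow_le_rpow ?_ hq0.le)
      (by positivity)
    have hi : Measurable fun x : X => e.symm (x, z) :=
      e.symm.measurable.comp measurable_prodMk_right
    exact hN.add_le (hg.comp hi) (hh.comp hi)
  · intro g hg hmono
    rw [hN']
    simp_rw [hN']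
    rw [← iSup_rpow _ (by positivity), ← lintegral_iSup (fun n => (hm (hg n)).pow_const q)
      fun a b hab z => ENNReal.rpow_le_rpow (hN.mono fun x => hmono hab _) hq0.le]
    congr 1
    refine lintegral_congr fun z => ?_
    have hi : Measurable fun x : X => e.symm (x, z) :=
      e.symm.measurable.comp measurable_prodMk_right
    rw [← iSup_rpow _ hq0, ← hN.iSup (g := fun n x => g n (e.symm (x, z)))
      (fun n => (hg n).comp hi) fun a b hab x => hmono hab _]
  · intro Y mY g hg
    simp_rw [hN']
    have h1 : Measurable fun w : X × (Z × Y) => g ((assocEquiv Y e).symm w) :=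
      hg.comp (assocEquiv Y e).symm.measurable
    have h2 := hN.meas h1
    exact (Measurable.lintegral_prod_left' (h2.pow_const q)).pow_const (1 / q)
  · intro Y F mY ν _ hF n u g hg hu
    simp_rw [hN']
    have hu' : SubCE ((G' n).prod F) (μ'.prod ν) u g := hu
    rw [comap_assocEquiv (hG n)] at hu'
    have h1 := hu'.comp_symm (assocEquiv Y e) (measurePreserving_assocEquiv he)
    have hgm : Measurable fun w : X × (Z × Y) => g ((assocEquiv Y e).symm w) :=
      hg.comp (assocEquiv Y e).symm.measurable
    have h2 := hN.contr (ν := ζ.prod ν) (F := (K n).prod F)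
      (prod_mono_measurableSpace (K.le n) hF) hgm h1
    exact SubCE.minkowski (K.le n) hF (hN.meas hgm) h2 hq

/-- At the matching exponent `q` the two inequalities are the same statement, by Fubini: `L_q(Z × Y;
N) = L_q(Y; L_q(Z; N))`. -/
theorem MaxIneq.step (hN : MixNorm μ G N)
    {ν : Measure Y} [IsProbabilityMeasure ν]
    {q : ℝ} (hq : 1 < q) {e : X' ≃ᵐ X × Z} (he : MeasurePreserving e μ' (μ.prod ζ))
    (hG : ∀ n, G' n = (prodFil G K n).comap e)
    (hN' : ∀ g, N' g = (∫⁻ z, (N fun x => g (e.symm (x, z))) ^ q ∂ζ) ^ (1 / q))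
    (h : MaxIneq μ G N (ζ.prod ν) (prodFil K H) q) : MaxIneq μ' G' N' ν H q := by
  have hq0 : 0 < q := by linarith
  obtain ⟨C, hC⟩ := h
  refine ⟨C, fun g u hg hu => ?_⟩
  have hu' : ∀ n, SubCE (prodFil G (prodFil K H) n) (μ.prod (ζ.prod ν))
      (fun w => u n ((assocEquiv Y e).symm w)) (fun w => g ((assocEquiv Y e).symm w)) := fun n => by
    have h1 := hu n
    change SubCE ((G' n).prod (H n)) (μ'.prod ν) (u n) g at h1
    rw [comap_assocEquiv (hG n)] at h1
    exact h1.comp_symm (assocEquiv Y e) (measurePreserving_assocEquiv he)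
  have hgm : Measurable fun w : X × (Z × Y) => g ((assocEquiv Y e).symm w) :=
    hg.comp (assocEquiv Y e).symm.measurable
  have hum : Measurable fun w : X × (Z × Y) => ⨆ n, u n ((assocEquiv Y e).symm w) :=
    Measurable.iSup fun n => (hu' n).meas.mono ((prodFil G (prodFil K H)).le n) le_rfl
  have h2 := hC _ _ hgm hu'
  have hpow : ∀ f : X' × Y → ℝ≥0∞, Measurable (fun w : X × (Z × Y) => f ((assocEquiv Y e).symm w)) →
      ∫⁻ y, (N' fun x => f (x, y)) ^ q ∂ν =
        ∫⁻ zy, (N fun x => f ((assocEquiv Y e).symm (x, zy))) ^ q ∂ζ.prod ν := by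
    intro f hf
    rw [lintegral_prod_symm' _ ((hN.meas hf).pow_const q)]
    refine lintegral_congr fun y => ?_
    rw [hN', ← ENNReal.rpow_mul, one_div_mul_cancel hq0.ne', ENNReal.rpow_one]
    rfl
  rw [hpow g hgm, hpow (fun w => ⨆ n, u n w) hum]
  exact h2

end Step

/-! ### Finite products and the maximal inequality by induction. -/

section Pi

/-- Separation of the last coordinate. -/
def snocEquiv {d : ℕ} (Ω : Fin (d + 1) → Type u) [∀ i, MeasurableSpace (Ω i)] :
    (∀ i, Ω i) ≃ᵐ (∀ i : Fin d, Ω i.castSucc) × Ω (Fin.last d) where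
  toFun x := (fun i => x i.castSucc, x (Fin.last d))
  invFun w := Fin.snoc (α := Ω) w.1 w.2
  left_inv x := Fin.snoc_init_self x
  right_inv w := by
    ext i
    · simp
    · simp
  measurable_toFun := by
    refine Measurable.prodMk (measurable_pi_lambda _ fun i => measurable_pi_apply _)
      (measurable_pi_apply _)
  measurable_invFun := by
    refine measurable_pi_lambda _ fun i => ?_
    refine Fin.lastCases ?_ (fun i => ?_) i
    · change Measurable fun w : (∀ i : Fin d, Ω i.castSucc) × Ω (Fin.last d) =>
        Fin.snoc (α := Ω) w.1 w.2 (Fin.last d)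
      simpa only [Fin.snoc_last] using measurable_snd
    · change Measurable fun w : (∀ i : Fin d, Ω i.castSucc) × Ω (Fin.last d) =>
        Fin.snoc (α := Ω) w.1 w.2 i.castSucc
      simp only [Fin.snoc_castSucc]
      exact (measurable_pi_apply i).comp measurable_fst

theorem snocEquiv_symm_apply {d : ℕ} (Ω : Fin (d + 1) → Type u) [∀ i, MeasurableSpace (Ω i)]
    (w : (∀ i : Fin d, Ω i.castSucc) × Ω (Fin.last d)) :
    (snocEquiv Ω).symm w = Fin.snoc (α := Ω) w.1 w.2 := rfl

variable {d : ℕ} {Ω : Fin (d + 1) → Type u} [m : ∀ i, MeasurableSpace (Ω i)]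

theorem measurePreserving_snocEquiv (P : ∀ i, Measure (Ω i)) [∀ i, IsProbabilityMeasure (P i)] :
    MeasurePreserving (snocEquiv Ω) (Measure.pi P)
      ((Measure.pi fun i : Fin d => P i.castSucc).prod (P (Fin.last d))) := by
  set e := (snocEquiv Ω).symm
  refine MeasurePreserving.symm e ?_
  refine ⟨e.measurable, (Measure.pi_eq fun s _ => ?_).symm⟩
  rw [e.map_apply, Fin.prod_univ_castSucc, ← Measure.pi_pi, ← Measure.prod_prod]
  congr 1 with ⟨x, f⟩
  simp only [mem_preimage, mem_pi, mem_univ, true_implies, mem_prod]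
  rw [Fin.forall_fin_succ']
  simp [e, snocEquiv_symm_apply]

theorem comap_snocEquiv (F : ∀ i, Filtration ℕ (m i)) (n : ℕ) :
    prodFiltration F n = (prodFil (prodFiltration fun i : Fin d => F i.castSucc)
      (F (Fin.last d)) n).comap (snocEquiv Ω) := by
  change (⨆ i, (F i n).comap fun x => x i) =
    ((⨆ i : Fin d, (F i.castSucc n).comap fun x => x i).comap Prod.fst ⊔
      (F (Fin.last d) n).comap Prod.snd).comap (snocEquiv Ω)
  rw [MeasurableSpace.comap_sup, MeasurableSpace.comap_comp, MeasurableSpace.comap_comp,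
    MeasurableSpace.comap_iSup]
  simp_rw [MeasurableSpace.comap_comp]
  apply le_antisymm
  · refine iSup_le fun i => ?_
    refine Fin.lastCases ?_ (fun i => ?_) i
    · exact le_sup_right
    · exact le_sup_of_le_left (le_iSup (fun i : Fin d => (F i.castSucc n).comap
        ((fun x => x i) ∘ Prod.fst ∘ snocEquiv Ω)) i)
  · refine sup_le (iSup_le fun i => ?_) ?_
    · exact le_iSup (fun i => (F i n).comap fun x : ∀ i, Ω i => x i) i.castSucc
    · exact le_iSup (fun i => (F i n).comap fun x : ∀ i, Ω i => x i) (Fin.last d)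

theorem cons_snoc {d : ℕ} {Ω : Fin (d + 2) → Type u} (y : Ω 0) (x : ∀ i : Fin d, Ω i.castSucc.succ)
    (z : Ω (Fin.last (d + 1))) :
    (Fin.cons (α := Ω) y (Fin.snoc (α := fun i => Ω i.succ) x z) : ∀ i, Ω i) =
      Fin.snoc (α := Ω) (Fin.cons (α := fun i => Ω i.castSucc) y x) z := by
  funext i
  refine Fin.cases ?_ (fun i => ?_) i
  · rfl
  · refine Fin.lastCases ?_ (fun i => ?_) i
    · rw [Fin.cons_succ, Fin.snoc_last]
      exact (Fin.snoc_last (α := Ω) _ _).symm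
    · rw [Fin.cons_succ, Fin.snoc_castSucc]
      exact (Fin.snoc_castSucc (α := Ω) _ (Fin.cons (α := fun i => Ω i.castSucc) y x) i.succ).symm

/-- The definition peels off the innermost variable; the induction needs the outermost one. -/
theorem mixedNorm_snoc : ∀ {d : ℕ} (Ω : Fin (d + 1) → Type u) (m : ∀ i, MeasurableSpace (Ω i))
    (P : ∀ i, Measure (Ω i)) (p : Fin (d + 1) → ℝ) (g : (∀ i, Ω i) → ℝ≥0∞),
    mixedNorm Ω m P p g = (∫⁻ z, (mixedNorm (fun i : Fin d => Ω i.castSucc) (fun i => m i.castSucc)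
      (fun i => P i.castSucc) (fun i => p i.castSucc) fun x => g (Fin.snoc (α := Ω) x z)) ^
        p (Fin.last d) ∂P (Fin.last d)) ^ (1 / p (Fin.last d))
  | 0, Ω, m, P, p, g => by
    simp only [mixedNorm]
    refine congrArg (· ^ (1 / p 0)) (lintegral_congr fun z => ?_)
    refine congrArg (fun w => g w ^ p 0) (funext fun i => ?_)
    refine Fin.lastCases ?_ (fun i => i.elim0) i
    exact (Fin.snoc_last (α := Ω) _ _).symm
  | d + 1, Ω, m, P, p, g => by
    rw [mixedNorm, mixedNorm_snoc]
    refine congrArg (· ^ (1 / p (Fin.last (d + 1)))) (lintegral_congr fun z => ?_)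
    refine congrArg (· ^ (p (Fin.last (d + 1)))) ?_
    conv_rhs => rw [mixedNorm]
    simp_rw [cons_snoc]
    rfl

/-- The empty product is a point with its Dirac measure, and the norm is evaluation at that point.
-/
theorem mixNorm_isEmpty (Ω : Fin 0 → Type u) [m : ∀ i, MeasurableSpace (Ω i)]
    (P : ∀ i, Measure (Ω i)) (G : Filtration ℕ (MeasurableSpace.pi : MeasurableSpace (∀ i, Ω i)))
    (p : Fin 0 → ℝ) : MixNorm (Measure.pi P) G (mixedNorm Ω m P p) := by
  have hp : ∀ q : (∀ i, Ω i) → Prop, (∀ᵐ x ∂Measure.pi P, q x) → q (fun i => i.elim0) := by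
    intro q hq
    rw [Measure.pi_of_empty P (fun i => i.elim0)] at hq
    exact (ae_dirac_iff (Set.toFinite _).measurableSet).1 hq
  refine ⟨fun h => hp _ h, rfl, fun _ _ => le_rfl, fun _ _ => rfl, fun {Y mY g} hg => ?_, ?_⟩
  · exact hg.comp measurable_prodMk_left
  · intro Y F mY ν _ hF n u g hg hu
    have hum : Measurable u := hu.meas.mono (prod_mono_measurableSpace (G.le n) hF) le_rfl
    refine ⟨hu.meas.comp (@measurable_prodMk_left _ _ (G n) F _), fun A hA => ?_⟩
    have := hu.le (Prod.snd ⁻¹' A) (@measurable_snd _ Y (G n) F A hA)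
    rw [setLIntegral_snd hum (hF _ hA), setLIntegral_snd hg (hF _ hA)] at this
    simp_rw [Measure.pi_of_empty P (fun i => i.elim0)] at this
    simpa [mixedNorm] using this

/-- The extra factor `Y` and the freedom in `s` are what make the induction run: the hypothesis is
used with the last variable merged into `Y` and `s = p (Fin.last d)`, then extrapolated to the
required `s`. The base case is the scalar Doob inequality on `Y`. -/
theorem mixedNorm_maximal (d : ℕ) : ∀ (Ω : Fin d → Type u) [m : ∀ i, MeasurableSpace (Ω i)]
    (P : ∀ i, Measure (Ω i)) [∀ i, IsProbabilityMeasure (P i)] (F : ∀ i, Filtration ℕ (m i))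
    (p : Fin d → ℝ), (∀ i, 1 < p i) →
    MixNorm (Measure.pi P) (prodFiltration F) (mixedNorm Ω m P p) ∧
      ∀ {Y : Type u} {mY : MeasurableSpace Y} {ν : Measure Y} [IsProbabilityMeasure ν]
        {H : Filtration ℕ mY}, RegF (prodFil (prodFiltration F) H) ((Measure.pi P).prod ν) →
        ∀ s, 1 < s → MaxIneq (Measure.pi P) (prodFiltration F) (mixedNorm Ω m P p) ν H s := by
  induction d with
  | zero =>
    intro Ω m P _ F p hp
    have hN := mixNorm_isEmpty Ω P (prodFiltration F) p
    refine ⟨hN, fun {Y mY ν _ H} _ s hs => ?_⟩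
    have hK : (2 ^ s * 2 * 2 ^ (s - 1) * dyadicConst (s - 1) : ℝ≥0∞) ≠ ∞ := by
      have : (2 : ℝ≥0∞) ^ (s - 1) ≠ ∞ := ENNReal.rpow_ne_top_of_nonneg (by linarith) (by simp)
      have : (2 : ℝ≥0∞) ^ s ≠ ∞ := ENNReal.rpow_ne_top_of_nonneg (by linarith) (by simp)
      finiteness
    refine ⟨(2 ^ s * 2 * 2 ^ (s - 1) * dyadicConst (s - 1) : ℝ≥0∞).toNNReal, fun g u hg hu => ?_⟩
    rw [ENNReal.coe_toNNReal hK]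
    exact doob_maximal H (hN.meas hg) (fun n => hN.contr (H.le n) hg (hu n)) hs
  | succ d ih =>
    intro Ω m P _ F p hp
    obtain ⟨hN, hmax⟩ := ih (fun i => Ω i.castSucc) (fun i => P i.castSucc)
      (fun i => F i.castSucc) (fun i => p i.castSucc) fun i => hp _
    have hq := hp (Fin.last d)
    have hN' := hN.step hq (measurePreserving_snocEquiv P) (comap_snocEquiv F)
      (mixedNorm_snoc Ω m P p)
    refine ⟨hN', fun {Y mY ν _ H} hreg s hs => ?_⟩
    refine hN'.maxIneq_of_maxIneq hreg.snd (q := p (Fin.last d)) (by linarith) ?_ hs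
    refine MaxIneq.step hN hq (measurePreserving_snocEquiv P) (comap_snocEquiv F)
      (mixedNorm_snoc Ω m P p) (hmax ?_ _ hq)
    exact hreg.comp_symm (assocEquiv Y (snocEquiv Ω))
      (measurePreserving_assocEquiv (measurePreserving_snocEquiv P))
      fun n => comap_assocEquiv (comap_snocEquiv F n)

end Pi

/-! ### Elementary properties of the mixed norm and Doob's inequality. -/

section MixedNorm

theorem mixedNorm_ae_mono : ∀ {d : ℕ} {Ω : Fin d → Type u} [m : ∀ i, MeasurableSpace (Ω i)]
    {P : ∀ i, Measure (Ω i)} [∀ i, IsProbabilityMeasure (P i)] {p : Fin d → ℝ}, (∀ i, 0 < p i) →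
    ∀ {g h : (∀ i, Ω i) → ℝ≥0∞}, g ≤ᵐ[Measure.pi P] h → mixedNorm Ω m P p g ≤ mixedNorm Ω m P p h
  | 0, Ω, m, P, _, p, _, g, h, hgh =>
    (mixNorm_isEmpty Ω P
      (prodFiltration fun i => (⊤ : Filtration ℕ (m i))) p).ae_mono hgh
  | d + 1, Ω, m, P, _, p, hp, g, h, hgh => by
    have hq := hp (Fin.last d)
    rw [mixedNorm_snoc, mixedNorm_snoc]
    have h1 := ae_ae_of_ae_prod_symm
      (((measurePreserving_snocEquiv P).symm _).quasiMeasurePreserving.ae hgh)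
    refine ENNReal.rpow_le_rpow (lintegral_mono_ae ?_) (by positivity)
    filter_upwards [h1] with z hz
    exact ENNReal.rpow_le_rpow (mixedNorm_ae_mono (fun i => hp _) hz) hq.le

theorem mixedNorm_mono {d : ℕ} {Ω : Fin d → Type u} [m : ∀ i, MeasurableSpace (Ω i)]
    {P : ∀ i, Measure (Ω i)} [∀ i, IsProbabilityMeasure (P i)] {p : Fin d → ℝ} (hp : ∀ i, 0 < p i)
    {g h : (∀ i, Ω i) → ℝ≥0∞} (hgh : ∀ x, g x ≤ h x) :
    mixedNorm Ω m P p g ≤ mixedNorm Ω m P p h :=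
  mixedNorm_ae_mono hp (Filter.Eventually.of_forall hgh)

theorem mixedNorm_const_mul : ∀ {d : ℕ} (Ω : Fin d → Type u) (m : ∀ i, MeasurableSpace (Ω i))
    (P : ∀ i, Measure (Ω i)) {p : Fin d → ℝ}, (∀ i, 0 < p i) → ∀ (c : ℝ≥0)
    (g : (∀ i, Ω i) → ℝ≥0∞), mixedNorm Ω m P p (fun x => c * g x) = c * mixedNorm Ω m P p g
  | 0, _, _, _, _, _, _, _ => rfl
  | d + 1, Ω, m, P, p, hp, c, g => by
    have h0 := hp 0
    have : (c : ℝ≥0∞) ^ p 0 ≠ ∞ := ENNReal.rpow_ne_top_of_nonneg h0.le (by simp)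
    simp only [mixedNorm, ENNReal.mul_rpow_of_nonneg _ _ h0.le, lintegral_const_mul' _ _ this]
    simp_rw [ENNReal.mul_rpow_of_nonneg _ _ (one_div_pos.2 h0).le, ← ENNReal.rpow_mul,
      mul_one_div_cancel h0.ne', ENNReal.rpow_one]
    exact mixedNorm_const_mul _ _ _ (fun i => hp i.succ) c _

/-- This rescaling moves arbitrary positive exponents above `1`. -/
theorem mixedNorm_rpow : ∀ {d : ℕ} (Ω : Fin d → Type u) (m : ∀ i, MeasurableSpace (Ω i))
    (P : ∀ i, Measure (Ω i)) (p : Fin d → ℝ) {a : ℝ}, a ≠ 0 → ∀ (g : (∀ i, Ω i) → ℝ≥0∞),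
    mixedNorm Ω m P p (fun x => g x ^ a) = mixedNorm Ω m P (fun i => a * p i) g ^ a
  | 0, _, _, _, _, _, _, _ => rfl
  | d + 1, Ω, m, P, p, a, ha, g => by
    simp only [mixedNorm]
    rw [← mixedNorm_rpow (a := a) _ _ _ _ ha]
    congr 1
    funext x
    rw [← ENNReal.rpow_mul]
    simp_rw [← ENNReal.rpow_mul]
    congr 1
    rw [one_div_mul_eq_div, ← div_div, div_self ha]

theorem mixedNorm_one : ∀ {d : ℕ} (Ω : Fin d → Type u) (m : ∀ i, MeasurableSpace (Ω i))
    (P : ∀ i, Measure (Ω i)) [∀ i, IsProbabilityMeasure (P i)] (p : Fin d → ℝ),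
    mixedNorm Ω m P p (fun _ => 1) = 1
  | 0, _, _, _, _, _ => rfl
  | d + 1, Ω, m, P, _, p => by
    simp only [mixedNorm, ENNReal.one_rpow, lintegral_const, measure_univ, mul_one]
    exact mixedNorm_one _ _ _ _

/-- The last variable plays the part of the extra factor `Y`, with outer exponent its own. -/
theorem mixedNorm_doob {d : ℕ} (hd : 1 ≤ d) {Ω : Fin d → Type u} [m : ∀ i, MeasurableSpace (Ω i)]
    (P : ∀ i, Measure (Ω i)) [∀ i, IsProbabilityMeasure (P i)] (F : ∀ i, Filtration ℕ (m i))
    (hreg : RegF (prodFiltration F) (Measure.pi P)) (p : Fin d → ℝ) (hp : ∀ i, 1 < p i) :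
    ∃ C : ℝ≥0, ∀ (g : (∀ i, Ω i) → ℝ≥0∞) (u : ℕ → (∀ i, Ω i) → ℝ≥0∞), Measurable g →
      (∀ n, SubCE (prodFiltration F n) (Measure.pi P) (u n) g) →
        mixedNorm Ω m P p (fun x => ⨆ n, u n x) ≤ C * mixedNorm Ω m P p g := by
  obtain ⟨d, rfl⟩ : ∃ e, d = e + 1 := ⟨d - 1, by omega⟩
  have hq := hp (Fin.last d)
  have hq0 : 0 < p (Fin.last d) := by linarith
  have he := measurePreserving_snocEquiv P
  obtain ⟨C, hC⟩ := (mixedNorm_maximal d (fun i => Ω i.castSucc) (fun i => P i.castSucc)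
    (fun i => F i.castSucc) (fun i => p i.castSucc) fun i => hp _).2 (ν := P (Fin.last d))
    (H := F (Fin.last d)) (hreg.comp_symm (snocEquiv Ω) he fun n => comap_snocEquiv F n) _ hq
  refine ⟨C ^ (1 / p (Fin.last d)), fun g u hg hu => ?_⟩
  have h1 := hC (fun w => g ((snocEquiv Ω).symm w)) (fun n w => u n ((snocEquiv Ω).symm w))
    (hg.comp (snocEquiv Ω).symm.measurable) fun n => by
      have h2 := hu n
      rw [comap_snocEquiv F n] at h2
      exact h2.comp_symm _ he
  rw [mixedNorm_snoc, mixedNorm_snoc, ENNReal.coe_rpow_of_nonneg _ (by positivity),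
    ← ENNReal.mul_rpow_of_nonneg _ _ (by positivity)]
  exact ENNReal.rpow_le_rpow h1 (by positivity)

end MixedNorm

/-! ### Predictable controls in the regular case. -/

section Control

theorem exists_exponent {d : ℕ} {p : Fin d → ℝ} (hp : ∀ i, 0 < p i) :
    ∃ r : ℝ, 0 < r ∧ r < 1 ∧ ∀ i, r < p i := by
  have : ∀ᶠ r in nhdsWithin (0 : ℝ) (Ioi 0), 0 < r ∧ r < 1 ∧ ∀ i, r < p i := by
    refine Filter.Eventually.and self_mem_nhdsWithin (Filter.Eventually.and ?_
      (Filter.eventually_all.2 fun i => ?_))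
    · exact nhdsWithin_le_nhds (Iio_mem_nhds one_pos)
    · exact nhdsWithin_le_nhds (Iio_mem_nhds (hp i))
  exact this.exists

variable {d : ℕ} {Ω : Fin d → Type u} [m : ∀ i, MeasurableSpace (Ω i)]

/-- In the regular case an adapted integrable sequence `t` with `t_n ≤ T` has a predictable
control whose limit is bounded by `T` in the mixed norm. -/
theorem exists_control (hd : 1 ≤ d) (P : ∀ i, Measure (Ω i)) [∀ i, IsProbabilityMeasure (P i)]
    (F : ∀ i, Filtration ℕ (m i)) (hreg : IsRegular (prodFiltration F) (Measure.pi P))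
    {p : Fin d → ℝ} (hp : ∀ i, 0 < p i) :
    ∃ C : ℝ≥0, ∀ (t : ℕ → (∀ i, Ω i) → ℝ) (T : (∀ i, Ω i) → ℝ≥0∞), Measurable T →
      (∀ n, Measurable[prodFiltration F n] (t n)) → (∀ n, Integrable (t n) (Measure.pi P)) →
      (∀ n x, ENNReal.ofReal (t n x) ≤ T x) →
      ∃ l, IsControl (prodFiltration F) l ∧ (∀ n, ∀ᵐ x ∂Measure.pi P, t (n + 1) x ≤ l n x) ∧
        mixedNorm Ω m P p (limFn l) ≤ C * mixedNorm Ω m P p T := by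
  obtain ⟨r, hr0, hr1, hrp⟩ := exists_exponent hp
  obtain ⟨R, hR⟩ := hreg.le_condLExp
  obtain ⟨C, hC⟩ := mixedNorm_doob hd P F hreg.regF (fun i => 1 / r * p i) fun i => by
    rw [one_div_mul_eq_div, one_lt_div hr0]; exact hrp i
  have hr' : 0 < 1 / r := by positivity
  refine ⟨(C * R) ^ (1 / r), fun t T hT htm hti htT => ?_⟩
  set ℱ := prodFiltration F
  set μ := Measure.pi P
  -- The power `r < 1` serves twice: it raises the exponents to `p_i / r > 1` for Doob's inequality,
  -- and it keeps `h` integrable by `y^r ≤ 1 + y`.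
  set h : ℕ → (∀ i, Ω i) → ℝ≥0∞ := fun n x => ENNReal.ofReal (t n x) ^ r
  have hh : ∀ n, Measurable[ℱ n] (h n) := fun n => (htm n).ennreal_ofReal.pow_const r
  set b : ℕ → (∀ i, Ω i) → ℝ≥0∞ := fun n x => R * (μ⁻[h (n + 1)|ℱ n]) x
  have hb : ∀ n, Measurable[ℱ n] (b n) := fun n => (measurable_condLExp _ _ _).const_mul _
  have hbT : ∀ n, SubCE (ℱ n) μ (b n) fun x => R * T x ^ r := by
    refine fun n => ⟨hb n, fun A hA => ?_⟩
    rw [lintegral_const_mul _ (measurable_condLExp' (ℱ n) μ _),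
          setLIntegral_condLExp (ℱ.le n) μ _ hA,
      lintegral_const_mul _ (hT.pow_const r)]
    exact mul_le_mul_right (lintegral_mono fun x => ENNReal.rpow_le_rpow (htT _ _) hr0.le) _
  have hbfin : ∀ᵐ x ∂μ, ∀ n, b n x ≠ ∞ := by
    refine ae_all_iff.2 fun n => ?_
    have hint : ∫⁻ x, h (n + 1) x ∂μ ≠ ∞ := by
      refine ne_top_of_le_ne_top (b := ∫⁻ x, (1 + ‖t (n + 1) x‖ₑ) ∂μ) ?_
        (lintegral_mono fun x => ?_)
      · rw [lintegral_add_left measurable_const]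
        refine ENNReal.add_ne_top.2 ⟨by simp, (hti (n + 1)).2.ne⟩
      · rcases le_total (ENNReal.ofReal (t (n + 1) x)) 1 with h1 | h1
        · exact le_add_right (ENNReal.rpow_le_one h1 hr0.le)
        · refine le_add_left ?_
          calc ENNReal.ofReal (t (n + 1) x) ^ r ≤ ENNReal.ofReal (t (n + 1) x) ^ (1 : ℝ) :=
                ENNReal.rpow_le_rpow_of_exponent_le h1 hr1.le
            _ ≤ _ := by
              rw [ENNReal.rpow_one]
              exact Real.ofReal_le_enorm _
    filter_upwards [condLExp_ne_top (mΩ := ℱ n) hint] with x hx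
    exact ENNReal.mul_ne_top (by simp) hx
  -- Replacing the value `∞`, taken on a null set only, makes the control real-valued and monotone
  -- at every point.
  set b' : ℕ → (∀ i, Ω i) → ℝ≥0∞ := fun n x => if b n x = ∞ then 0 else b n x
  have hb' : ∀ n, Measurable[ℱ n] (b' n) := fun n =>
    Measurable.ite (hb n (measurableSet_singleton ∞)) measurable_const (hb n)
  have hb'b : ∀ n x, b' n x ≤ b n x := fun n x => by
    simp only [b']
    split_ifs with h
    · exact zero_le
    · exact le_rfl
  have hmax : ∀ n x, runMax b' n x ≠ ∞ := by
    intro n x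
    refine ne_top_of_le_ne_top (b := ∑ j ∈ Finset.range (n + 1), b' j x) ?_ ?_
    · refine ENNReal.sum_ne_top.2 fun j _ => ?_
      simp only [b']
      split_ifs with h
      · simp
      · exact h
    · exact iSup₂_le fun j hj => Finset.single_le_sum (f := fun j => b' j x) (fun _ _ => zero_le)
        (Finset.mem_range.2 (Nat.lt_succ_of_le hj))
  set l : ℕ → (∀ i, Ω i) → ℝ := fun n x => (runMax b' n x ^ (1 / r)).toReal
  have hl : ∀ n x, ENNReal.ofReal (l n x) = runMax b' n x ^ (1 / r) := fun n x =>
    ENNReal.ofReal_toReal (ENNReal.rpow_ne_top_of_nonneg hr'.le (hmax n x))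
  refine ⟨l, ⟨fun n => ?_, fun n x => ENNReal.toReal_nonneg, fun x n k hnk => ?_⟩, fun n => ?_, ?_⟩
  · exact ((measurable_runMax ℱ hb' n).pow_const _).ennreal_toReal
  · refine ENNReal.toReal_mono (ENNReal.rpow_ne_top_of_nonneg hr'.le (hmax k x)) ?_
    exact ENNReal.rpow_le_rpow (runMax_mono b' x hnk) hr'.le
  · filter_upwards [hR n (h (n + 1)) (hh (n + 1)), hbfin] with x hx hfin
    have h1 : h (n + 1) x ≤ runMax b' n x := by
      refine le_trans ?_ (le_runMax b' le_rfl x)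
      simp only [b', if_neg (hfin n)]
      exact hx
    rw [← ENNReal.ofReal_le_ofReal_iff ENNReal.toReal_nonneg]
    change _ ≤ ENNReal.ofReal (l n x)
    rw [hl]
    calc ENNReal.ofReal (t (n + 1) x) = h (n + 1) x ^ (1 / r) := by
          simp only [h]
          rw [← ENNReal.rpow_mul, mul_one_div_cancel hr0.ne', ENNReal.rpow_one]
      _ ≤ _ := ENNReal.rpow_le_rpow h1 hr'.le
  · have hlim : ∀ x, limFn l x ≤ (⨆ n, b n x) ^ (1 / r) := fun x => by
      simp only [limFn, hl]
      rw [← iSup_rpow _ hr', iSup_runMax]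
      exact ENNReal.rpow_le_rpow (iSup_mono fun n => hb'b n x) hr'.le
    have hTr : mixedNorm Ω m P (fun i => 1 / r * p i) (fun x => T x ^ r) =
        mixedNorm Ω m P p T ^ r := by
      rw [mixedNorm_rpow _ _ _ _ hr0.ne']
      congr 2
      funext i
      field_simp
    calc mixedNorm Ω m P p (limFn l)
        ≤ mixedNorm Ω m P p (fun x => (⨆ n, b n x) ^ (1 / r)) := mixedNorm_mono hp hlim
      _ = mixedNorm Ω m P (fun i => 1 / r * p i) (fun x => ⨆ n, b n x) ^ (1 / r) :=
          mixedNorm_rpow _ _ _ _ hr'.ne' _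
      _ ≤ (C * (R * mixedNorm Ω m P p T ^ r)) ^ (1 / r) := by
          refine ENNReal.rpow_le_rpow
            ((hC _ b ((hT.pow_const r).const_mul _) hbT).trans_eq ?_) hr'.le
          rw [mixedNorm_const_mul _ _ _ (fun i => mul_pos hr' (hp i)), hTr]
      _ = _ := by
          rw [← mul_assoc, ENNReal.mul_rpow_of_nonneg _ _ hr'.le, ← ENNReal.rpow_mul,
            mul_one_div_cancel hr0.ne', ENNReal.rpow_one, ← ENNReal.coe_mul,
            ENNReal.coe_rpow_of_nonneg _ hr'.le]

end Control

theorem ofReal_two_zpow (k : ℤ) : ENNReal.ofReal ((2 : ℝ) ^ k) = (2 : ℝ≥0∞) ^ k := by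
  have : ENNReal.ofReal ((2 : ℝ) ^ k) = (((2 : ℝ≥0) ^ k : ℝ≥0) : ℝ≥0∞) := by
    rw [← ENNReal.ofReal_coe_nnreal]
    push_cast
    rfl
  rw [this, ENNReal.coe_zpow two_ne_zero]
  rfl

/-! ### Cutting a sequence along the dyadic levels of its control. -/

section Block

variable {W : Type*}

/-- The part of `f` (null at time `0`) whose increments occur while `2^k < l ≤ 2^{k+1}`. -/
def block (f l : ℕ → W → ℝ) (k : ℤ) (n : ℕ) (x : W) : ℝ :=
  ∑ j ∈ Finset.range n, {x | 2 ^ k < l j x ∧ l j x ≤ 2 ^ (k + 1)}.indicator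
    (fun x => f (j + 1) x - f j x) x

/-- The sum of the first increments of `f` while `l ≤ c`. -/
def cutoff (f l : ℕ → W → ℝ) (c : ℝ) (n : ℕ) (x : W) : ℝ :=
  ∑ j ∈ Finset.range n, if l j x ≤ c then f (j + 1) x - f j x else 0

/-- As `l` is monotone, dropping the increments with `l > c` freezes `f` at a time `i` before which
`l ≤ c`. -/
theorem cutoff_eq (f : ℕ → W → ℝ) {l : ℕ → W → ℝ} {x : W} (hl : Monotone fun n => l n x) (c : ℝ)
    (n : ℕ) : ∃ i, cutoff f l c n x = f i x - f 0 x ∧ ∀ j < i, l j x ≤ c := by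
  induction n with
  | zero => exact ⟨0, by simp [cutoff], by simp⟩
  | succ n ih =>
    by_cases h : l n x ≤ c
    · refine ⟨n + 1, ?_, fun j hj => (hl (Nat.le_of_lt_succ hj)).trans h⟩
      rw [cutoff, ← Finset.sum_range_sub (fun n => f n x)]
      refine Finset.sum_congr rfl fun j hj => if_pos ?_
      exact (hl (Nat.le_of_lt_succ (Finset.mem_range.1 hj))).trans h
    · obtain ⟨i, hi, hi'⟩ := ih
      refine ⟨i, ?_, hi'⟩
      rw [cutoff, Finset.sum_range_succ, if_neg h, add_zero]
      exact hi

theorem two_zpow_le_succ (k : ℤ) : (2 : ℝ) ^ k ≤ 2 ^ (k + 1) :=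
  zpow_le_zpow_right₀ one_le_two (by omega)

theorem block_eq_cutoff (f l : ℕ → W → ℝ) (k : ℤ) (n : ℕ) (x : W) :
    block f l k n x = cutoff f l (2 ^ (k + 1)) n x - cutoff f l (2 ^ k) n x := by
  rw [block, cutoff, cutoff, ← Finset.sum_sub_distrib]
  refine Finset.sum_congr rfl fun j _ => ?_
  have := two_zpow_le_succ k
  by_cases h1 : l j x ≤ 2 ^ k
  · simp [indicator, h1, h1.trans this, not_lt.2 h1]
  · by_cases h2 : l j x ≤ 2 ^ (k + 1) <;> simp [indicator, h1, h2, not_le.1 h1]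

theorem block_eq_zero {f l : ℕ → W → ℝ} {k : ℤ} {n : ℕ} {x : W} (h : ∀ j < n, l j x ≤ 2 ^ k) :
    block f l k n x = 0 :=
  Finset.sum_eq_zero fun j hj => indicator_of_notMem
    (fun hx => absurd hx.1 (not_lt.2 (h j (Finset.mem_range.1 hj)))) _

/-- Each increment with `l j x > 0` belongs to exactly one dyadic level; one with `l j x = 0`
belongs to none and must vanish. -/
theorem hasSum_block {f l : ℕ → W → ℝ} {x : W} (hl : ∀ n, 0 ≤ l n x) (h0 : f 0 x = 0)
    (hz : ∀ j, l j x = 0 → f (j + 1) x = f j x) (n : ℕ) :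
    HasSum (fun k => block f l k n x) (f n x) := by
  have : f n x = ∑ j ∈ Finset.range n, (f (j + 1) x - f j x) := by
    rw [Finset.sum_range_sub (fun n => f n x), h0, sub_zero]
  rw [this]
  refine hasSum_sum fun j _ => ?_
  set a : ℤ → ℝ := fun k => {x | 2 ^ k < l j x ∧ l j x ≤ 2 ^ (k + 1)}.indicator
    (fun x => f (j + 1) x - f j x) x
  rcases (hl j).eq_or_lt with h | h
  · have ha : a = fun _ => 0 := funext fun k => indicator_of_notMem (fun hx => absurd hx.1
      (not_lt.2 (by rw [← h]; positivity))) _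
    rw [hz j h.symm, sub_self, ha]
    exact hasSum_zero
  · obtain ⟨k₀, h1, h2⟩ := exists_mem_Ioc_zpow h (one_lt_two (α := ℝ))
    have ha : a k₀ = f (j + 1) x - f j x :=
      indicator_of_mem (s := {x | 2 ^ k₀ < l j x ∧ l j x ≤ 2 ^ (k₀ + 1)}) ⟨h1, h2⟩ _
    rw [← ha]
    refine hasSum_single k₀ fun k hk => indicator_of_notMem (fun hx => hk ?_) _
    have a1 : k₀ < k + 1 := (zpow_lt_zpow_iff_right₀ one_lt_two).1 (h1.trans_le hx.2)
    have a2 : k < k₀ + 1 := (zpow_lt_zpow_iff_right₀ one_lt_two).1 (hx.1.trans_le h2)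
    omega

end Block

/-! ### The maximal function and the quadratic variation. -/

/-- The features shared by the maximal function and the quadratic variation: `T f` is the
supremum of the adapted sequence `t f`. -/
structure IsHardyOp {W : Type u} (T : (ℕ → W → ℝ) → W → ℝ≥0∞)
    (t : (ℕ → W → ℝ) → ℕ → W → ℝ) : Prop where
  congr : ∀ {f g : ℕ → W → ℝ} {x : W}, (∀ n, f n x = g n x) → T f x = T g x
  eq_iSup : ∀ (f : ℕ → W → ℝ) (x : W), T f x = ⨆ n, ENNReal.ofReal (t f n x)
  nonneg : ∀ (f : ℕ → W → ℝ) (n : ℕ) (x : W), 0 ≤ t f n x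
  smul : ∀ (c : ℝ) (f : ℕ → W → ℝ) (x : W), T (fun n x => c * f n x) x = ‖c‖ₑ * T f x
  le_tsum : ∀ {c : ℤ → ℝ} {v : ℤ → ℕ → W → ℝ} {f : ℕ → W → ℝ} {x : W},
    (∀ n, HasSum (fun k => c k * v k n x) (f n x)) → T f x ≤ ∑' k, ‖c k‖ₑ * T (v k) x
  adapted : ∀ {mW : MeasurableSpace W} {ℱ : Filtration ℕ mW} {f : ℕ → W → ℝ},
    (∀ n, Measurable[ℱ n] (f n)) → ∀ n, Measurable[ℱ n] (t f n)
  integrable : ∀ {_ : MeasurableSpace W} {μ : Measure W} {f : ℕ → W → ℝ},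
    (∀ n, Integrable (f n) μ) → ∀ n, Integrable (t f n) μ
  zero : ∀ {f : ℕ → W → ℝ} {x : W}, f 0 x = 0 → t f 0 x = 0
  diff_eq_zero : ∀ {f : ℕ → W → ℝ} {n : ℕ} {x : W}, t f n x = 0 → t f (n + 1) x = 0 →
    f (n + 1) x = f n x
  block_le : ∀ {f l : ℕ → W → ℝ} {x : W}, (Monotone fun n => l n x) → f 0 x = 0 →
    (∀ n, t f (n + 1) x ≤ l n x) → ∀ k : ℤ, T (block f l k) x ≤ 3 * 2 ^ k
  sq_bound : ∀ {mW : MeasurableSpace W} {μ : Measure W} [IsProbabilityMeasure μ]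
    {ℱ : Filtration ℕ mW} {f : ℕ → W → ℝ}, Martingale f ℱ μ → (∀ᵐ x ∂μ, f 0 x = 0) →
    ∀ K : ℝ≥0, (∀ᵐ x ∂μ, T f x ≤ K) → ∀ n, eLpNorm (f n) 2 μ ≤ K

theorem isHardyOp_maxFn {W : Type u} :
    IsHardyOp (maxFn : (ℕ → W → ℝ) → W → ℝ≥0∞) (fun f n x => |f n x|) where
  congr h := by simp only [maxFn, h]
  eq_iSup f x := by simp only [maxFn, Real.enorm_eq_ofReal_abs]
  nonneg f n x := abs_nonneg _
  smul c f x := by simp only [maxFn, enorm_mul, ENNReal.mul_iSup]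
  le_tsum {c v f x} h := by
    refine iSup_le fun n => ?_
    rw [← (h n).tsum_eq]
    refine enorm_tsum_le_tsum_enorm.trans (ENNReal.tsum_le_tsum fun k => ?_)
    rw [enorm_mul]
    gcongr
    exact le_iSup (fun n => ‖v k n x‖ₑ) n
  adapted h n := continuous_abs.measurable.comp (h n)
  integrable h n := (h n).abs
  zero h := by simp [h]
  diff_eq_zero h1 h2 := by rw [abs_eq_zero.1 h1, abs_eq_zero.1 h2]
  block_le {f l x} hl h0 h k := by
    have hcut : ∀ c : ℝ, 0 ≤ c → ∀ n, |cutoff f l c n x| ≤ c := by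
      intro c hc n
      obtain ⟨i, hi, hlc⟩ := cutoff_eq f hl c n
      rw [hi, h0, sub_zero]
      cases i with
      | zero => simpa [h0] using hc
      | succ i => exact (h i).trans (hlc i i.lt_succ_self)
    refine iSup_le fun n => ?_
    have h2 : |block f l k n x| ≤ 3 * 2 ^ k := by
      rw [block_eq_cutoff]
      have h3 := hcut (2 ^ (k + 1)) (by positivity) n
      have h4 := hcut (2 ^ k) (by positivity) n
      rw [zpow_add_one₀ two_ne_zero] at h3 ⊢
      refine (abs_sub _ _).trans ?_
      linarith
    rw [Real.enorm_eq_ofReal_abs, ← ofReal_two_zpow,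
      show (3 : ℝ≥0∞) = ENNReal.ofReal 3 by simp, ← ENNReal.ofReal_mul (by norm_num)]
    exact ENNReal.ofReal_le_ofReal h2
  sq_bound {_ μ _ ℱ f} hf h0 K hK n := by
    refine (eLpNorm_le_of_ae_enorm_bound (C := K) ?_).trans (by simp)
    filter_upwards [hK] with x hx
    exact (le_iSup (fun n => ‖f n x‖ₑ) n).trans hx

/-- Minkowski's inequality in `ℓ²` for countably many summands; it gives the countable subadditivity
of the quadratic variation. -/
theorem rpow_sum_tsum_le {n : ℕ} (a : ℤ → ℕ → ℝ≥0∞) :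
    (∑ j ∈ Finset.range n, (∑' k, a k j) ^ (2 : ℝ)) ^ (1 / 2 : ℝ) ≤
      ∑' k, (∑ j ∈ Finset.range n, a k j ^ (2 : ℝ)) ^ (1 / 2 : ℝ) := by
  have hfin : ∀ s : Finset ℤ, (∑ j ∈ Finset.range n, (∑ k ∈ s, a k j) ^ (2 : ℝ)) ^ (1 / 2 : ℝ) ≤
      ∑ k ∈ s, (∑ j ∈ Finset.range n, a k j ^ (2 : ℝ)) ^ (1 / 2 : ℝ) := by
    classical
    intro s
    induction s using Finset.induction_on with
    | empty => simp
    | insert k s hk ih =>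
      simp only [Finset.sum_insert hk]
      exact (ENNReal.Lp_add_le _ _ _ one_le_two).trans (by gcongr)
  have hA : Filter.Tendsto (fun s : Finset ℤ =>
      (∑ j ∈ Finset.range n, (∑ k ∈ s, a k j) ^ (2 : ℝ)) ^ (1 / 2 : ℝ)) Filter.atTop
      (nhds ((∑ j ∈ Finset.range n, (∑' k, a k j) ^ (2 : ℝ)) ^ (1 / 2 : ℝ))) := by
    refine (ENNReal.continuous_rpow_const.tendsto _).comp (tendsto_finsetSum _ fun j _ => ?_)
    exact (ENNReal.continuous_rpow_const.tendsto _).comp ENNReal.summable.hasSum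
  have hB : Filter.Tendsto (fun s : Finset ℤ =>
      ∑ k ∈ s, (∑ j ∈ Finset.range n, a k j ^ (2 : ℝ)) ^ (1 / 2 : ℝ)) Filter.atTop
      (nhds (∑' k, (∑ j ∈ Finset.range n, a k j ^ (2 : ℝ)) ^ (1 / 2 : ℝ))) :=
    ENNReal.summable.hasSum
  exact le_of_tendsto_of_tendsto' hA hB hfin

theorem mdiff_succ {W : Type*} (f : ℕ → W → ℝ) (n : ℕ) (x : W) :
    mdiff f (n + 1) x = f (n + 1) x - f n x := rfl

theorem mdiff_block {W : Type*} (f l : ℕ → W → ℝ) (k : ℤ) (n : ℕ) (x : W) :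
    mdiff (block f l k) (n + 1) x = {x | 2 ^ k < l n x ∧ l n x ≤ 2 ^ (k + 1)}.indicator
      (fun x => f (n + 1) x - f n x) x := by
  rw [mdiff_succ, block, block, Finset.sum_range_succ, add_sub_cancel_left]

theorem ofReal_sqFnUpTo {W : Type*} (f : ℕ → W → ℝ) (n : ℕ) (x : W) :
    ENNReal.ofReal (sqFnUpTo f n x) =
      (∑ j ∈ Finset.range (n + 1), ‖mdiff f j x‖ₑ ^ 2) ^ (1 / 2 : ℝ) := by
  rw [sqFnUpTo, Real.sqrt_eq_rpow, ← ENNReal.ofReal_rpow_of_nonneg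
    (Finset.sum_nonneg fun _ _ => by positivity) (by norm_num),
    ENNReal.ofReal_sum_of_nonneg fun _ _ => by positivity]
  simp_rw [ENNReal.ofReal_pow (abs_nonneg _), Real.enorm_eq_ofReal_abs]

theorem sqFn_eq_iSup {W : Type*} (f : ℕ → W → ℝ) (x : W) :
    sqFn f x = ⨆ n, ENNReal.ofReal (sqFnUpTo f n x) := by
  simp_rw [ofReal_sqFnUpTo]
  rw [sqFn, ← iSup_rpow _ (by norm_num), ENNReal.tsum_eq_iSup_nat'
    (Filter.tendsto_add_atTop_nat 1)]

theorem abs_mdiff_le_sqFnUpTo {W : Type*} (f : ℕ → W → ℝ) {j n : ℕ} (h : j ≤ n) (x : W) :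
    |mdiff f j x| ≤ sqFnUpTo f n x := by
  refine Real.le_sqrt_of_sq_le ?_
  exact Finset.single_le_sum (f := fun j => |mdiff f j x| ^ 2) (fun _ _ => by positivity)
    (Finset.mem_range.2 (Nat.lt_succ_of_le h))

theorem sqFnUpTo_le_sum {W : Type*} (f : ℕ → W → ℝ) (n : ℕ) (x : W) :
    sqFnUpTo f n x ≤ ∑ j ∈ Finset.range (n + 1), |mdiff f j x| := by
  refine Real.sqrt_le_iff.2 ⟨Finset.sum_nonneg fun _ _ => abs_nonneg _, ?_⟩
  exact Finset.sum_sq_le_sq_sum_of_nonneg fun _ _ => abs_nonneg _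

theorem integral_mul_diff {W : Type*} {mW : MeasurableSpace W} {μ : Measure W}
    [IsFiniteMeasure μ] {ℱ : Filtration ℕ mW} {f : ℕ → W → ℝ} (hf : Martingale f ℱ μ) (n : ℕ)
    (hint : Integrable (f n * (f (n + 1) - f n)) μ) :
    ∫ x, f n x * (f (n + 1) x - f n x) ∂μ = 0 := by
  have h1 : μ[f (n + 1) - f n|ℱ n] =ᵐ[μ] 0 := by
    refine (condExp_sub (hf.integrable _) (hf.integrable _) _).trans ?_
    filter_upwards [hf.condExp_ae_eq n.le_succ, hf.condExp_ae_eq (le_refl n)] with x h1 h2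
    simp [h1, h2]
  have h2 : μ[f n * (f (n + 1) - f n)|ℱ n] =ᵐ[μ] 0 := by
    refine (condExp_mul_of_stronglyMeasurable_left (hf.stronglyMeasurable n) hint
      ((hf.integrable _).sub (hf.integrable _))).trans ?_
    filter_upwards [h1] with x hx
    simp [hx]
  have h3 := integral_condExp (μ := μ) (f := f n * (f (n + 1) - f n)) (ℱ.le n)
  rw [integral_congr_ae h2] at h3
  simpa using h3.symm

/-- Orthogonality of the increments: each cross term is `f n` times a difference with zero
conditional mean. -/
theorem integral_sq_eq_sum {W : Type*} {mW : MeasurableSpace W} {μ : Measure W}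
    [IsFiniteMeasure μ] {ℱ : Filtration ℕ mW} {f : ℕ → W → ℝ} (hf : Martingale f ℱ μ)
    (h0 : ∀ᵐ x ∂μ, f 0 x = 0) (hL2 : ∀ n, MemLp (f n) 2 μ) (n : ℕ) :
    ∫ x, f n x ^ 2 ∂μ = ∑ j ∈ Finset.range n, ∫ x, (f (j + 1) x - f j x) ^ 2 ∂μ := by
  induction n with
  | zero =>
    rw [Finset.range_zero, Finset.sum_empty]
    refine integral_eq_zero_of_ae ?_
    filter_upwards [h0] with x hx
    simp [hx]
  | succ n ih =>
    have hd := (hL2 (n + 1)).sub (hL2 n)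
    have h1 : Integrable (f n * (f (n + 1) - f n)) μ := (hL2 n).integrable_mul hd
    have h2 : Integrable (fun x => f n x ^ 2) μ := (hL2 n).integrable_sq
    have h3 : Integrable (fun x => (f (n + 1) x - f n x) ^ 2) μ := hd.integrable_sq
    have h4 : Integrable (fun x => 2 * (f n x * (f (n + 1) x - f n x))) μ := h1.const_mul 2
    rw [Finset.sum_range_succ, ← ih]
    calc ∫ x, f (n + 1) x ^ 2 ∂μ = ∫ x, (f n x ^ 2 + 2 * (f n x * (f (n + 1) x - f n x)) +
          (f (n + 1) x - f n x) ^ 2) ∂μ := by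
          refine integral_congr_ae (Filter.Eventually.of_forall fun x => ?_)
          simp only
          ring
      _ = _ := by
          rw [integral_add (f := fun x => f n x ^ 2 + 2 * (f n x * (f (n + 1) x - f n x)))
            (h2.add h4) h3, integral_add h2 h4, integral_const_mul,
            integral_mul_diff hf n h1]
          ring

theorem isHardyOp_sqFn {W : Type u} :
    IsHardyOp (sqFn : (ℕ → W → ℝ) → W → ℝ≥0∞) sqFnUpTo where
  congr {f g x} h := by
    have : ∀ n, mdiff f n x = mdiff g n x := fun n => by cases n <;> simp [mdiff, h]
    simp only [sqFn, this]
  eq_iSup := sqFn_eq_iSup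
  nonneg f n x := Real.sqrt_nonneg _
  smul c f x := by
    have : ∀ n, mdiff (fun n x => c * f n x) n x = c * mdiff f n x := fun n => by
      cases n <;> simp [mdiff, mul_sub]
    simp only [sqFn, this, enorm_mul, mul_pow, ENNReal.tsum_mul_left]
    rw [ENNReal.mul_rpow_of_nonneg _ _ (by norm_num), ← ENNReal.rpow_natCast, ← ENNReal.rpow_mul]
    norm_num
  le_tsum {c v f x} h := by
    have hd : ∀ n, HasSum (fun k => c k * mdiff (v k) n x) (mdiff f n x) := fun n => by
      cases n with
      | zero => exact h 0
      | succ n => simpa only [mdiff, mul_sub] using (h (n + 1)).sub (h n)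
    rw [sqFn_eq_iSup]
    refine iSup_le fun n => ?_
    rw [ofReal_sqFnUpTo]
    simp_rw [← ENNReal.rpow_two]
    calc (∑ j ∈ Finset.range (n + 1), ‖mdiff f j x‖ₑ ^ (2 : ℝ)) ^ (1 / 2 : ℝ)
        ≤ (∑ j ∈ Finset.range (n + 1), (∑' k, ‖c k‖ₑ * ‖mdiff (v k) j x‖ₑ) ^ (2 : ℝ)) ^
            (1 / 2 : ℝ) := by
          gcongr with j
          rw [← (hd j).tsum_eq]
          refine enorm_tsum_le_tsum_enorm.trans_eq ?_
          simp_rw [enorm_mul]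
      _ ≤ ∑' k, (∑ j ∈ Finset.range (n + 1), (‖c k‖ₑ * ‖mdiff (v k) j x‖ₑ) ^ (2 : ℝ)) ^
            (1 / 2 : ℝ) := rpow_sum_tsum_le _
      _ ≤ _ := by
          refine ENNReal.tsum_le_tsum fun k => ?_
          simp_rw [ENNReal.mul_rpow_of_nonneg _ _ zero_le_two]
          rw [← Finset.mul_sum, ENNReal.mul_rpow_of_nonneg _ _ (by norm_num), ← ENNReal.rpow_mul,
            mul_one_div_cancel two_ne_zero, ENNReal.rpow_one, sqFn]
          simp_rw [ENNReal.rpow_two]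
          gcongr
          exact ENNReal.sum_le_tsum _
  adapted {mW ℱ f} h n := by
    have hm : ∀ j, Measurable[ℱ j] (mdiff f j) := fun j => by
      cases j with
      | zero => exact h 0
      | succ j => exact (h (j + 1)).sub ((h j).mono (ℱ.mono j.le_succ) le_rfl)
    refine Real.continuous_sqrt.measurable.comp (Finset.measurable_fun_sum _ fun j hj => ?_)
    have hj' : j ≤ n := Nat.lt_succ_iff.1 (Finset.mem_range.1 hj)
    exact (continuous_abs.pow 2).measurable.comp ((hm j).mono (ℱ.mono hj') le_rfl)
  integrable {_ μ f} h n := by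
    have hm : ∀ j, Integrable (mdiff f j) μ := fun j => by
      cases j with
      | zero => exact h 0
      | succ j => exact (h (j + 1)).sub (h j)
    have hmeas : AEStronglyMeasurable (sqFnUpTo f n) μ :=
      Real.continuous_sqrt.comp_aestronglyMeasurable
        (Finset.aestronglyMeasurable_fun_sum _ fun j _ =>
          (continuous_abs.pow 2).comp_aestronglyMeasurable (hm j).1)
    refine Integrable.mono' (integrable_finsetSum (Finset.range (n + 1)) fun j _ => (hm j).abs)
      hmeas (Filter.Eventually.of_forall fun x => ?_)
    rw [Real.norm_of_nonneg (show 0 ≤ sqFnUpTo f n x from Real.sqrt_nonneg _)]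
    exact sqFnUpTo_le_sum f n x
  zero h := by simp [sqFnUpTo, mdiff, h]
  diff_eq_zero {f n x} _ h := by
    have h1 := abs_mdiff_le_sqFnUpTo f (le_refl (n + 1)) x
    rw [h, mdiff_succ] at h1
    exact sub_eq_zero.1 (abs_nonpos_iff.1 h1)
  block_le {f l x} hl h0 h k := by
    have hcut : ∀ n, ∑ j ∈ Finset.range n, (if l j x ≤ 2 ^ (k + 1) then |mdiff f (j + 1) x| ^ 2
        else 0) ≤ ((2 : ℝ) ^ (k + 1)) ^ 2 := by
      intro n
      induction n with
      | zero => simp; positivity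
      | succ n ih =>
        by_cases hn : l n x ≤ 2 ^ (k + 1)
        · calc _ ≤ ∑ j ∈ Finset.range (n + 1), |mdiff f (j + 1) x| ^ 2 :=
                Finset.sum_le_sum fun j _ => by
                  split_ifs
                  · exact le_rfl
                  · positivity
            _ ≤ ∑ j ∈ Finset.range (n + 2), |mdiff f j x| ^ 2 := by
                rw [Finset.sum_range_succ' _ (n + 1)]
                exact le_add_of_nonneg_right (by positivity)
            _ = sqFnUpTo f (n + 1) x ^ 2 :=
                (Real.sq_sqrt (Finset.sum_nonneg fun _ _ => by positivity)).symm
            _ ≤ _ := by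
                have : 0 ≤ sqFnUpTo f (n + 1) x := Real.sqrt_nonneg _
                gcongr
                exact (h n).trans hn
        · rw [Finset.sum_range_succ, if_neg hn, add_zero]
          exact ih
    rw [sqFn_eq_iSup]
    refine iSup_le fun n => ?_
    rw [← ofReal_two_zpow, show (3 : ℝ≥0∞) = ENNReal.ofReal 3 by simp,
      ← ENNReal.ofReal_mul (by norm_num)]
    refine ENNReal.ofReal_le_ofReal ?_
    -- The last increment used satisfies `S_{n+1} ≤ l n ≤ 2^{k+1}`. The constant `3` of the maximal
    -- function, `2^{k+1} + 2^k`, is kept for uniformity.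
    have h2 : sqFnUpTo (block f l k) n x ≤ 2 ^ (k + 1) := by
      refine Real.sqrt_le_iff.2 ⟨by positivity, ?_⟩
      rw [Finset.sum_range_succ']
      have hb0 : mdiff (block f l k) 0 x = 0 := by simp [mdiff, block]
      rw [hb0, abs_zero, zero_pow two_ne_zero, add_zero]
      refine le_trans (Finset.sum_le_sum fun j _ => ?_) (hcut n)
      rw [mdiff_block]
      by_cases h2 : l j x ≤ 2 ^ (k + 1)
      · rw [if_pos h2, mdiff_succ]
        by_cases h1 : 2 ^ k < l j x
        · rw [indicator_of_mem (s := {x | 2 ^ k < l j x ∧ l j x ≤ 2 ^ (k + 1)}) ⟨h1, h2⟩]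
        · rw [indicator_of_notMem fun hx => h1 hx.1]
          rw [abs_zero, zero_pow two_ne_zero]
          positivity
      · rw [if_neg h2, indicator_of_notMem fun hx => h2 hx.2]
        simp
    rw [zpow_add_one₀ two_ne_zero] at h2
    have : (0 : ℝ) < 2 ^ k := by positivity
    linarith
  sq_bound {_ μ _ ℱ f} hf h0 K hK n := by
    have ht : ∀ᵐ x ∂μ, ∀ n, sqFnUpTo f n x ≤ K := by
      filter_upwards [hK] with x hx n
      have h1 : ENNReal.ofReal (sqFnUpTo f n x) ≤ K := by
        rw [sqFn_eq_iSup] at hx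
        exact (le_iSup (fun n => ENNReal.ofReal (sqFnUpTo f n x)) n).trans hx
      rw [← ENNReal.ofReal_coe_nnreal] at h1
      exact (ENNReal.ofReal_le_ofReal_iff K.2).1 h1
    -- A crude bound depending on `n`, needed only to make the orthogonality relation available.
    have hL2 : ∀ n, MemLp (f n) 2 μ := by
      intro n
      refine MemLp.of_bound (hf.integrable n).1 (n * K) ?_
      filter_upwards [ht, h0] with x hx hx0
      have : f n x = ∑ j ∈ Finset.range n, (f (j + 1) x - f j x) := by
        rw [Finset.sum_range_sub (fun n => f n x), hx0, sub_zero]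
      rw [this, Real.norm_eq_abs]
      refine (Finset.abs_sum_le_sum_abs _ _).trans ?_
      refine (Finset.sum_le_card_nsmul _ _ (K : ℝ) fun j _ => ?_).trans_eq (by simp)
      exact (abs_mdiff_le_sqFnUpTo f (le_refl (j + 1)) x).trans (hx _)
    have hsq : ∫ x, f n x ^ 2 ∂μ ≤ (K : ℝ) ^ 2 := by
      rw [integral_sq_eq_sum hf h0 hL2]
      have hi : ∀ j, Integrable (fun x => (f (j + 1) x - f j x) ^ 2) μ := fun j =>
        ((hL2 (j + 1)).sub (hL2 j)).integrable_sq
      rw [← integral_finsetSum _ fun j _ => hi j]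
      calc ∫ x, ∑ j ∈ Finset.range n, (f (j + 1) x - f j x) ^ 2 ∂μ ≤ ∫ _, (K : ℝ) ^ 2 ∂μ := by
            refine integral_mono_ae (integrable_finsetSum _ fun j _ => hi j)
              (integrable_const _) ?_
            filter_upwards [ht] with x hx
            calc ∑ j ∈ Finset.range n, (f (j + 1) x - f j x) ^ 2
                ≤ ∑ j ∈ Finset.range (n + 1), |mdiff f j x| ^ 2 := by
                  rw [Finset.sum_range_succ']
                  refine le_add_of_le_of_nonneg (Finset.sum_le_sum fun j _ => ?_) (by positivity)
                  rw [mdiff_succ, sq_abs]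
              _ = sqFnUpTo f n x ^ 2 :=
                  (Real.sq_sqrt (Finset.sum_nonneg fun _ _ => by positivity)).symm
              _ ≤ _ := by
                  have : 0 ≤ sqFnUpTo f n x := Real.sqrt_nonneg _
                  gcongr
                  exact hx n
        _ = _ := by simp
    have h2 : eLpNorm (f n) 2 μ = (∫⁻ x, ‖f n x‖ₑ ^ 2 ∂μ) ^ (1 / 2 : ℝ) := by
      rw [eLpNorm_eq_lintegral_rpow_enorm_toReal two_ne_zero (by simp)]
      simp
    rw [h2, ← ENNReal.rpow_le_rpow_iff (z := 2) two_pos, ← ENNReal.rpow_mul,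
      one_div_mul_cancel two_ne_zero, ENNReal.rpow_one]
    calc ∫⁻ x, ‖f n x‖ₑ ^ 2 ∂μ = ENNReal.ofReal (∫ x, f n x ^ 2 ∂μ) := by
          rw [ofReal_integral_eq_lintegral_ofReal (hL2 n).integrable_sq
            (Filter.Eventually.of_forall fun x => sq_nonneg _)]
          refine lintegral_congr fun x => ?_
          rw [Real.enorm_eq_ofReal_abs, ← ENNReal.ofReal_pow (abs_nonneg _), sq_abs]
      _ ≤ ENNReal.ofReal ((K : ℝ) ^ 2) := ENNReal.ofReal_le_ofReal hsq
      _ = _ := by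
          rw [ENNReal.ofReal_pow K.coe_nonneg, ENNReal.rpow_two]
          simp

/-! ### Sets of mixed norm zero. -/

section MeasureZero

variable {d : ℕ} {Ω : Fin d → Type u} [m : ∀ i, MeasurableSpace (Ω i)]
  {P : ∀ i, Measure (Ω i)} [∀ i, IsProbabilityMeasure (P i)] {p : Fin d → ℝ}

/-- A form of Hölder's inequality on a probability space, read off from the contraction property
with trivial filtrations and a one-point parameter space: there the constant `P(A)` is dominated by
the indicator of `A`. -/
theorem measure_le_mixedNorm (hp : ∀ i, 1 < p i) {A : Set (∀ i, Ω i)} (hA : MeasurableSet A) :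
    Measure.pi P A ≤ mixedNorm Ω m P p (A.indicator 1) := by
  set F : ∀ i, Filtration ℕ (m i) := fun i => Filtration.const ℕ ⊥ bot_le
  have hN := (mixedNorm_maximal d Ω P F p hp).1
  have hbot : (prodFiltration F 0).prod (⊥ : MeasurableSpace PUnit.{u + 1}) = ⊥ := by
    have : prodFiltration F 0 = ⊥ := by
      change (⨆ i, (⊥ : MeasurableSpace (Ω i)).comap fun x : ∀ i, Ω i => x i) = ⊥
      simp
    rw [this]
    simp [MeasurableSpace.prod]
  set g : (∀ i, Ω i) × PUnit.{u + 1} → ℝ≥0∞ := fun w => A.indicator 1 w.1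
  have hg : Measurable g := (measurable_one.indicator hA).comp measurable_fst
  set ν : Measure PUnit.{u + 1} := Measure.dirac PUnit.unit
  have hint : ∫⁻ w, g w ∂(Measure.pi P).prod ν = Measure.pi P A := by
    rw [lintegral_prod _ hg.aemeasurable]
    simp [g, hA]
  have hc : SubCE ((prodFiltration F 0).prod ⊥) ((Measure.pi P).prod ν)
      (fun _ => Measure.pi P A) g := by
    rw [hbot]
    refine ⟨measurable_const, fun B hB => ?_⟩
    rcases MeasurableSpace.measurableSet_bot_iff.1 hB with rfl | rfl
    · simp
    · simp [hint]
  have h1 := (hN.contr (ν := ν) (F := ⊥) bot_le hg hc).le univ MeasurableSet.univ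
  have h2 : mixedNorm Ω m P p (fun _ => Measure.pi P A) = Measure.pi P A := by
    have := mixedNorm_const_mul Ω m P (fun i => one_pos.trans (hp i)) (Measure.pi P A).toNNReal
      (fun _ => 1)
    rw [mixedNorm_one, mul_one, ENNReal.coe_toNNReal (measure_ne_top _ _)] at this
    simpa using this
  simpa [g, h2] using h1

/-- An indicator equals its own powers, so the exponents can be raised above `1`. This covers atoms
with `‖χ‖ = 0`, where normalising divides by zero. -/
theorem measure_eq_zero_of_mixedNorm (hp : ∀ i, 0 < p i) {A : Set (∀ i, Ω i)}
    (hA : MeasurableSet A) (h : mixedNorm Ω m P p (A.indicator 1) = 0) : Measure.pi P A = 0 := by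
  obtain ⟨r, hr0, -, hrp⟩ := exists_exponent hp
  have hr' : 0 < 1 / r := by positivity
  have h1 : mixedNorm Ω m P p (fun x => A.indicator 1 x ^ (1 / r)) = 0 := by
    rw [← h]
    congr 1
    funext x
    by_cases hx : x ∈ A <;> simp [hx, hr0]
  rw [mixedNorm_rpow _ _ _ _ hr'.ne', ENNReal.rpow_eq_zero_iff_of_pos hr'] at h1
  refine le_antisymm ((measure_le_mixedNorm (fun i => ?_) hA).trans h1.le) zero_le
  rw [one_div_mul_eq_div, one_lt_div hr0]
  exact hrp i

end MeasureZero

/-! ### Block martingales and exceedance times. -/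

section Martingale

variable {W : Type u} {mW : MeasurableSpace W} {μ : Measure W} [IsProbabilityMeasure μ]
  {ℱ : Filtration ℕ mW}

theorem uniformIntegrable_of_eLpNorm_two_le {f : ℕ → W → ℝ}
    (hf : ∀ n, AEStronglyMeasurable (f n) μ) {K : ℝ≥0} (hK : ∀ n, eLpNorm (f n) 2 μ ≤ K) :
    UniformIntegrable f 1 μ := by
  refine ⟨hf, fun ε hε => ?_, K, fun n => ?_⟩
  · set δ : ℝ := (ε / (K + 1)) ^ 2
    have hK1 : (0 : ℝ) < K + 1 := by positivity
    refine ⟨δ, by positivity, fun n s hs hsδ => ?_⟩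
    rw [eLpNorm_indicator_eq_eLpNorm_restrict hs]
    have h1 := eLpNorm_le_eLpNorm_mul_rpow_measure_univ (μ := μ.restrict s)
      (p := 1) (q := 2) one_le_two (hf n).restrict
    refine h1.trans ?_
    have h2 : (1 / (1 : ℝ≥0∞).toReal - 1 / (2 : ℝ≥0∞).toReal) = 1 / 2 := by norm_num
    rw [h2, Measure.restrict_apply_univ]
    calc eLpNorm (f n) 2 (μ.restrict s) * μ s ^ (1 / 2 : ℝ)
        ≤ ENNReal.ofReal (K + 1) * ENNReal.ofReal δ ^ (1 / 2 : ℝ) := by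
          gcongr
          refine (eLpNorm_restrict_le _ _ _ _).trans ((hK n).trans ?_)
          rw [← ENNReal.ofReal_coe_nnreal]
          exact ENNReal.ofReal_le_ofReal (by linarith)
      _ = ENNReal.ofReal ε := by
          rw [ENNReal.ofReal_rpow_of_nonneg (by positivity) (by norm_num), ← Real.sqrt_eq_rpow,
            Real.sqrt_sq (by positivity), ← ENNReal.ofReal_mul hK1.le]
          congr 1
          field_simp
  · exact (eLpNorm_le_eLpNorm_of_exponent_le one_le_two (hf n)).trans (hK n)

/-- A martingale transform: whether the increment from `j` to `j + 1` is kept is decided by `l j`,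
which is known at time `j`. -/
theorem martingale_block {f l : ℕ → W → ℝ} (hf : Martingale f ℱ μ) (hl : IsControl ℱ l) (k : ℤ) :
    Martingale (block f l k) ℱ μ := by
  set A : ℕ → Set W := fun j => {x | 2 ^ k < l j x ∧ l j x ≤ 2 ^ (k + 1)}
  have hA : ∀ j, MeasurableSet[ℱ j] (A j) := fun j =>
    (measurableSet_lt measurable_const (hl.adapted j)).inter
      (measurableSet_le (hl.adapted j) measurable_const)
  have hd : ∀ j, StronglyMeasurable[ℱ (j + 1)] ((A j).indicator fun x => f (j + 1) x - f j x) :=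
    fun j => ((hf.stronglyMeasurable (j + 1)).sub
      ((hf.stronglyMeasurable j).mono (ℱ.mono j.le_succ))).indicator (ℱ.mono j.le_succ _ (hA j))
  have hdi : ∀ j, Integrable ((A j).indicator fun x => f (j + 1) x - f j x) μ := fun j =>
    ((hf.integrable (j + 1)).sub (hf.integrable j)).indicator (ℱ.le j _ (hA j))
  refine martingale_of_condExp_sub_eq_zero_nat (fun n => ?_) (fun n => ?_) fun n => ?_
  · exact Finset.stronglyMeasurable_fun_sum _ fun j hj =>
      (hd j).mono (ℱ.mono (Nat.succ_le_of_lt (Finset.mem_range.1 hj)))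
  · exact integrable_finsetSum _ fun j _ => hdi j
  · have e : block f l k (n + 1) - block f l k n = (A n).indicator (f (n + 1) - f n) := by
      funext x
      simp only [Pi.sub_apply, block]
      rw [Finset.sum_range_succ, add_sub_cancel_left]
      rfl
    rw [e]
    refine (condExp_indicator ((hf.integrable (n + 1)).sub (hf.integrable n)) (hA n)).trans ?_
    have h1 := condExp_sub (hf.integrable (n + 1)) (hf.integrable n) (ℱ n)
    filter_upwards [h1, hf.condExp_ae_eq n.le_succ, hf.condExp_ae_eq (le_refl n)] with x h1 h2 h3
    by_cases hx : x ∈ A n <;> simp [hx, h1, h2, h3]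

variable {T : (ℕ → W → ℝ) → W → ℝ≥0∞} {t : (ℕ → W → ℝ) → ℕ → W → ℝ}

theorem IsHardyOp.le_limFn (hT : IsHardyOp T t) {f l : ℕ → W → ℝ} {x : W} (h0 : f 0 x = 0)
    (h : ∀ n, t f (n + 1) x ≤ l n x) : T f x ≤ limFn l x := by
  rw [hT.eq_iSup]
  refine iSup_le fun n => ?_
  cases n with
  | zero => simp [hT.zero h0]
  | succ n =>
    exact (ENNReal.ofReal_le_ofReal (h n)).trans (le_iSup (fun n => ENNReal.ofReal (l n x)) n)

/-- Monotonicity of `l` makes `l`, hence `t`, vanish at all earlier steps too, so both neighbouring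
values of `t` are zero. -/
theorem IsHardyOp.increment_eq_zero (hT : IsHardyOp T t) {f l : ℕ → W → ℝ} {x : W}
    (hl : Monotone fun n => l n x) (h0 : f 0 x = 0) (h : ∀ n, t f (n + 1) x ≤ l n x) {j : ℕ}
    (hj : l j x = 0) : f (j + 1) x = f j x := by
  have hz : ∀ i ≤ j, t f (i + 1) x = 0 := fun i hi =>
    le_antisymm ((h i).trans ((hl hi).trans hj.le)) (hT.nonneg _ _ _)
  refine hT.diff_eq_zero ?_ (hz j le_rfl)
  cases j with
  | zero => exact hT.zero h0
  | succ j => exact hz j j.le_succ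

theorem IsHardyOp.measurable (hT : IsHardyOp T t) {f : ℕ → W → ℝ}
    (hf : ∀ n, Measurable[ℱ n] (f n)) : Measurable (T f) := by
  have : T f = fun x => ⨆ n, ENNReal.ofReal (t f n x) := funext fun x => hT.eq_iSup f x
  rw [this]
  exact Measurable.iSup fun n => ((hT.adapted hf n).mono (ℱ.le n) le_rfl).ennreal_ofReal

theorem IsHardyOp.eq_zero (hT : IsHardyOp T t) {f : ℕ → W → ℝ} {x : W} (h : ∀ n, f n x = 0) :
    T f x = 0 := by
  have h1 : ∀ n, f n x = (fun n x => (0 : ℝ) * f n x) n x := fun n => by simp [h]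
  rw [hT.congr (g := fun n x => (0 : ℝ) * f n x) h1, hT.smul]
  simp

/-- The pointwise bound on `T` of a block gives an `L_2` bound uniform in `n`; the block is
therefore uniformly integrable and closed by its limit, from which the atom is made. -/
theorem IsHardyOp.block_eq_condExp (hT : IsHardyOp T t) {f l : ℕ → W → ℝ} (hf : IsMart ℱ μ f)
    (hl : IsControl ℱ l) (h : ∀ n, ∀ᵐ x ∂μ, t f (n + 1) x ≤ l n x) (k : ℤ) :
    Integrable (Filtration.limitProcess (block f l k) ℱ μ) μ ∧
      ∀ n, block f l k n =ᵐ[μ] μ[Filtration.limitProcess (block f l k) ℱ μ|ℱ n] := by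
  have hb := martingale_block hf.1 hl k
  have hK : ∀ n, eLpNorm (block f l k n) 2 μ ≤ ((3 * 2 ^ k : ℝ≥0) : ℝ≥0∞) := by
    refine hT.sq_bound hb (Filter.Eventually.of_forall fun x => by simp [block]) _ ?_
    filter_upwards [hf.2, ae_all_iff.2 h] with x hx0 hx
    refine (hT.block_le (hl.mono x) hx0 hx k).trans_eq ?_
    rw [ENNReal.coe_mul, ENNReal.coe_zpow two_ne_zero]
    rfl
  have hm : ∀ n, AEStronglyMeasurable (block f l k n) μ := fun n => (hb.integrable n).1
  have hUI := uniformIntegrable_of_eLpNorm_two_le hm hK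
  exact ⟨(Filtration.memLp_limitProcess_of_eLpNorm_bdd hm hK).integrable one_le_two,
    fun n => hb.ae_eq_condExp_limitProcess hUI n⟩

/-- The first time at which `l` exceeds `c`. -/
def exceedTime (l : ℕ → W → ℝ) (c : ℝ) (x : W) : WithTop ℕ :=
  open Classical in if h : ∃ n, c < l n x then (Nat.find h : ℕ) else ⊤

theorem exceedTime_le_iff {l : ℕ → W → ℝ} {c : ℝ} {x : W} (i : ℕ) :
    exceedTime l c x ≤ i ↔ ∃ n ≤ i, c < l n x := by
  classical
  unfold exceedTime
  split_ifs with h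
  · rw [Nat.cast_le, Nat.find_le_iff]
  · refine ⟨fun hi => absurd (top_le_iff.1 hi) (WithTop.natCast_ne_top i), ?_⟩
    rintro ⟨n, -, hn⟩
    exact absurd ⟨n, hn⟩ h

theorem isStoppingTime_exceedTime {l : ℕ → W → ℝ} (hl : IsControl ℱ l) (c : ℝ) :
    IsStoppingTime ℱ (exceedTime l c) := by
  intro i
  have : {x | exceedTime l c x ≤ i} = ⋃ n, ⋃ _ : n ≤ i, {x | c < l n x} := by
    ext x
    simp [exceedTime_le_iff]
  change MeasurableSet[ℱ i] {x | exceedTime l c x ≤ i}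
  rw [this]
  exact MeasurableSet.iUnion fun n => MeasurableSet.iUnion fun hn =>
    measurableSet_lt measurable_const ((hl.adapted n).mono (ℱ.mono hn) le_rfl)

theorem mem_finSet_exceedTime {l : ℕ → W → ℝ} {c : ℝ} {x : W} :
    x ∈ finSet (exceedTime l c) ↔ ∃ n, c < l n x := by
  classical
  change exceedTime l c x < ⊤ ↔ _
  unfold exceedTime
  split_ifs with h <;> simp [h]

theorem mem_finSet_exceedTime_zpow {l : ℕ → W → ℝ} {k : ℤ} {x : W} :
    x ∈ finSet (exceedTime l (2 ^ k)) ↔ (2 : ℝ≥0∞) ^ k < limFn l x := by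
  rw [mem_finSet_exceedTime, limFn, lt_iSup_iff, ← ofReal_two_zpow]
  refine exists_congr fun n => ?_
  rw [ENNReal.ofReal_lt_ofReal_iff']
  exact ⟨fun h => ⟨h, lt_of_le_of_lt (by positivity) h⟩, fun h => h.1⟩

/-- The block at time `n` involves `l j` only for `j < n`, so it still vanishes at `n = τ` itself,
as the definition of an atom requires. -/
theorem block_eq_zero_of_le_exceedTime {f l : ℕ → W → ℝ} {k : ℤ} {n : ℕ} {x : W}
    (h : (n : WithTop ℕ) ≤ exceedTime l (2 ^ k) x) : block f l k n x = 0 := by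
  refine block_eq_zero fun j hj => not_lt.1 fun hlt => ?_
  have h1 : exceedTime l (2 ^ k) x ≤ j := (exceedTime_le_iff j).2 ⟨j, le_rfl, hlt⟩
  exact absurd (Nat.cast_le.1 (h.trans h1)) (not_le.2 hj)

end Martingale

/-- Writing `L` for the right side, every `a k ≤ L`, so `a k ≤ (a k)^t · L^{1-t}`; sum over `k`. -/
theorem tsum_le_rpow_tsum_rpow {ι : Type*} (a : ι → ℝ≥0∞) {t : ℝ} (ht : 0 < t) (ht1 : t ≤ 1) :
    ∑' k, a k ≤ (∑' k, a k ^ t) ^ (1 / t) := by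
  set L := (∑' k, a k ^ t) ^ (1 / t)
  have hL : L ^ t = ∑' k, a k ^ t := by
    rw [← ENNReal.rpow_mul, one_div_mul_cancel ht.ne', ENNReal.rpow_one]
  have ha : ∀ k, a k ≤ L := fun k => by
    rw [← ENNReal.rpow_le_rpow_iff ht, hL]
    exact ENNReal.le_tsum k
  have hsplit : ∀ b : ℝ≥0∞, b = b ^ t * b ^ (1 - t) := fun b => by
    rw [← ENNReal.rpow_add_of_nonneg _ _ ht.le (by linarith), add_sub_cancel, ENNReal.rpow_one]
  calc ∑' k, a k = ∑' k, a k ^ t * a k ^ (1 - t) := tsum_congr fun k => hsplit _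
    _ ≤ ∑' k, a k ^ t * L ^ (1 - t) := by
      refine ENNReal.tsum_le_tsum fun k => ?_
      gcongr
      exact ha k
    _ = L ^ t * L ^ (1 - t) := by rw [ENNReal.tsum_mul_right, hL]
    _ = L := (hsplit L).symm

/-! ### Atomic decompositions. -/

section Atoms

variable {d : ℕ} {Ω : Fin d → Type u} [m : ∀ i, MeasurableSpace (Ω i)]
  {P : ∀ i, Measure (Ω i)} [∀ i, IsProbabilityMeasure (P i)]
  {F : ∀ i, Filtration ℕ (m i)} {p : Fin d → ℝ}
  {T : (ℕ → (∀ i, Ω i) → ℝ) → (∀ i, Ω i) → ℝ≥0∞} {t : (ℕ → (∀ i, Ω i) → ℝ) → ℕ → (∀ i, Ω i) → ℝ}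

theorem chiNorm_le_one (hp : ∀ i, 0 < p i) (τ : (∀ i, Ω i) → WithTop ℕ) : chiNorm P p τ ≤ 1 := by
  rw [← mixedNorm_one Ω m P p]
  refine mixedNorm_mono hp fun x => ?_
  by_cases hx : x ∈ finSet τ <;> simp [hx]

/-- Almost everywhere `T` of an atom is at most the normalised indicator of `{τ < ∞}`: the atom's
bound gives this on the set, and off it every `E_n a` vanishes. Subadditivity of `T` and `ℓ^s ⊂ ℓ^1`
finish. -/
theorem IsHardyOp.le_atomicSize (hT : IsHardyOp T t) (hp : ∀ i, 0 < p i) {s : ℝ} (hs : 0 < s)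
    (hs1 : s ≤ 1) {f : ℕ → (∀ i, Ω i) → ℝ} {c : ℤ → ℝ} {a : ℤ → (∀ i, Ω i) → ℝ}
    {τ : ℤ → (∀ i, Ω i) → WithTop ℕ} (h : IsDecomp P F p T f c a τ) :
    mixedNorm Ω m P p (T f) ≤ atomicSize P p s c τ := by
  refine mixedNorm_ae_mono hp ?_
  have hatom : ∀ᵐ x ∂Measure.pi P, ∀ k,
      T (condMart P F (a k)) x ≤ (finSet (τ k)).indicator 1 x / chiNorm P p (τ k) := by
    refine ae_all_iff.2 fun k => ?_
    filter_upwards [ae_all_iff.2 (h.atom k).vanish,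
      ae_le_essSup (f := (finSet (τ k)).indicator (T (condMart P F (a k))))] with x hx hx2
    by_cases hxk : x ∈ finSet (τ k)
    · rw [indicator_of_mem hxk] at hx2 ⊢
      rw [Pi.one_apply, one_div]
      exact hx2.trans (h.atom k).bound
    · have htop : τ k x = ⊤ := not_lt_top_iff.1 hxk
      rw [hT.eq_zero fun n => hx n (by rw [htop]; exact le_top)]
      exact zero_le
  filter_upwards [hatom, ae_all_iff.2 h.sum] with x hx hsum
  refine (hT.le_tsum hsum).trans ((ENNReal.tsum_le_tsum fun k => ?_).trans
    (tsum_le_rpow_tsum_rpow _ hs hs1))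
  rw [mul_div_assoc]
  gcongr
  exact hx k

/-- The atoms are the limits of the blocks divided by their bound `3 · 2^k` times `‖χ‖`. Since `τ_k
< ∞` exactly where the limit of `l` exceeds `2^k`, the sum in the atomic size is a dyadic sum of
that limit. -/
theorem IsHardyOp.exists_decomp (hT : IsHardyOp T t) (hp : ∀ i, 0 < p i) {s : ℝ} (hs : 0 < s)
    {f l : ℕ → (∀ i, Ω i) → ℝ} (hf : IsMart (prodFiltration F) (Measure.pi P) f)
    (hl : IsControl (prodFiltration F) l)
    (h : ∀ n, ∀ᵐ x ∂Measure.pi P, t f (n + 1) x ≤ l n x) :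
    ∃ c a τ, IsDecomp P F p T f c a τ ∧ atomicSize P p s c τ ≤
      (3 * dyadicConst s ^ (1 / s) : ℝ≥0) * mixedNorm Ω m P p (limFn l) := by
  set μ := Measure.pi P
  set ℱ := prodFiltration F
  set τ : ℤ → (∀ i, Ω i) → WithTop ℕ := fun k => exceedTime l (2 ^ k)
  have hτ : ∀ k, IsStoppingTime ℱ (τ k) := fun k => isStoppingTime_exceedTime hl _
  set χ : ℤ → ℝ≥0∞ := fun k => chiNorm P p (τ k)
  have hχT : ∀ k, χ k ≠ ∞ := fun k => ne_top_of_le_ne_top ENNReal.one_ne_top (chiNorm_le_one hp _)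
  set c : ℤ → ℝ := fun k => 3 * 2 ^ k * (χ k).toReal
  have hc : ∀ k, ‖c k‖ₑ = 3 * 2 ^ k * χ k := fun k => by
    rw [Real.enorm_of_nonneg (by positivity), ENNReal.ofReal_mul (by positivity),
      ENNReal.ofReal_mul (by norm_num), ofReal_two_zpow, ENNReal.ofReal_toReal (hχT k)]
    simp
  set b : ℤ → (∀ i, Ω i) → ℝ := fun k => Filtration.limitProcess (block f l k) ℱ μ
  set a : ℤ → (∀ i, Ω i) → ℝ := fun k => (c k)⁻¹ • b k
  have hb := fun k => hT.block_eq_condExp hf hl h k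
  have hcond : ∀ k, ∀ᵐ x ∂μ, ∀ n, condMart P F (a k) n x = (c k)⁻¹ * block f l k n x := fun k => by
    refine ae_all_iff.2 fun n => ?_
    filter_upwards [condExp_smul (μ := μ) (c k)⁻¹ (b k) (ℱ n), (hb k).2 n] with x h1 h2
    rw [h2]
    exact h1
  have hfin : ∀ k, MeasurableSet (finSet (τ k)) := fun k => by
    have : finSet (τ k) = {x | (2 : ℝ≥0∞) ^ k < limFn l x} := by
      ext x
      exact mem_finSet_exceedTime_zpow
    rw [this]
    exact measurableSet_lt measurable_const
      (Measurable.iSup fun n => ((hl.adapted n).mono (ℱ.le n) le_rfl).ennreal_ofReal)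
  have hblock : ∀ᵐ x ∂μ, ∀ k, T (block f l k) x ≤ 3 * 2 ^ k := by
    filter_upwards [hf.2, ae_all_iff.2 h] with x hx0 hx k
    exact hT.block_le (hl.mono x) hx0 hx k
  have hcb : ∀ᵐ x ∂μ, ∀ k n, c k * condMart P F (a k) n x = block f l k n x := by
    -- Multiplying back by `c k` fails when `c k = 0`; but then `{τ_k < ∞}` is a null set and the
    -- block vanishes off it.
    have hnull : ∀ᵐ x ∂μ, ∀ k, c k = 0 → x ∉ finSet (τ k) := by
      refine ae_all_iff.2 fun k => ?_
      by_cases hck : c k = 0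
      · have hχ0 : χ k = 0 := by
          have h3 : (3 * 2 ^ k : ℝ) ≠ 0 := by positivity
          have := (mul_eq_zero.1 hck).resolve_left h3
          exact ((ENNReal.toReal_eq_zero_iff _).1 this).resolve_right (hχT k)
        filter_upwards [measure_eq_zero_iff_ae_notMem.1
          (measure_eq_zero_of_mixedNorm hp (hfin k) hχ0)] with x hx _ using hx
      · exact Filter.Eventually.of_forall fun x hx => absurd hx hck
    filter_upwards [hnull, ae_all_iff.2 hcond] with x hx hx2 k n
    rw [hx2 k n]
    by_cases hck : c k = 0
    · have htop : τ k x = ⊤ := not_lt_top_iff.1 (hx k hck)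
      rw [block_eq_zero_of_le_exceedTime
        (by rw [show exceedTime l (2 ^ k) x = ⊤ from htop]; exact le_top)]
      simp
    · rw [← mul_assoc, mul_inv_cancel₀ hck, one_mul]
  refine ⟨c, a, τ, ⟨fun k => ⟨?_, (hb k).1.smul _, hτ k, fun n => ?_, ?_⟩, fun n => ?_⟩, ?_⟩
  · exact (Filtration.stronglyMeasurable_limit_process' (μ := μ)).measurable.const_smul (c k)⁻¹
  · filter_upwards [hcond k] with x hx hn
    rw [hx n, block_eq_zero_of_le_exceedTime hn, mul_zero]
  · refine essSup_le_of_ae_le _ ?_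
    filter_upwards [hcond k, hblock] with x hx hx2
    rcases eq_or_ne (χ k) 0 with h0 | h0
    · change _ ≤ (χ k)⁻¹
      simp [h0]
    by_cases hxk : x ∈ finSet (τ k)
    · rw [indicator_of_mem hxk, hT.congr (g := fun n x => (c k)⁻¹ * block f l k n x) hx, hT.smul]
      have h3T : (3 * 2 ^ k : ℝ≥0∞) ≠ ∞ := ENNReal.mul_ne_top (by simp) (two_zpow_ne_top k)
      have h30 : (3 * 2 ^ k : ℝ≥0∞) ≠ 0 := mul_ne_zero (by simp) (two_zpow_pos k).ne'
      have hck : c k ≠ 0 := fun h => by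
        have := hc k
        rw [h, enorm_zero] at this
        exact (mul_ne_zero h30 h0) this.symm
      rw [enorm_inv hck, hc, ENNReal.mul_inv (Or.inl h30) (Or.inl h3T)]
      calc (3 * 2 ^ k)⁻¹ * (χ k)⁻¹ * T (block f l k) x
          ≤ (3 * 2 ^ k)⁻¹ * (χ k)⁻¹ * (3 * 2 ^ k) := by gcongr; exact hx2 k
        _ = (3 * 2 ^ k)⁻¹ * (3 * 2 ^ k) * (χ k)⁻¹ := by ring
        _ = (χ k)⁻¹ := by rw [ENNReal.inv_mul_cancel h30 h3T, one_mul]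
        _ ≤ _ := le_rfl
    · rw [indicator_of_notMem hxk]
      exact zero_le
  · filter_upwards [hcb, hf.2, ae_all_iff.2 h] with x hx hx0 hxt
    simp_rw [hx]
    exact hasSum_block (fun n => hl.nonneg n x) hx0
      (fun j hj => hT.increment_eq_zero (hl.mono x) hx0 hxt hj) n
  · rw [← mixedNorm_const_mul _ _ _ hp]
    refine mixedNorm_mono hp fun x => ?_
    have hterm : ∀ k, (‖c k‖ₑ * (finSet (τ k)).indicator 1 x / chiNorm P p (τ k)) ^ s ≤
        3 ^ s * if (2 : ℝ≥0∞) ^ k < limFn l x then ((2 : ℝ≥0∞) ^ k) ^ s else 0 := fun k => by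
      by_cases hxk : x ∈ finSet (τ k)
      · rw [if_pos (mem_finSet_exceedTime_zpow.1 hxk), indicator_of_mem hxk, Pi.one_apply, mul_one,
          hc, ← ENNReal.mul_rpow_of_nonneg _ _ hs.le]
        refine ENNReal.rpow_le_rpow ?_ hs.le
        rw [mul_div_assoc]
        -- Only an inequality, because `χ k` may be zero and `0 / 0 = 0`.
        exact mul_le_of_le_one_right' ENNReal.div_self_le_one
      · rw [indicator_of_notMem hxk]
        simp [hs]
    calc (∑' k, (‖c k‖ₑ * (finSet (τ k)).indicator 1 x / chiNorm P p (τ k)) ^ s) ^ (1 / s)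
        ≤ (3 ^ s * (dyadicConst s * limFn l x ^ s)) ^ (1 / s) := by
          refine ENNReal.rpow_le_rpow ?_ (by positivity)
          refine (ENNReal.tsum_le_tsum hterm).trans ?_
          rw [ENNReal.tsum_mul_left]
          gcongr
          exact dyadicSum_le hs _
      _ = _ := by
          have hs' : (0 : ℝ) ≤ 1 / s := by positivity
          rw [ENNReal.mul_rpow_of_nonneg _ _ hs', ENNReal.mul_rpow_of_nonneg _ _ hs',
            ← ENNReal.rpow_mul, ← ENNReal.rpow_mul, mul_one_div_cancel hs.ne', ENNReal.rpow_one,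
            ENNReal.rpow_one, ← mul_assoc, ENNReal.coe_mul, ENNReal.coe_rpow_of_nonneg _ hs']
          rfl

end Atoms

/-! ### Equivalence of the quasi-norms. -/

section Equivalence

variable {d : ℕ} {Ω : Fin d → Type u} [m : ∀ i, MeasurableSpace (Ω i)]
  {P : ∀ i, Measure (Ω i)} [∀ i, IsProbabilityMeasure (P i)]
  {F : ∀ i, Filtration ℕ (m i)} {p : Fin d → ℝ}
  {T : (ℕ → (∀ i, Ω i) → ℝ) → (∀ i, Ω i) → ℝ≥0∞} {t : (ℕ → (∀ i, Ω i) → ℝ) → ℕ → (∀ i, Ω i) → ℝ}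

theorem IsHardyOp.exists_control (hT : IsHardyOp T t) (hd : 1 ≤ d)
    (hreg : IsRegular (prodFiltration F) (Measure.pi P)) (hp : ∀ i, 0 < p i) :
    ∃ C : ℝ≥0, ∀ f, IsMart (prodFiltration F) (Measure.pi P) f →
      ∃ l, (IsControl (prodFiltration F) l ∧ ∀ n, ∀ᵐ x ∂Measure.pi P, t f (n + 1) x ≤ l n x) ∧
        mixedNorm Ω m P p (limFn l) ≤ C * mixedNorm Ω m P p (T f) := by
  obtain ⟨C, hC⟩ := MixedHardy.exists_control hd P F hreg hp
  refine ⟨C, fun f hf => ?_⟩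
  have hm : ∀ n, Measurable[prodFiltration F n] (f n) := fun n =>
    (hf.1.stronglyMeasurable n).measurable
  obtain ⟨l, h1, h2, h3⟩ := hC (t f) (T f) (hT.measurable hm) (hT.adapted hm)
    (hT.integrable hf.1.integrable) fun n x => by
      rw [hT.eq_iSup]
      exact le_iSup (fun n => ENNReal.ofReal (t f n x)) n
  exact ⟨l, ⟨h1, h2⟩, h3⟩

theorem IsHardyOp.mixedNorm_le_limFn (hT : IsHardyOp T t) (hp : ∀ i, 0 < p i)
    {f l : ℕ → (∀ i, Ω i) → ℝ} (hf : IsMart (prodFiltration F) (Measure.pi P) f)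
    (h : ∀ n, ∀ᵐ x ∂Measure.pi P, t f (n + 1) x ≤ l n x) :
    mixedNorm Ω m P p (T f) ≤ mixedNorm Ω m P p (limFn l) := by
  refine mixedNorm_ae_mono hp ?_
  filter_upwards [hf.2, ae_all_iff.2 h] with x hx0 hx
  exact hT.le_limFn hx0 hx

theorem IsHardyOp.atomic_characterization (hT : IsHardyOp T t) (hd : 1 ≤ d)
    (hreg : IsRegular (prodFiltration F) (Measure.pi P)) (hp : ∀ i, 0 < p i) {s : ℝ} (hs : 0 < s)
    (hs1 : s ≤ 1) :
    (∀ f, IsMart (prodFiltration F) (Measure.pi P) f →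
      (f ∈ {f | IsMart (prodFiltration F) (Measure.pi P) f ∧ mixedNorm Ω m P p (T f) < ∞} ↔
        ∃ c a τ, IsDecomp P F p T f c a τ ∧ atomicSize P p s c τ < ∞)) ∧
    EquivOn {f | IsMart (prodFiltration F) (Measure.pi P) f ∧ mixedNorm Ω m P p (T f) < ∞}
      (fun f => mixedNorm Ω m P p (T f)) (atomicInf P F p T s) := by
  obtain ⟨C, hC⟩ := hT.exists_control (p := p) hd hreg hp
  set D : ℝ≥0 := 3 * dyadicConst s ^ (1 / s) * C
  have key : ∀ f, IsMart (prodFiltration F) (Measure.pi P) f → ∃ c a τ, IsDecomp P F p T f c a τ ∧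
      atomicSize P p s c τ ≤ D * mixedNorm Ω m P p (T f) := fun f hf => by
    obtain ⟨l, ⟨hl, hfl⟩, hlT⟩ := hC f hf
    obtain ⟨c, a, τ, h1, h2⟩ := hT.exists_decomp hp hs hf hl hfl
    refine ⟨c, a, τ, h1, h2.trans ?_⟩
    rw [show (D : ℝ≥0∞) = (3 * dyadicConst s ^ (1 / s) : ℝ≥0) * C from ENNReal.coe_mul _ _,
      mul_assoc]
    exact mul_le_mul_right hlT _
  -- The summand `1` makes the upper constant positive, since `C`, and hence `D`, might be zero.
  refine ⟨fun f hf => ⟨fun h => ?_, ?_⟩, 1, D + 1, one_pos, by positivity, fun f hf => ⟨?_, ?_⟩⟩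
  · obtain ⟨c, a, τ, h1, h2⟩ := key f hf
    exact ⟨c, a, τ, h1, h2.trans_lt (ENNReal.mul_lt_top ENNReal.coe_lt_top h.2)⟩
  · rintro ⟨c, a, τ, h1, h2⟩
    exact ⟨hf, (hT.le_atomicSize hp hs hs1 h1).trans_lt h2⟩
  · rw [ENNReal.coe_one, one_mul]
    exact le_iInf fun c => le_iInf fun a => le_iInf fun τ => le_iInf fun h =>
      hT.le_atomicSize hp hs hs1 h
  · obtain ⟨c, a, τ, h1, h2⟩ := key f hf.1
    have h3 : atomicInf P F p T s f ≤ D * mixedNorm Ω m P p (T f) :=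
      iInf_le_of_le c (iInf_le_of_le a (iInf_le_of_le τ (iInf_le_of_le h1 h2)))
    refine h3.trans ?_
    gcongr
    exact le_self_add

theorem IsHardyOp.control_characterization (hT : IsHardyOp T t) (hd : 1 ≤ d)
    (hreg : IsRegular (prodFiltration F) (Measure.pi P)) (hp : ∀ i, 0 < p i) :
    {f | IsMart (prodFiltration F) (Measure.pi P) f ∧ mixedNorm Ω m P p (T f) < ∞} =
      {f | IsMart (prodFiltration F) (Measure.pi P) f ∧
        ∃ l, (IsControl (prodFiltration F) l ∧ ∀ n, ∀ᵐ x ∂Measure.pi P, t f (n + 1) x ≤ l n x) ∧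
          mixedNorm Ω m P p (limFn l) < ∞} ∧
    EquivOn {f | IsMart (prodFiltration F) (Measure.pi P) f ∧ mixedNorm Ω m P p (T f) < ∞}
      (fun f => mixedNorm Ω m P p (T f))
      (fun f => ⨅ (l : ℕ → (∀ i, Ω i) → ℝ) (_ : IsControl (prodFiltration F) l ∧
        ∀ n, ∀ᵐ x ∂Measure.pi P, t f (n + 1) x ≤ l n x), mixedNorm Ω m P p (limFn l)) := by
  obtain ⟨C, hC⟩ := hT.exists_control (p := p) hd hreg hp
  refine ⟨Set.ext fun f => and_congr_right fun hf => ⟨fun h => ?_, ?_⟩, 1, C + 1, one_pos,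
    by positivity, fun f hf => ⟨?_, ?_⟩⟩
  · obtain ⟨l, h1, h2⟩ := hC f hf
    exact ⟨l, h1, h2.trans_lt (ENNReal.mul_lt_top ENNReal.coe_lt_top h)⟩
  · rintro ⟨l, h1, h2⟩
    exact (hT.mixedNorm_le_limFn hp hf h1.2).trans_lt h2
  · rw [ENNReal.coe_one, one_mul]
    exact le_iInf fun l => le_iInf fun h => hT.mixedNorm_le_limFn hp hf.1 h.2
  · obtain ⟨l, h1, h2⟩ := hC f hf.1
    refine (iInf₂_le l h1).trans (h2.trans ?_)
    gcongr
    exact le_self_add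

end Equivalence

end MixedHardy

end

theorem theorem6 {d : ℕ} (hd : 1 ≤ d) {Ω : Fin d → Type*} [m : ∀ i, MeasurableSpace (Ω i)]
    (P : ∀ i, Measure (Ω i)) [∀ i, IsProbabilityMeasure (P i)]
    (F : ∀ i, Filtration ℕ (m i)) (hF : ∀ i, ⨆ n, F i n = m i)
    (hreg : MixedHardy.IsRegular (MixedHardy.prodFiltration F) (Measure.pi P))
    (p : Fin d → ℝ) (hp : ∀ i, 0 < p i) :
    (∀ t : ℝ, 0 < t → t < 1 → (∀ i, t < p i) →
      ((∀ f, MixedHardy.IsMart (MixedHardy.prodFiltration F) (Measure.pi P) f →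
          (f ∈ MixedHardy.spaceHM P F p ↔
            ∃ c a τ, MixedHardy.IsDecomp P F p MixedHardy.maxFn f c a τ ∧
              MixedHardy.atomicSize P p t c τ < ∞)) ∧
        MixedHardy.EquivOn (MixedHardy.spaceHM P F p) (MixedHardy.normHM P p)
          (MixedHardy.atomicInf P F p MixedHardy.maxFn t)) ∧
      ((∀ f, MixedHardy.IsMart (MixedHardy.prodFiltration F) (Measure.pi P) f →
          (f ∈ MixedHardy.spaceHS P F p ↔
            ∃ c a τ, MixedHardy.IsDecomp P F p MixedHardy.sqFn f c a τ ∧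
              MixedHardy.atomicSize P p t c τ < ∞)) ∧
        MixedHardy.EquivOn (MixedHardy.spaceHS P F p) (MixedHardy.normHS P p)
          (MixedHardy.atomicInf P F p MixedHardy.sqFn t))) ∧
    (MixedHardy.spaceHS P F p = MixedHardy.spaceQ P F p ∧
      MixedHardy.EquivOn (MixedHardy.spaceHS P F p) (MixedHardy.normHS P p)
        (MixedHardy.normQ P F p)) ∧
    (MixedHardy.spaceHM P F p = MixedHardy.spaceP P F p ∧
      MixedHardy.EquivOn (MixedHardy.spaceHM P F p) (MixedHardy.normHM P p)
        (MixedHardy.normP P F p)) := by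
  -- The four concrete spaces and quasi-norms unfold definitionally to the statements for `maxFn`
  -- and `sqFn`.
  refine ⟨fun t ht ht1 _ => ⟨?_, ?_⟩, ?_, ?_⟩
  · exact MixedHardy.isHardyOp_maxFn.atomic_characterization hd hreg hp ht ht1.le
  · exact MixedHardy.isHardyOp_sqFn.atomic_characterization hd hreg hp ht ht1.le
  · exact MixedHardy.isHardyOp_sqFn.control_characterization hd hreg hp
  · exact MixedHardy.isHardyOp_maxFn.control_characterization hd hreg hp
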